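/- **Setting.** There are $n$ ad networks, $M$ slots with known discount rates $1\ge\varrho_1\ge\dots\ge\varrho_M\ge 0$, a finite set $U_I$ of impressions and a finite set $U_B$ of non-negative bid values with maximum $L$. In each of $m$ time steps an impression $j\in U_I$ arrives, independently with an unknown distribution $q$ on $U_I$; given $j$, the bids of the networks are independent, network $i$ bidding $v$ with known probability $p_{ijv}$. On each arrival a (possibly randomized and adaptive) policy chooses, from the past impressions, the bids received so far and the current impression, a set $S$ of networks to call out; it then sees the bids of the networks in $S$, and its value is $\sum_\ell \varrho_\ell b_{(\ell)}$, where $b_{(1)}\ge b_{(2)}\ge\cdots$ are the bids of $S$ in decreasing order. The policy is *admissible* if each network $i$ is called out at most $\rho_i m$ times in the $m$ arrivals, where $\rho_i\in[0,1]$ is known. Its *performance* is its expected total value per arrival. Policies in the comparison class may know $q$. **LP-Val.** For an impression $j$ and prices $c\in\mathbb R^n$ let $\mathrm{LP}_j(c)$ be the maximum of $\sum_{i,v,\ell} v\varrho_\ell y_{iv\ell}-\sum_i c_i x_i$ over $x,y\ge 0$ with $\sum_{i,v}y_{iv\ell}\le 1$, $x_i\le 1$ and $\sum_\ell y_{iv\ell}\le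 p_{ijv}x_i$. Every arrival $s$ is given an independent random perturbation $\omega_s$, uniform in $[0,\eta]^n$. *Exploration:* LP-Val observes the first $t$ impressions $j_1,\dots,j_t$ without calling out and computes optimum Lagrange multipliers $\hat\lambda$ of the sampled LP, that is, a minimizer over $\lambda\ge 0$ of $\sum_i\lambda_i\kappa_i\rho_i+\frac1t\sum_{s\le t}\mathrm{LP}_{j_s}(\lambda+\omega_s)$, for suitable scaling factors $\kappa_i\in[0,1]$ of the global constraints, determined from the sample and the known data. *Exploitation:* on each later arrival $s$ with impression $j$ it computes an optimal solution $(x,y)$ of $\mathrm{LP}_j(\hat\lambda+\omega_s)$ and calls out each network $i$ independently with probability $x_i$, provided that this respects the bound $\rho_i m$. **Theorem.** There are absolute constants $C>0$ and $k\in\mathbb N$ such that the following holds for every such problem, all $\delta,\varepsilon>0$ and, with $X=\frac{n^2L}{\delta\varepsilon}$, every sample size $t\ge C\,X\log^k(2+X)$. There are a perturbation size $\eta>0$ with $n\eta\le\varepsilon\delta$ and a learning rule for $\hat\lambda$ as above, neither depending on $q$ or $m$, such that for every distribution $q$ on $U_I$, every $m\ge Ct/\varepsilon$ and every (measurable) choice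 of the optimal solutions of the LPs: if some admissible policy has performance at least $\delta$, then LP-Val is admissible and its performance is at least $\left(1-\frac1e-\varepsilon\right)$ times that of every admissible policy. -/

import Mathlib

open MeasureTheory

/-- The data of a selective call-out problem known to the exchange: `n` ad networks, `M` slots,
impressions in `ι`. -/
structure Exchange (n M : ℕ) (ι : Type) where
  /-- the finite set of bid values -/
  bids : Finset ℝ
  bids_nonempty : bids.Nonempty
  bids_nonneg : ∀ v ∈ bids, 0 ≤ v
  /-- `prob i j v` is the probability that network `i`, called out on impression `j`, bids `v` -/
  prob : Fin n → ι → bids → ℝ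
  prob_mem : ∀ i j, prob i j ∈ stdSimplex ℝ bids
  /-- the discount rates of the slots, `1 ≥ ϱ₁ ≥ ϱ₂ ≥ ⋯ ≥ 0` -/
  discount : Fin M → ℝ
  discount_antitone : Antitone discount
  discount_nonneg : ∀ l, 0 ≤ discount l
  discount_le_one : ∀ l, discount l ≤ 1
  /-- the call-out rates: in `m` arrivals, network `i` may be called out at most `rate i * m`
  times -/
  rate : Fin n → ℝ
  rate_nonneg : ∀ i, 0 ≤ rate i
  rate_le_one : ∀ i, rate i ≤ 1

namespace Exchange

noncomputable section

variable {n M : ℕ} {ι : Type}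

/-- The largest possible bid `L`. -/
def maxBid (E : Exchange n M ι) : ℝ := E.bids.max' E.bids_nonempty

/-! ### Policies and their performance -/

/-- An arrival: the impression, and the bid that each network would return if called out. -/
abbrev Arrival (E : Exchange n M ι) : Type := ι × (Fin n → E.bids)

/-- What the exchange has seen of a past arrival: the impression, and the bids of exactly those
networks that were called out. -/
abbrev Round (E : Exchange n M ι) : Type := ι × (Fin n → Option E.bids)

/-- The observation made when the networks in `S` are called out on arrival `a`. -/
def observe (E : Exchange n M ι) (S : Finset (Fin n)) (a : E.Arrival) : E.Round :=
  (a.1, fun i => if i ∈ S then some (a.2 i) else none)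

/-- The number of past rounds (listed in `h`) in which network `i` was called out. -/
def callCount (E : Exchange n M ι) (i : Fin n) (h : List E.Round) : ℕ :=
  h.countP fun r => (r.2 i).isSome

/-- The value obtained from calling out `S` when the bids are `b`: the slots are filled in
decreasing order of the bids received. -/
def slotValue (E : Exchange n M ι) (S : Finset (Fin n)) (b : Fin n → E.bids) : ℝ :=
  (List.zipWith (fun d v => d * v) (List.ofFn E.discount)
    ((S.val.map fun i => (b i : ℝ)).sort fun v w => v ≥ w)).sum

/-- A nonanticipating call-out rule: from the past rounds, most recent first, and the current
impression, it determines the set of networks to call out. -/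
abbrev Rule (E : Exchange n M ι) : Type := List E.Round → ι → Finset (Fin n)

/-- The rounds seen by a rule facing a list of arrivals, both most recent first. -/
def play (E : Exchange n M ι) (R : E.Rule) : List E.Arrival → List E.Round
  | [] => []
  | a :: as => E.observe (R (E.play R as) a.1) a :: E.play R as

/-- The total value that a rule obtains from a list of arrivals, most recent first. -/
def totalValue (E : Exchange n M ι) (R : E.Rule) : List E.Arrival → ℝ
  | [] => 0
  | a :: as => E.slotValue (R (E.play R as) a.1) a.2 + E.totalValue R as

/-- The probability of an arrival when impressions have distribution `q`; given the impression,
the bids of the networks are independent. -/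
def arrivalProb (E : Exchange n M ι) (q : ι → ℝ) (a : E.Arrival) : ℝ :=
  q a.1 * ∏ i, E.prob i a.1 (a.2 i)

/-- The expected value per arrival that a rule obtains from `m` i.i.d. arrivals. -/
def ruleValue (E : Exchange n M ι) [Fintype ι] (q : ι → ℝ) (m : ℕ) (R : E.Rule) : ℝ :=
  (∑ a : Fin m → E.Arrival, (∏ s, E.arrivalProb q (a s)) * E.totalValue R (List.ofFn a)) / m

/-- A randomized call-out policy: a random seed selects a rule. -/
structure Policy (E : Exchange n M ι) where
  Seed : Type
  [measurableSpace : MeasurableSpace Seed]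
  law : Measure Seed
  [isProbabilityMeasure : IsProbabilityMeasure law]
  rule : Seed → E.Rule

attribute [instance] Policy.measurableSpace Policy.isProbabilityMeasure

/-- The policy is admissible for `m` arrivals: it depends measurably on its seed, and whatever
arrives, it calls out each network `i` at most `rate i * m` times. -/
def Policy.Admissible {E : Exchange n M ι} (P : E.Policy) (m : ℕ) : Prop :=
  (∀ h j S, MeasurableSet {θ | P.rule θ h j = S}) ∧
  ∀ᵐ θ ∂P.law, ∀ as : List E.Arrival, as.length = m →
    ∀ i, (E.callCount i (E.play (P.rule θ) as) : ℝ) ≤ E.rate i * m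

/-- The performance of a policy: its expected total value per arriving impression. -/
def Policy.value {E : Exchange n M ι} [Fintype ι] (P : E.Policy) (q : ι → ℝ) (m : ℕ) : ℝ :=
  ∫ θ, E.ruleValue q m (P.rule θ) ∂P.law

/-! ### The decoupled linear programs -/

/-- The local constraints of the LP relaxation for impression `j`: `x i` is the probability that
`i` is called out, `y i v l` that `i` bids `v` and is given slot `l`. -/
structure Feasible (E : Exchange n M ι) (j : ι) (x : Fin n → ℝ)
    (y : Fin n → E.bids → Fin M → ℝ) : Prop where
  slot_le : ∀ l, ∑ i, ∑ v, y i v l ≤ 1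
  x_le : ∀ i, x i ≤ 1
  y_le : ∀ i v, ∑ l, y i v l ≤ E.prob i j v * x i
  x_nonneg : ∀ i, 0 ≤ x i
  y_nonneg : ∀ i v l, 0 ≤ y i v l

/-- The objective of the decoupled LP at call-out prices `c`. -/
def objective (E : Exchange n M ι) (c x : Fin n → ℝ) (y : Fin n → E.bids → Fin M → ℝ) : ℝ :=
  ∑ v : E.bids, ∑ i, ∑ l, (v : ℝ) * E.discount l * y i v l - ∑ i, c i * x i

/-- The optimum of the decoupled LP of impression `j` at call-out prices `c`. -/
def lpValue (E : Exchange n M ι) (j : ι) (c : Fin n → ℝ) : ℝ :=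
  sSup {z | ∃ x y, E.Feasible j x y ∧ E.objective c x y = z}

/-- `x` is the call-out part of an optimal solution of the decoupled LP. -/
def IsOptimalCallOut (E : Exchange n M ι) (j : ι) (c x : Fin n → ℝ) : Prop :=
  ∃ y, E.Feasible j x y ∧
    ∀ x' y', E.Feasible j x' y' → E.objective c x' y' ≤ E.objective c x y

/-- A method of solving the decoupled LPs: an optimal solution, measurable in the prices. -/
def IsSolver (E : Exchange n M ι) (solve : ι → (Fin n → ℝ) → Fin n → ℝ) : Prop :=
  ∀ j, Measurable (solve j) ∧ ∀ c, E.IsOptimalCallOut j c (solve j c)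

/-- A sample of `t` impressions, each with the small random perturbation of its call-out prices
that is used to obtain unique LP optima. -/
abbrev Sample (_E : Exchange n M ι) (t : ℕ) : Type := Fin t → ι × (Fin n → ℝ)

/-- The Lagrangian dual function of the sampled LP with global constraints
`(1/t) ∑ₛ x i s ≤ b i`. -/
def sampleDual (E : Exchange n M ι) {t : ℕ} (σ : E.Sample t) (b lam : Fin n → ℝ) : ℝ :=
  ∑ i, lam i * b i + (∑ s, E.lpValue (σ s).1 (lam + (σ s).2)) / t

/-- `lam` is a vector of optimum Lagrangian multipliers of the sampled LP with bounds `b`. -/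
def IsOptimalMultiplier (E : Exchange n M ι) {t : ℕ} (σ : E.Sample t) (b lam : Fin n → ℝ) :
    Prop :=
  0 ≤ lam ∧ ∀ lam', 0 ≤ lam' → E.sampleDual σ b lam ≤ E.sampleDual σ b lam'

/-- A learning rule: it computes from the sample optimum Lagrangian multipliers of the sampled LP
with suitably scaled global constraints (`κ i ∈ [0, 1]` are the scaling factors), measurably in
the perturbations. -/
def IsLearner (E : Exchange n M ι) (t : ℕ) (learn : E.Sample t → Fin n → ℝ) : Prop :=
  (∀ j : Fin t → ι, Measurable fun w : Fin t → Fin n → ℝ => learn fun s => (j s, w s)) ∧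
  ∃ κ : E.Sample t → Fin n → ℝ, ∀ σ, (∀ i, 0 ≤ κ σ i ∧ κ σ i ≤ 1) ∧
    E.IsOptimalMultiplier σ (fun i => κ σ i * E.rate i) (learn σ)

/-! ### The algorithm LP-Val -/

/-- The internal randomness of LP-Val: for each arrival and each network two independent uniform
numbers in `[0, 1]`, for the perturbation and for the call-out decision. -/
abbrev LPSeed (n m : ℕ) : Type := Fin m → Fin n → unitInterval × unitInterval

/-- The perturbation, uniform in `[0, η]`, of the price of each network at arrival number `s`. -/
def perturbation {m : ℕ} (η : ℝ) (θ : LPSeed n m) (s : ℕ) (i : Fin n) : ℝ :=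
  if hs : s < m then η * (θ ⟨s, hs⟩ i).1 else 0

/-- The random number that decides on calling out network `i` at arrival number `s`. -/
def coin {m : ℕ} (θ : LPSeed n m) (s : ℕ) (i : Fin n) : ℝ :=
  if hs : s < m then (θ ⟨s, hs⟩ i).2 else 1

/-- The sample formed by the first `t` impressions of the history `h` (most recent first). -/
def sampleOf (E : Exchange n M ι) {m : ℕ} (t : ℕ) (η : ℝ) (θ : LPSeed n m) (h : List E.Round)
    (hh : t ≤ h.length) : E.Sample t :=
  fun s => ((h.reverse[(s : ℕ)]'(by simpa using lt_of_lt_of_le s.2 hh)).1, perturbation η θ s)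

/-- The rule of LP-Val. Exploration: observe the first `t` impressions without calling out.
Exploitation: on each later impression solve its decoupled LP at the learned multipliers (plus the
perturbation), and call out each network independently with its probability `x i` in the solution,
as long as its call-out constraint permits. -/
def lpValRule (E : Exchange n M ι) (m t : ℕ) (η : ℝ) (learn : E.Sample t → Fin n → ℝ)
    (solve : ι → (Fin n → ℝ) → Fin n → ℝ) (θ : LPSeed n m) : E.Rule := fun h j =>
  open scoped Classical in
  if hh : t ≤ h.length then
    Finset.univ.filter fun i =>
      coin θ h.length i <
        solve j (learn (E.sampleOf t η θ h hh) + perturbation η θ h.length) i ∧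
      (E.callCount i h + 1 : ℝ) ≤ E.rate i * m
  else ∅

/-- LP-Val as a randomized call-out policy for `m` arrivals. -/
def lpVal (E : Exchange n M ι) (m t : ℕ) (η : ℝ) (learn : E.Sample t → Fin n → ℝ)
    (solve : ι → (Fin n → ℝ) → Fin n → ℝ) : E.Policy where
  Seed := LPSeed n m
  law := volume
  rule := E.lpValRule m t η learn solve

/-- The quantity `n² L / (δ ε)` governing the sample size. -/
def sampleScale (E : Exchange n M ι) (δ ε : ℝ) : ℝ := (n : ℝ) ^ 2 * E.maxBid / (δ * ε)

end

end Exchange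

/-! Write L for the largest bid, and U_i, Q_i for the means of x_i and x_i² over impressions and
perturbations at prices λ. By weak duality, every admissible policy performs at most D(λ) = Σ_j q_j
LP_j(λ) + Σ_i λ_i ρ_i, for every λ ≥ 0 (`IsSolver.value_le`). It therefore suffices that LP-Val
earns nearly (1 - 1/e) D(λ) at the multipliers λ that it learns.

Rounding an LP solution independently keeps 1 - 1/e of its value and, beyond that, a surplus
quadratic in the parts of the single networks (`Feasible.le_roundValue`). An optimal solution never
pays more for a network than the network contributes, so the surplus is at least Σ λ_i² Q_i / (32
L). By `IsSolver.le_sum_expContribution`, one step at prices λ earns at least (1 - 1/e)(D(λ) - nη -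
Σ λ_i(ρ_i - U_i)) + Σ λ_i² Q_i / (32 L). A wasted budget λ_i(ρ_i - U_i) of at most λ_i² Q_i / (64 L)
plus O(εδ/n) is thus paid for by the surplus and a small additive loss.

This makes a sample size linear in X, up to logarithms, sufficient. A Bernstein-type bound shows
that λ_i times the deviation of the sampled use from U_i is at most λ_i² Q_i / (576 L) + O(Lτ/t),
except with probability about e^{-τ}. A safety margin proportional to λ_i² Q_i / L absorbs the
variance term. A union bound over a grid of K^n prices takes τ of order n log K + log(n/ε), and an
additive error of order εδ/n then needs t of order n² L log K / (δε).

The multipliers are sought on the grid: for every network, the sampled value of unused budget minus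
safety margin should be nearly zero. This excess is negative at price 0, and nonnegative at price
2L, where the network is never called out (a network too poor for this is priced at 2L for good).
Averaging over the perturbation makes it Lipschitz in λ, with a constant of order 1/η, so a discrete
Poincaré–Miranda argument, the cubical Sperner lemma `exists_cube_of_labels`, yields a grid point
(`IsSolver.exists_gridPrice`). Any λ ≥ 0 is an optimum multiplier for the bounds given by its own
sampled use. Scaling ρ_i down to that use therefore makes the choice a legitimate learning rule,
provided that the use is at most ρ_i on the sample, and this is checked.

In exploitation U_i ≤ ρ_i holds with high probability. A second moment bound controls the demand cut
off by the capacities, and by submodularity an exhausted network only raises the marginal values of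
the others (`le_listExp_exploitValue`). The learner is built from one solver and LP-Val may use
another. This is harmless, since U_i and Q_i do not depend on the solver (`IsSolver.avgUse_eq`). -/

/-! ### A cubical Sperner lemma -/

namespace CubicalSperner

variable {n : ℕ}

/-- Translation of a function on the grid by one step in direction `k`. -/
def shift (k : Fin n) (f : (Fin n → ℕ) → ZMod 2) : (Fin n → ℕ) → ZMod 2 :=
  fun y => f (y + Pi.single k 1)

/-- The difference of a function on the grid in direction `k`. -/
def diff (k : Fin n) (f : (Fin n → ℕ) → ZMod 2) : (Fin n → ℕ) → ZMod 2 :=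
  fun y => f (y + Pi.single k 1) - f y

/-- The cup product of the coboundaries of the functions `fs`, on cubes with directions `s`. -/
def cup : List ((Fin n → ℕ) → ZMod 2) → Finset (Fin n) → (Fin n → ℕ) → ZMod 2
  | [], _ => fun _ => 1
  | f :: fs, s => fun y => ∑ k ∈ s, diff k f y * shift k (cup fs (s.erase k)) y

/-- The pairs (k, a) and (a, k) contribute equally, so they cancel modulo 2. -/
theorem sum_symm_eq_zero (s : Finset (Fin n)) (F : Fin n → Fin n → ZMod 2)
    (hF : ∀ a b, F a b = F b a) : ∑ k ∈ s, ∑ a ∈ s.erase k, F k a = 0 := by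
  rw [Finset.sum_sigma']
  refine Finset.sum_involution (fun p _ => ⟨p.2, p.1⟩) ?_ ?_ ?_ ?_
  · rintro ⟨a, b⟩ _
    simp only [hF b a]
    exact CharTwo.add_self_eq_zero _
  · rintro ⟨a, b⟩ h _ h2
    simp only [Finset.mem_sigma, Finset.mem_erase] at h
    simp only [Sigma.mk.injEq] at h2
    exact h.2.1 h2.1
  · rintro ⟨a, b⟩ h
    simp only [Finset.mem_sigma, Finset.mem_erase] at h ⊢
    exact ⟨h.2.2, fun e => h.2.1 e.symm, h.1⟩
  · rintro ⟨a, b⟩ _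
    rfl

/-- A cup product of coboundaries is a cocycle, by the Leibniz rule and induction on the number of
factors. -/
theorem cup_closed (fs : List ((Fin n → ℕ) → ZMod 2)) : ∀ (s : Finset (Fin n)) (y : Fin n → ℕ),
    ∑ k ∈ s, diff k (cup fs (s.erase k)) y = 0 := by
  induction fs with
  | nil => intro s y; simp [diff, cup]
  | cons f fs ih =>
    intro s y
    -- Leibniz rule d(df ∪ ω) = ddf ∪ ω + df ∪ dω. The first sum vanishes because second differences
    -- are symmetric in the two directions, the second by the induction hypothesis.
    have key : ∀ k ∈ s, diff k (cup (f :: fs) (s.erase k)) y =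
        (∑ a ∈ s.erase k, (diff k (diff a f) y *
          cup fs ((s.erase k).erase a) (y + Pi.single k 1 + Pi.single a 1))) +
        ∑ a ∈ s.erase k, diff a f y *
          diff k (cup fs ((s.erase k).erase a)) (y + Pi.single a 1) := by
      intro k _
      simp only [diff, cup, shift]
      rw [← Finset.sum_sub_distrib, ← Finset.sum_add_distrib]
      refine Finset.sum_congr rfl fun a _ => ?_
      rw [add_right_comm y (Pi.single a 1) (Pi.single k 1)]
      ring
    rw [Finset.sum_congr rfl key, Finset.sum_add_distrib, sum_symm_eq_zero, zero_add]
    · have : ∑ k ∈ s, ∑ a ∈ s.erase k, diff a f y *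
            diff k (cup fs ((s.erase k).erase a)) (y + Pi.single a 1) =
          ∑ a ∈ s, ∑ k ∈ s.erase a, diff a f y *
            diff k (cup fs ((s.erase a).erase k)) (y + Pi.single a 1) := by
        rw [Finset.sum_comm' (t' := s) (s' := fun a => s.erase a)]
        · refine Finset.sum_congr rfl fun a _ => Finset.sum_congr rfl fun k _ => ?_
          rw [Finset.erase_right_comm]
        · intro a b
          simp only [Finset.mem_erase]
          tauto
      rw [this]
      refine Finset.sum_eq_zero fun a _ => ?_
      rw [← Finset.mul_sum, ih, mul_zero]
    · intro a b
      simp only [diff]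
      rw [add_right_comm y (Pi.single b 1) (Pi.single a 1), Finset.erase_right_comm]
      ring

/-- `r` is a vertex of the unit cube at `y` with directions `s`. -/
def InCube (s : Finset (Fin n)) (y r : Fin n → ℕ) : Prop :=
  ∀ i, y i ≤ r i ∧ r i ≤ y i + if i ∈ s then 1 else 0

theorem InCube.step {s : Finset (Fin n)} {y r : Fin n → ℕ} {k : Fin n} (hk : k ∈ s)
    (h : InCube (s.erase k) (y + Pi.single k 1) r) : InCube s y r := by
  intro i
  obtain ⟨h1, h2⟩ := h i
  by_cases hik : i = k
  · subst hik; simp at h1 h2; simp [hk]; omega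
  · simp only [Pi.add_apply, Pi.single_apply, hik, if_false, add_zero, Finset.mem_erase, ne_eq,
      not_false_eq_true, true_and] at h1 h2
    exact ⟨h1, h2⟩

/-- The coboundary of a function that is constant on a cube vanishes on all edges of that cube, and
every term of the product contains such a factor. -/
theorem cup_eq_zero (fs : List ((Fin n → ℕ) → ZMod 2)) {f : (Fin n → ℕ) → ZMod 2} (hf : f ∈ fs) :
    ∀ (s : Finset (Fin n)) (y : Fin n → ℕ) (c : ZMod 2), (∀ r, InCube s y r → f r = c) →
      cup fs s y = 0 := by
  induction fs with
  | nil => simp at hf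
  | cons g fs ih =>
    intro s y c hc
    simp only [cup]
    refine Finset.sum_eq_zero fun k hk => ?_
    rcases List.mem_cons.1 hf with rfl | hf
    · rw [diff, hc y, hc (y + Pi.single k 1), sub_self, zero_mul]
      · intro i
        by_cases hik : i = k
        · subst hik; simp [hk]
        · simp [hik]
      · intro i; simp
    · rw [shift, ih hf _ _ c fun r hr => hc r (hr.step hk), mul_zero]

/-- The grid points with coordinates in `range K` in the directions `s`, and `K` in the others. -/
def grid (K : ℕ) (s : Finset (Fin n)) : Finset (Fin n → ℕ) :=
  Fintype.piFinset fun i => if i ∈ s then Finset.range K else {K}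

theorem sum_grid (K : ℕ) {s : Finset (Fin n)} {k : Fin n} (hk : k ∈ s)
    (F : (Fin n → ℕ) → ZMod 2) :
    ∑ y ∈ grid K s, F y = ∑ y ∈ grid K (s.erase k), ∑ c ∈ Finset.range K,
      F (Function.update y k c) := by
  rw [Finset.sum_sigma']
  refine Finset.sum_bij' (fun y _ => ⟨Function.update y k K, y k⟩)
    (fun p _ => Function.update p.1 k p.2) ?_ ?_ ?_ ?_ ?_
  · intro y hy
    simp only [grid, Fintype.mem_piFinset, Finset.mem_sigma] at hy ⊢
    refine ⟨fun i => ?_, by simpa [hk] using hy k⟩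
    by_cases hik : i = k
    · subst hik; simp
    · simpa [hik] using hy i
  · rintro ⟨y, c⟩ hy
    simp only [grid, Fintype.mem_piFinset, Finset.mem_sigma] at hy ⊢
    intro i
    by_cases hik : i = k
    · subst hik; simpa [hk] using hy.2
    · simpa [hik] using hy.1 i
  · intro y _; simp
  · rintro ⟨y, c⟩ hy
    simp only [grid, Fintype.mem_piFinset, Finset.mem_sigma] at hy
    have : y k = K := by simpa using hy.1 k
    simp [← this]
  · intro y _; simp

/-- Telescoping along direction k, the one-dimensional case of Stokes' theorem. -/
theorem sum_grid_diff (K : ℕ) {s : Finset (Fin n)} {k : Fin n} (hk : k ∈ s)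
    (G : (Fin n → ℕ) → ZMod 2) :
    ∑ y ∈ grid K s, diff k G y = ∑ y ∈ grid K (s.erase k),
      (G y - G (Function.update y k 0)) := by
  rw [sum_grid K hk]
  refine Finset.sum_congr rfl fun y hy => ?_
  have hyk : y k = K := by
    simp only [grid, Fintype.mem_piFinset] at hy
    simpa using hy k
  have : ∀ c, diff k G (Function.update y k c) =
      G (Function.update y k (c + 1)) - G (Function.update y k c) := by
    intro c
    simp only [diff]
    congr 2
    ext i
    by_cases hik : i = k
    · subst hik; simp
    · simp [hik]
  simp only [this, Finset.sum_range_sub (fun c => G (Function.update y k c))]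
  rw [← hyk, Function.update_eq_self]

/-- Stokes' theorem, by induction on the dimension: the product is the coboundary of the first label
times the cup product of the others, so its sum over the grid is a sum over the boundary faces. Only
the far face in the direction of the first label survives. -/
theorem sum_cup (K : ℕ) (l : Fin n → (Fin n → ℕ) → ZMod 2)
    (h0 : ∀ i y, y i = 0 → l i y = 0) (hK : ∀ i y, y i = K → l i y = 1) (ks : List (Fin n)) :
    ks.Nodup → ∑ y ∈ grid K ks.toFinset, cup (ks.map l) ks.toFinset y = 1 := by
  induction ks with
  | nil =>
    intro _
    simp [cup, grid]
  | cons k₁ ks ih =>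
    intro hnd
    have hk₁ : k₁ ∉ ks := (List.nodup_cons.1 hnd).1
    set s := (k₁ :: ks).toFinset with hs
    have hk₁s : k₁ ∈ s := by simp [hs]
    have hse : s.erase k₁ = ks.toFinset := by
      ext i
      simp only [hs, List.toFinset_cons, Finset.mem_erase, Finset.mem_insert, List.mem_toFinset]
      refine ⟨fun h => h.2.resolve_left h.1, fun h => ⟨?_, Or.inr h⟩⟩
      rintro rfl
      exact hk₁ h
    -- As ω, the product of the other labels, is closed, df ∪ ω = d(f ∪ ω).
    have step : ∀ y, cup ((k₁ :: ks).map l) s y =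
        ∑ k ∈ s, diff k (fun y => l k₁ y * cup (ks.map l) (s.erase k) y) y := by
      intro y
      have h := cup_closed (ks.map l) s y
      have : cup ((k₁ :: ks).map l) s y = cup ((k₁ :: ks).map l) s y +
          l k₁ y * ∑ k ∈ s, diff k (cup (ks.map l) (s.erase k)) y := by rw [h]; ring
      rw [this, List.map_cons, cup, Finset.mul_sum, ← Finset.sum_add_distrib]
      refine Finset.sum_congr rfl fun k _ => ?_
      simp only [diff, shift]
      ring
    simp only [step]
    rw [Finset.sum_comm, ← Finset.add_sum_erase _ _ hk₁s, sum_grid_diff K hk₁s,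
      Finset.sum_eq_zero (s := s.erase k₁), add_zero]
    · rw [hse] at *
      rw [← ih (List.nodup_cons.1 hnd).2]
      refine Finset.sum_congr rfl fun y hy => ?_
      have hyk : y k₁ = K := by
        simp only [grid, Fintype.mem_piFinset] at hy
        simpa [hk₁] using hy k₁
      rw [hK k₁ y hyk, h0 k₁ (Function.update y k₁ 0) (by simp)]
      ring
    -- On both faces in a direction k other than k₁ the label k is constant, so the product
    -- containing it vanishes.
    · intro k hk
      have hks : k ∈ s := Finset.mem_of_mem_erase hk
      rw [sum_grid_diff K hks]
      refine Finset.sum_eq_zero fun y hy => ?_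
      have hyk : y k = K := by
        simp only [grid, Fintype.mem_piFinset] at hy
        simpa using hy k
      have hmem : l k ∈ ks.map l := by
        rw [hse] at hk
        exact List.mem_map_of_mem (List.mem_toFinset.1 hk)
      rw [cup_eq_zero _ hmem (s.erase k) y 1, cup_eq_zero _ hmem (s.erase k) _ 0]
      · ring
      · intro r hr
        refine h0 k r ?_
        simpa using hr k
      · intro r hr
        refine hK k r ?_
        have := hr k
        simp at this
        omega

end CubicalSperner

/-- If each of `n` labels on the grid `{0, …, K}ⁿ` is false on one of the two faces in its own
direction and true on the other, then some unit cube has both values of every label. -/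
theorem exists_cube_of_labels {n K : ℕ} (l : Fin n → (Fin n → ℕ) → Prop)
    (h0 : ∀ i y, y i = 0 → ¬ l i y) (hK : ∀ i y, y i = K → l i y) :
    ∃ y : Fin n → ℕ, (∀ i, y i < K) ∧ ∀ i, ∃ r s : Fin n → ℕ,
      (∀ k, y k ≤ r k ∧ r k ≤ y k + 1) ∧ (∀ k, y k ≤ s k ∧ s k ≤ y k + 1) ∧ l i r ∧ ¬ l i s := by
  classical
  open CubicalSperner in
  let g : Fin n → (Fin n → ℕ) → ZMod 2 := fun i y => if l i y then 1 else 0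
  have hsum := sum_cup K g (fun i y hy => by simp [g, h0 i y hy])
    (fun i y hy => by simp [g, hK i y hy]) (List.finRange n) (List.nodup_finRange n)
  have huniv : (List.finRange n).toFinset = Finset.univ := by ext; simp
  rw [huniv] at hsum
  obtain ⟨y, hy, hne⟩ : ∃ y ∈ grid K (Finset.univ : Finset (Fin n)),
      cup ((List.finRange n).map g) Finset.univ y ≠ 0 := by
    by_contra! hcon
    rw [Finset.sum_eq_zero hcon] at hsum
    exact zero_ne_one hsum
  refine ⟨y, fun i => ?_, fun i => ?_⟩
  · simp only [grid, Fintype.mem_piFinset] at hy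
    simpa using hy i
  · have hmem : g i ∈ (List.finRange n).map g := List.mem_map_of_mem (List.mem_finRange i)
    -- A label that does not take both values on the cube is constant there, which would make the
    -- cup product vanish.
    by_contra! hcon
    refine hne ?_
    have hcube : ∀ r, InCube Finset.univ y r → ∀ k, y k ≤ r k ∧ r k ≤ y k + 1 := by
      intro r hr k
      simpa using hr k
    by_cases hex : ∃ r, InCube Finset.univ y r ∧ l i r
    · obtain ⟨r, hr, hlr⟩ := hex
      refine cup_eq_zero _ hmem _ y 1 fun s hs => ?_
      have := hcon r s (hcube r hr) (hcube s hs) hlr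
      simp [g, this]
    · push Not at hex
      refine cup_eq_zero _ hmem _ y 0 fun s hs => ?_
      simp [g, hex s hs]

/-! ### The value of a set of bids, layer by layer -/

/-- Every element of a finite set of nonnegative numbers is the sum of the gaps below it. -/
theorem exists_gap (B : Finset ℝ) (hB : ∀ v ∈ B, 0 ≤ v) :
    ∃ g : ℝ → ℝ, (∀ v, 0 ≤ g v) ∧ ∀ b ∈ B, b = ∑ v ∈ B, if v ≤ b then g v else 0 := by
  induction B using Finset.induction_on_max with
  | empty => exact ⟨0, by simp, by simp⟩
  | insert a s hs ih =>
    obtain ⟨g, hg0, hg⟩ := ih fun v hv => hB v (Finset.mem_insert_of_mem hv)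
    have has : a ∉ s := fun h => lt_irrefl a (hs a h)
    have hsum : ∑ v ∈ s, g v ≤ a := by
      rcases s.eq_empty_or_nonempty with rfl | hne
      · simpa using hB a (by simp)
      · have h1 := hg _ (s.max'_mem hne)
        rw [Finset.sum_congr rfl fun v hv => if_pos (s.le_max' v hv)] at h1
        rw [← h1]
        exact (hs _ (s.max'_mem hne)).le
    refine ⟨Function.update g a (a - ∑ v ∈ s, g v), fun v => ?_, fun b hb => ?_⟩
    · by_cases hv : v = a
      · subst hv; simpa using hsum
      · simpa [hv] using hg0 v
    · rw [Finset.sum_insert has, Function.update_self]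
      have hcongr : ∀ c : ℝ, (∑ v ∈ s, if v ≤ c then Function.update g a (a - ∑ v ∈ s, g v) v else 0)
          = ∑ v ∈ s, if v ≤ c then g v else 0 := by
        intro c
        refine Finset.sum_congr rfl fun v hv => ?_
        rw [Function.update_of_ne (ne_of_mem_of_not_mem hv has)]
      rw [hcongr]
      rcases Finset.mem_insert.1 hb with rfl | hb
      · rw [if_pos le_rfl, Finset.sum_congr rfl fun v hv => if_pos (hs v hv).le]
        ring
      · rw [if_neg (not_le.2 (hs b hb)), zero_add]
        exact hg b hb

/-- Layer cake: each bid is the sum of the gaps up to it, and in decreasing order the bids that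
reach level v are exactly the first ones, so they collect an initial segment of the rates. -/
theorem sum_zipWith_eq_sum_gap {B : Finset ℝ} {g : ℝ → ℝ}
    (hg : ∀ b ∈ B, b = ∑ v ∈ B, if v ≤ b then g v else 0) (s : List ℝ) :
    ∀ ds : List ℝ, s.Pairwise (· ≥ ·) → (∀ b ∈ s, b ∈ B) →
      (List.zipWith (fun d v => d * v) ds s).sum =
        ∑ v ∈ B, g v * (ds.take (s.countP fun b => v ≤ b)).sum := by
  induction s with
  | nil => intro ds _ _; simp
  | cons a s ih =>
    intro ds hs hsB
    cases ds with
    | nil => simp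
    | cons d ds =>
      rw [List.zipWith_cons_cons, List.sum_cons,
        ih ds (List.pairwise_cons.1 hs).2 fun b hb => hsB b (List.mem_cons_of_mem _ hb)]
      have ha := hg a (hsB a (by simp))
      conv_lhs => rw [ha]
      rw [Finset.mul_sum, ← Finset.sum_add_distrib]
      refine Finset.sum_congr rfl fun v _ => ?_
      by_cases hv : v ≤ a
      · rw [if_pos hv, List.countP_cons_of_pos (by simpa using hv), List.take_succ_cons,
          List.sum_cons]
        ring
      -- If the largest bid does not reach v, no later one does.
      · have h0 : s.countP (fun b => v ≤ b) = 0 := by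
          rw [List.countP_eq_zero]
          intro b hb
          have := (List.pairwise_cons.1 hs).1 b hb
          simp only [decide_eq_true_eq, not_le]
          exact lt_of_le_of_lt this (not_le.1 hv)
        rw [if_neg hv, List.countP_cons_of_neg (by simpa using hv), h0]
        simp

namespace Exchange

variable {n M : ℕ} {ι : Type} (E : Exchange n M ι)

theorem le_maxBid (v : E.bids) : (v : ℝ) ≤ E.maxBid := E.bids.le_max' _ v.2

theorem bid_nonneg (v : E.bids) : (0 : ℝ) ≤ v := E.bids_nonneg _ v.2

theorem maxBid_nonneg : 0 ≤ E.maxBid := E.bids_nonneg _ (E.bids.max'_mem _)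

/-- The distance of a bid value from the next smaller one (or from zero). -/
noncomputable def gap : ℝ → ℝ := Classical.choose (exists_gap E.bids E.bids_nonneg)

theorem gap_nonneg (v : ℝ) : 0 ≤ E.gap v :=
  (Classical.choose_spec (exists_gap E.bids E.bids_nonneg)).1 v

theorem eq_sum_gap {b : ℝ} (hb : b ∈ E.bids) :
    b = ∑ v ∈ E.bids, if v ≤ b then E.gap v else 0 :=
  (Classical.choose_spec (exists_gap E.bids E.bids_nonneg)).2 b hb

theorem sum_gap : ∑ v ∈ E.bids, E.gap v = E.maxBid := by
  have h := E.eq_sum_gap (E.bids.max'_mem E.bids_nonempty)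
  rw [Finset.sum_congr rfl fun v hv => if_pos (E.bids.le_max' v hv)] at h
  exact h.symm

/-- The discount rate of slot number `l`, zero beyond the last slot. -/
noncomputable def slotRate (l : ℕ) : ℝ := if h : l < M then E.discount ⟨l, h⟩ else 0

theorem slotRate_nonneg (l : ℕ) : 0 ≤ E.slotRate l := by
  unfold slotRate; split
  · exact E.discount_nonneg _
  · exact le_rfl

theorem slotRate_le_one (l : ℕ) : E.slotRate l ≤ 1 := by
  unfold slotRate; split
  · exact E.discount_le_one _
  · exact zero_le_one

theorem slotRate_antitone : Antitone E.slotRate := by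
  intro a b hab
  unfold slotRate
  split_ifs with h1 h2
  · exact E.discount_antitone hab
  · omega
  · exact E.discount_nonneg _
  · exact le_rfl

theorem slotRate_of_le {l : ℕ} (h : M ≤ l) : E.slotRate l = 0 := dif_neg (by omega)

theorem slotRate_fin (l : Fin M) : E.slotRate l = E.discount l := dif_pos l.2

theorem sum_take_discount (N : ℕ) :
    ((List.ofFn E.discount).take N).sum = ∑ l ∈ Finset.range N, E.slotRate l := by
  induction N with
  | zero => simp
  | succ N ih =>
    rw [Finset.sum_range_succ, ← ih]
    by_cases h : N < M
    · rw [List.take_add_one, List.sum_append, List.getElem?_ofFn]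
      simp [h, slotRate]
    · rw [List.take_of_length_le (by simp; omega), List.take_of_length_le (by simp; omega),
        slotRate_of_le _ (by omega), add_zero]

/-- The number of networks in `S` that bid at least `v`. -/
noncomputable def numAbove (S : Finset (Fin n)) (b : Fin n → E.bids) (v : ℝ) : ℕ :=
  (S.filter fun i => v ≤ b i).card

theorem slotValue_eq_sum_gap (S : Finset (Fin n)) (b : Fin n → E.bids) :
    E.slotValue S b =
      ∑ v ∈ E.bids, E.gap v * ∑ l ∈ Finset.range (E.numAbove S b v), E.slotRate l := by
  unfold slotValue
  rw [sum_zipWith_eq_sum_gap (B := E.bids) (g := E.gap) fun b hb => E.eq_sum_gap hb]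
  · refine Finset.sum_congr rfl fun v _ => ?_
    rw [sum_take_discount]
    congr 3
    have : ((S.val.map fun i => (b i : ℝ)).sort fun v w => v ≥ w).countP (fun b => v ≤ b) =
        (S.val.map fun i => (b i : ℝ)).countP (fun b => v ≤ b) := by
      conv_rhs => rw [← Multiset.sort_eq (S.val.map fun i => (b i : ℝ)) (fun v w => v ≥ w)]
      rw [Multiset.coe_countP]
    rw [this, Multiset.countP_map]
    rfl
  · exact Multiset.pairwise_sort _ _
  · intro x hx
    rw [Multiset.mem_sort] at hx
    obtain ⟨i, _, rfl⟩ := Multiset.mem_map.1 hx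
    exact (b i).2

/-- The increase of the value when network `i` is called out in addition to those in `S`. -/
noncomputable def marginal (S : Finset (Fin n)) (b : Fin n → E.bids) (i : Fin n) : ℝ :=
  ∑ v ∈ E.bids, if v ≤ b i then E.gap v * E.slotRate (E.numAbove S b v) else 0

theorem slotValue_insert {S : Finset (Fin n)} (b : Fin n → E.bids) {i : Fin n} (hi : i ∉ S) :
    E.slotValue (insert i S) b = E.slotValue S b + E.marginal S b i := by
  rw [slotValue_eq_sum_gap, slotValue_eq_sum_gap, marginal, ← Finset.sum_add_distrib]
  refine Finset.sum_congr rfl fun v _ => ?_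
  unfold numAbove
  rw [Finset.filter_insert]
  split_ifs with h
  · rw [Finset.card_insert_of_notMem (by simp [hi]), Finset.sum_range_succ]
    ring
  · ring

theorem marginal_nonneg (S : Finset (Fin n)) (b : Fin n → E.bids) (i : Fin n) :
    0 ≤ E.marginal S b i := by
  refine Finset.sum_nonneg fun v _ => ?_
  split_ifs
  · exact mul_nonneg (E.gap_nonneg v) (E.slotRate_nonneg _)
  · exact le_rfl

theorem marginal_le (S : Finset (Fin n)) (b : Fin n → E.bids) (i : Fin n) :
    E.marginal S b i ≤ E.maxBid := by
  refine le_trans ?_ (E.le_maxBid (b i))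
  rw [E.eq_sum_gap (b i).2]
  refine Finset.sum_le_sum fun v _ => ?_
  split_ifs
  · exact mul_le_of_le_one_right (E.gap_nonneg v) (E.slotRate_le_one _)
  · exact le_rfl

/-- Submodularity: with more competitors at or above a level, the slot gained at that level is later
and its rate is smaller. -/
theorem marginal_anti {S T : Finset (Fin n)} (h : S ⊆ T) (b : Fin n → E.bids) (i : Fin n) :
    E.marginal T b i ≤ E.marginal S b i := by
  refine Finset.sum_le_sum fun v _ => ?_
  split_ifs
  · exact mul_le_mul_of_nonneg_left
      (E.slotRate_antitone (Finset.card_le_card (Finset.filter_subset_filter _ h))) (E.gap_nonneg v)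
  · exact le_rfl

/-- The contribution of network `i` to the value when those in `T` are called out: its marginal
value over the networks in `T` that precede it. -/
noncomputable def contribution (T : Finset (Fin n)) (b : Fin n → E.bids) (i : Fin n) : ℝ :=
  if i ∈ T then E.marginal (T.filter (· < i)) b i else 0

theorem contribution_nonneg (T : Finset (Fin n)) (b : Fin n → E.bids) (i : Fin n) :
    0 ≤ E.contribution T b i := by
  unfold contribution; split_ifs
  · exact E.marginal_nonneg _ _ _
  · exact le_rfl

theorem contribution_le (T : Finset (Fin n)) (b : Fin n → E.bids) (i : Fin n) :
    E.contribution T b i ≤ E.maxBid * if i ∈ T then 1 else 0 := by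
  unfold contribution; split_ifs
  · simpa using E.marginal_le _ _ _
  · simp

theorem slotValue_eq_sum_marginal (S : Finset (Fin n)) (b : Fin n → E.bids) :
    E.slotValue S b = ∑ i ∈ S, E.marginal (S.filter (· < i)) b i := by
  induction S using Finset.induction_on_max with
  | empty => rw [slotValue_eq_sum_gap]; simp [numAbove]
  | insert a s hs ih =>
    have has : a ∉ s := fun h => lt_irrefl a (hs a h)
    rw [slotValue_insert _ _ has, Finset.sum_insert has, add_comm, ih]
    congr 1
    · congr 1
      rw [Finset.filter_insert, if_neg (lt_irrefl a), Finset.filter_true_of_mem hs]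
    · refine Finset.sum_congr rfl fun i hi => ?_
      rw [Finset.filter_insert, if_neg (not_lt.2 (hs i hi).le)]

theorem slotValue_eq_sum_contribution (S : Finset (Fin n)) (b : Fin n → E.bids) :
    E.slotValue S b = ∑ i, E.contribution S b i := by
  rw [slotValue_eq_sum_marginal]
  simp [contribution, Finset.sum_ite_mem]

/-- Used when some networks have exhausted their capacity: removing them leaves fewer predecessors
to each remaining network, so its contribution can only grow. -/
theorem sum_contribution_le (T A : Finset (Fin n)) (b : Fin n → E.bids) :
    ∑ i ∈ A, E.contribution T b i ≤ E.slotValue (T ∩ A) b := by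
  rw [slotValue_eq_sum_marginal]
  simp only [contribution]
  rw [← Finset.sum_filter, Finset.filter_mem_eq_inter, Finset.inter_comm A T]
  refine Finset.sum_le_sum fun i _ => E.marginal_anti ?_ b i
  exact Finset.filter_subset_filter _ Finset.inter_subset_left

theorem slotValue_nonneg (S : Finset (Fin n)) (b : Fin n → E.bids) : 0 ≤ E.slotValue S b := by
  rw [slotValue_eq_sum_contribution]
  exact Finset.sum_nonneg fun i _ => E.contribution_nonneg S b i

theorem slotValue_le (S : Finset (Fin n)) (b : Fin n → E.bids) :
    E.slotValue S b ≤ n * E.maxBid := by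
  rw [slotValue_eq_sum_contribution]
  calc ∑ i, E.contribution S b i ≤ ∑ _i : Fin n, E.maxBid := by
        refine Finset.sum_le_sum fun i _ => (E.contribution_le S b i).trans ?_
        split_ifs
        · simp
        · simpa using E.maxBid_nonneg
    _ = n * E.maxBid := by simp

/-- The slots are filled by an assignment of networks to slots. -/
theorem exists_assignment (S : Finset (Fin n)) (b : Fin n → E.bids) :
    ∃ is : List (Fin n), is.Nodup ∧ (∀ i ∈ is, i ∈ S) ∧
      E.slotValue S b =
        ∑ l : Fin M, ∑ i, if is[(l : ℕ)]? = some i then (b i : ℝ) * E.discount l else 0 := by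
  classical
  let r : Fin n → Fin n → Prop := fun i k => (b i : ℝ) ≥ b k
  have : Std.Total r := ⟨fun i k => le_total (b k : ℝ) (b i)⟩
  have : IsTrans (Fin n) r := ⟨fun i j k h1 h2 => ge_trans h1 h2⟩
  let is := S.toList.insertionSort r
  have hperm : is.Perm S.toList := List.perm_insertionSort r _
  refine ⟨is, hperm.nodup_iff.2 S.nodup_toList, fun i hi => by
    simpa using hperm.mem_iff.1 hi, ?_⟩
  have hsort : ((S.val.map fun i => (b i : ℝ)).sort fun v w => v ≥ w) =
      is.map fun i => (b i : ℝ) := by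
    refine List.Perm.eq_of_pairwise' (r := fun v w : ℝ => v ≥ w) (Multiset.pairwise_sort _ _) ?_ ?_
    · rw [List.pairwise_map]
      exact List.pairwise_insertionSort r _
    · rw [← Multiset.coe_eq_coe, Multiset.sort_eq, ← Multiset.map_coe, Multiset.coe_eq_coe.2 hperm,
        Finset.coe_toList]
  unfold slotValue
  rw [hsort]
  have hgen : ∀ (is : List (Fin n)) (N : ℕ) (f : Fin N → ℝ),
      (List.zipWith (fun d v => d * v) (List.ofFn f) (is.map fun i => (b i : ℝ))).sum =
        ∑ l : Fin N, ∑ i, if is[(l : ℕ)]? = some i then (b i : ℝ) * f l else 0 := by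
    intro is
    induction is with
    | nil => intro N f; simp
    | cons a is ih =>
      intro N f
      cases N with
      | zero => simp
      | succ N =>
        rw [List.ofFn_succ, List.map_cons, List.zipWith_cons_cons, List.sum_cons, ih,
          Fin.sum_univ_succ]
        simp [mul_comm]
  exact hgen is M E.discount

end Exchange

/-! ### Independent events on a finite product -/

section FiniteProduct

variable {κ α : Type*} [Fintype κ] [DecidableEq κ] [Fintype α]

theorem sum_prod_mul_prod (w f : κ → α → ℝ) :
    ∑ ω : κ → α, (∏ i, w i (ω i)) * ∏ i, f i (ω i) = ∏ i, ∑ a, w i a * f i a := by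
  rw [Finset.prod_univ_sum, Fintype.piFinset_univ]
  simp only [Finset.prod_mul_distrib]

theorem sum_prod_eq_one {w : κ → α → ℝ} (hw : ∀ i, ∑ a, w i a = 1) :
    ∑ ω : κ → α, ∏ i, w i (ω i) = 1 := by
  have := sum_prod_mul_prod w fun _ _ => 1
  simpa [hw] using this

theorem sum_prod_mul_apply {w : κ → α → ℝ} (hw : ∀ i, ∑ a, w i a = 1) (i : κ) (h : α → ℝ) :
    ∑ ω : κ → α, (∏ i, w i (ω i)) * h (ω i) = ∑ a, w i a * h a := by
  have := sum_prod_mul_prod w fun k a => if k = i then h a else 1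
  simp only [Finset.prod_ite_eq', Finset.mem_univ, if_true] at this
  rw [this, Finset.prod_eq_single i]
  · simp
  · intro k _ hk; simp [hk, hw]
  · simp

theorem sum_prod_mul_apply_mul_apply {w : κ → α → ℝ} (hw : ∀ i, ∑ a, w i a = 1) {i k : κ}
    (hik : i ≠ k) (h h' : α → ℝ) :
    ∑ ω : κ → α, (∏ i, w i (ω i)) * (h (ω i) * h' (ω k)) =
      (∑ a, w i a * h a) * ∑ a, w k a * h' a := by
  have := sum_prod_mul_prod w
    fun r a => (if r = i then h a else 1) * (if r = k then h' a else 1)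
  simp only [Finset.prod_mul_distrib, Finset.prod_ite_eq', Finset.mem_univ, if_true] at this
  rw [this, ← Finset.mul_prod_erase _ _ (Finset.mem_univ i),
    ← Finset.mul_prod_erase _ _ (Finset.mem_erase.2 ⟨hik.symm, Finset.mem_univ k⟩)]
  rw [Finset.prod_eq_one]
  · simp [hik, hik.symm]
  · intro r hr
    simp only [Finset.mem_erase, Finset.mem_univ, and_true] at hr
    simp [hr.1, hr.2, hw]

/-- The first two terms of the series of -log(1 - u). The quadratic term is the source of the
surplus in the rounding bound. -/
theorem one_sub_le_exp_quadratic {u : ℝ} (h0 : 0 ≤ u) (h1 : u ≤ 1) :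
    1 - u ≤ Real.exp (-u - u ^ 2 / 2) := by
  rcases h1.lt_or_eq with h | rfl
  · have hs := Real.hasSum_pow_div_log_of_abs_lt_one (x := u) (by rwa [abs_of_nonneg h0])
    have := sum_le_hasSum (Finset.range 2) (fun i _ => by positivity) hs
    norm_num [Finset.sum_range_succ] at this
    calc 1 - u = Real.exp (Real.log (1 - u)) := (Real.exp_log (by linarith)).symm
      _ ≤ _ := Real.exp_le_exp.2 (by linarith)
  · simpa using (Real.exp_pos _).le

theorem inv_exp_one_gt : (0.3678 : ℝ) < 1 / Real.exp 1 := by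
  rw [lt_div_iff₀ (Real.exp_pos _)]
  have := Real.exp_one_lt_d9
  linarith

/-- Convexity puts exp(-a) below its chord on [0, 1], and exp(-b/2) ≤ 1 - 3b/8. Since exp(-a) ≥ 1/e
> 0.3678, the gain from b is at least 0.3678 · 3b/8 > b/8. -/
theorem one_sub_exp_ge {a b : ℝ} (ha : 0 ≤ a) (ha1 : a ≤ 1) (hb : 0 ≤ b) (hb1 : b ≤ 1) :
    (1 - 1 / Real.exp 1) * a + b / 8 ≤ 1 - Real.exp (-a - b / 2) := by
  have he : Real.exp (-a) ≤ 1 - (1 - 1 / Real.exp 1) * a := by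
    have := convexOn_exp.2 (Set.mem_univ 0) (Set.mem_univ (-1)) (sub_nonneg.2 ha1) ha
      (by ring)
    simp only [smul_eq_mul, mul_zero, zero_add, Real.exp_zero, mul_one, mul_neg] at this
    rw [Real.exp_neg 1] at this
    rw [one_div]
    linarith
  have he1 : 1 / Real.exp 1 ≤ Real.exp (-a) := by
    rw [one_div, ← Real.exp_neg]
    exact Real.exp_le_exp.2 (by linarith)
  have hb2 : Real.exp (-(b / 2)) ≤ 1 - 3 * b / 8 := by
    have h1 : 1 + b / 2 + (b / 2) ^ 2 / 2 ≤ Real.exp (b / 2) :=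
      Real.quadratic_le_exp_of_nonneg (by linarith)
    have h2 : Real.exp (-(b / 2)) * Real.exp (b / 2) = 1 := by rw [← Real.exp_add]; simp
    have h3 := Real.exp_pos (-(b / 2))
    have h4 : 1 ≤ (1 - 3 * b / 8) * (1 + b / 2 + (b / 2) ^ 2 / 2) := by
      nlinarith [mul_nonneg hb (sub_nonneg.2 hb1), mul_nonneg (mul_nonneg hb hb) (sub_nonneg.2 hb1)]
    by_contra! hcon
    have h5 : (1 - 3 * b / 8) * (1 + b / 2 + (b / 2) ^ 2 / 2) <
        Real.exp (-(b / 2)) * Real.exp (b / 2) :=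
      mul_lt_mul hcon h1 (by positivity) h3.le
    linarith
  have hprod : Real.exp (-a - b / 2) ≤ Real.exp (-a) - Real.exp (-a) * (3 * b / 8) := by
    rw [sub_eq_add_neg, Real.exp_add]
    nlinarith [Real.exp_pos (-a)]
  have := inv_exp_one_gt
  nlinarith

variable {w : κ → α → ℝ} (A : κ → α → Prop) [∀ i a, Decidable (A i a)]

/-- The number of independent events that occur, truncated at `l`: its expectation is at least
`1 - 1/e` times the truncated sum of the probabilities, with a quadratic surplus. -/
theorem le_expect_min (hw0 : ∀ i a, 0 ≤ w i a) (hw1 : ∀ i, ∑ a, w i a = 1) {l : ℕ} (hl : 1 ≤ l)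
    {z : κ → ℝ} (hz0 : ∀ i, 0 ≤ z i) (hz : ∀ i, z i ≤ ∑ a, w i a * if A i a then 1 else 0)
    (hZ : ∑ i, z i ≤ l) :
    (1 - 1 / Real.exp 1) * ∑ i, z i + 1 / 32 * ∑ i, z i ^ 2 ≤
      ∑ ω : κ → α, (∏ i, w i (ω i)) *
        ((min l (Finset.univ.filter fun i => A i (ω i)).card : ℕ) : ℝ) := by
  have hlr : (1 : ℝ) ≤ l := by exact_mod_cast hl
  have hl0 : (0 : ℝ) < l := by linarith
  have hp1 : ∀ i, ∑ a, w i a * (if A i a then (1 : ℝ) else 0) ≤ 1 := by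
    intro i
    refine le_trans (Finset.sum_le_sum fun a _ => ?_) (hw1 i).le
    split_ifs
    · rw [mul_one]
    · simpa using hw0 i a
  have hz1 : ∀ i, z i ≤ 1 := fun i => (hz i).trans (hp1 i)
  have hW0 : ∀ ω : κ → α, 0 ≤ ∏ i, w i (ω i) := fun ω => Finset.prod_nonneg fun i _ => hw0 _ _
  have hZ0 : 0 ≤ ∑ i, z i := Finset.sum_nonneg fun i _ => hz0 i
  have hsq0 : 0 ≤ ∑ i, z i ^ 2 := Finset.sum_nonneg fun i _ => sq_nonneg _
  have hsq : ∑ i, z i ^ 2 ≤ ∑ i, z i := Finset.sum_le_sum fun i _ => by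
    nlinarith [hz0 i, hz1 i]
  have hinv := inv_exp_one_gt
  -- The exponential estimate has the sharp constant but a surplus that decays like 1/l, so it
  -- serves l ≤ 2. For l ≥ 3 a second moment bound already gives 2/3, which exceeds 1 - 1/e by a
  -- constant.
  rcases le_or_gt l 2 with hl2 | hl3
  · have hl2r : (l : ℝ) ≤ 2 := by exact_mod_cast hl2
    set r : ℝ := 1 - 1 / l with hr
    have hr0 : 0 ≤ r := by rw [hr, sub_nonneg, div_le_one hl0]; exact hlr
    -- A concave minorant of min(l, N), by Bernoulli's inequality. Its expectation factorizes over
    -- independent events.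
    have hpt : ∀ N : ℕ, (l : ℝ) * (1 - r ^ N) ≤ ((min l N : ℕ) : ℝ) := by
      intro N
      have hb := one_add_mul_le_pow (a := -(1 / (l : ℝ))) (by
        have : 1 / (l : ℝ) ≤ 1 := by rw [div_le_one hl0]; exact hlr
        linarith) N
      have hb' : 1 - N / (l : ℝ) ≤ r ^ N := by
        rw [hr, sub_eq_add_neg]
        refine le_trans (le_of_eq ?_) hb
        ring
      rw [Nat.cast_min]
      refine le_min ?_ ?_
      · nlinarith [pow_nonneg hr0 N]
      · have : (l : ℝ) * (1 - N / (l : ℝ)) = l - N := by field_simp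
        nlinarith
    have hE : ∑ ω : κ → α, (∏ i, w i (ω i)) *
        r ^ (Finset.univ.filter fun i => A i (ω i)).card ≤ ∏ i, (1 - z i / l) := by
      have h1 : ∀ ω : κ → α, r ^ (Finset.univ.filter fun i => A i (ω i)).card =
          ∏ i, if A i (ω i) then r else 1 := by
        intro ω
        rw [← Finset.prod_filter, Finset.prod_const]
      simp only [h1]
      rw [sum_prod_mul_prod w fun i a => if A i a then r else 1]
      refine Finset.prod_le_prod (fun i _ => Finset.sum_nonneg fun a _ =>
        mul_nonneg (hw0 _ _) (by split_ifs <;> simp [hr0])) fun i _ => ?_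
      have h2 : ∑ a, w i a * (if A i a then r else 1) =
          1 - (∑ a, w i a * if A i a then 1 else 0) / l := by
        have h3 : ∀ a, w i a * (if A i a then r else 1) =
            w i a - w i a * (if A i a then 1 else 0) / l := by
          intro a
          split_ifs
          · rw [hr]; ring
          · simp
        simp only [h3]
        rw [Finset.sum_sub_distrib, hw1 i, Finset.sum_div]
      rw [h2]
      have := div_le_div_of_nonneg_right (hz i) hl0.le
      linarith
    have hexp : ∏ i, (1 - z i / l) ≤
        Real.exp (-(∑ i, z i / l) - (∑ i, (z i / l) ^ 2) / 2) := by
      have hu1 : ∀ i, z i / l ≤ 1 := fun i => by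
        rw [div_le_one hl0]; exact (hz1 i).trans hlr
      calc ∏ i, (1 - z i / l) ≤ ∏ i, Real.exp (-(z i / l) - (z i / l) ^ 2 / 2) :=
            Finset.prod_le_prod (fun i _ => sub_nonneg.2 (hu1 i)) fun i _ =>
              one_sub_le_exp_quadratic (div_nonneg (hz0 i) hl0.le) (hu1 i)
        _ = _ := by
            rw [← Real.exp_sum, Finset.sum_sub_distrib, Finset.sum_neg_distrib, Finset.sum_div]
    have hmain := one_sub_exp_ge (a := ∑ i, z i / l) (b := ∑ i, (z i / l) ^ 2)
      (Finset.sum_nonneg fun i _ => div_nonneg (hz0 i) hl0.le)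
      (by rw [← Finset.sum_div, div_le_one hl0]; exact hZ)
      (Finset.sum_nonneg fun i _ => sq_nonneg _) (by
        calc ∑ i, (z i / l) ^ 2 = (∑ i, z i ^ 2) / l ^ 2 := by
              rw [Finset.sum_div]; simp only [div_pow]
          _ ≤ 1 := by
              rw [div_le_one (by positivity)]
              nlinarith)
    have hsum : ∑ ω : κ → α, (∏ i, w i (ω i)) *
        ((l : ℝ) * (1 - r ^ (Finset.univ.filter fun i => A i (ω i)).card)) =
        l * (1 - ∑ ω : κ → α, (∏ i, w i (ω i)) *
          r ^ (Finset.univ.filter fun i => A i (ω i)).card) := by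
      simp only [mul_left_comm _ (l : ℝ) _]
      rw [← Finset.mul_sum]
      simp only [mul_sub, mul_one]
      rw [Finset.sum_sub_distrib, sum_prod_eq_one hw1]
      ring
    refine le_trans ?_ (Finset.sum_le_sum fun ω _ => mul_le_mul_of_nonneg_left (hpt _) (hW0 ω))
    rw [hsum]
    refine le_trans ?_ (mul_le_mul_of_nonneg_left
      (sub_le_sub_left (hE.trans hexp) 1) hl0.le)
    refine le_trans ?_ (mul_le_mul_of_nonneg_left hmain hl0.le)
    have e1 : ∑ i, z i / (l : ℝ) = (∑ i, z i) / l := by rw [Finset.sum_div]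
    have e2 : ∑ i, (z i / (l : ℝ)) ^ 2 = (∑ i, z i ^ 2) / l ^ 2 := by
      rw [Finset.sum_div]; simp only [div_pow]
    rw [e1, e2]
    have e3 : (l : ℝ) * ((1 - 1 / Real.exp 1) * ((∑ i, z i) / l) + (∑ i, z i ^ 2) / l ^ 2 / 8) =
        (1 - 1 / Real.exp 1) * ∑ i, z i + (∑ i, z i ^ 2) / l / 8 := by
      field_simp
    rw [e3]
    have : (∑ i, z i ^ 2) / 2 ≤ (∑ i, z i ^ 2) / l := by gcongr
    linarith
  · have hl3r : (3 : ℝ) ≤ l := by exact_mod_cast hl3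
    set p : κ → ℝ := fun i => ∑ a, w i a * if A i a then 1 else 0 with hp
    -- Thinning: weighting event i by θ i gives a variable with mean exactly z i. If p i = 0 then z
    -- i = 0 too, so the value of the quotient is immaterial.
    set θ : κ → ℝ := fun i => z i / p i with hθ
    have hp0 : ∀ i, 0 ≤ p i := fun i => (hz0 i).trans (hz i)
    have hθ0 : ∀ i, 0 ≤ θ i := fun i => div_nonneg (hz0 i) (hp0 i)
    have hθ1 : ∀ i, θ i ≤ 1 := fun i => div_le_one_of_le₀ (hz i) (hp0 i)
    have hθp : ∀ i, θ i * p i = z i := by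
      intro i
      rcases (hp0 i).eq_or_lt with h | h
      · have : z i = 0 := le_antisymm (by rw [h]; exact hz i) (hz0 i)
        rw [← h, this, mul_zero]
      · rw [hθ]; field_simp
    let X : κ → α → ℝ := fun i a => if A i a then θ i else 0
    have hX : ∀ i, ∑ a, w i a * X i a = z i := by
      intro i
      rw [← hθp i, hp, Finset.mul_sum]
      refine Finset.sum_congr rfl fun a _ => ?_
      simp only [X]
      split_ifs <;> ring
    have hpt : ∀ ω : κ → α, ∑ i, X i (ω i) - (∑ i, X i (ω i)) ^ 2 / (4 * l) ≤
        ((min l (Finset.univ.filter fun i => A i (ω i)).card : ℕ) : ℝ) := by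
      intro ω
      set s := ∑ i, X i (ω i)
      have hs : s ≤ ((Finset.univ.filter fun i => A i (ω i)).card : ℝ) := by
        rw [Finset.card_filter]
        push_cast
        refine Finset.sum_le_sum fun i _ => ?_
        simp only [X]
        split_ifs
        · exact hθ1 i
        · exact le_rfl
      rw [Nat.cast_min]
      refine le_min ?_ ?_
      -- The parabola s - s²/(4l) attains its maximum l at s = 2l.
      · have : 0 ≤ (s - 2 * l) ^ 2 / (4 * l) := by positivity
        have e : (s - 2 * l) ^ 2 / (4 * l) = s ^ 2 / (4 * l) - s + l := by field_simp; ring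
        linarith
      · have : 0 ≤ s ^ 2 / (4 * l) := by positivity
        linarith
    have hE1 : ∑ ω : κ → α, (∏ i, w i (ω i)) * ∑ i, X i (ω i) = ∑ i, z i := by
      simp only [Finset.mul_sum]
      rw [Finset.sum_comm]
      refine Finset.sum_congr rfl fun i _ => ?_
      rw [sum_prod_mul_apply hw1, hX]
    have hE2 : ∑ ω : κ → α, (∏ i, w i (ω i)) * (∑ i, X i (ω i)) ^ 2 ≤
        (∑ i, z i) ^ 2 + ∑ i, z i := by
      simp only [sq, Finset.sum_mul_sum]
      simp only [Finset.mul_sum]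
      rw [Finset.sum_comm, ← Finset.sum_add_distrib]
      refine Finset.sum_le_sum fun i _ => ?_
      rw [Finset.sum_comm]
      calc ∑ k, ∑ ω : κ → α, (∏ i, w i (ω i)) * (X i (ω i) * X k (ω k)) ≤
            ∑ k, (z i * z k + if i = k then z i else 0) := by
            refine Finset.sum_le_sum fun k _ => ?_
            by_cases hik : i = k
            · subst hik
              rw [if_pos rfl, sum_prod_mul_apply hw1 i fun a => X i a * X i a]
              have : ∑ a, w i a * (X i a * X i a) ≤ ∑ a, w i a * X i a := by
                refine Finset.sum_le_sum fun a _ => mul_le_mul_of_nonneg_left ?_ (hw0 i a)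
                simp only [X]
                split_ifs
                · nlinarith [hθ0 i, hθ1 i]
                · simp
              rw [hX] at this
              nlinarith [mul_nonneg (hz0 i) (hz0 i)]
            · rw [if_neg hik, add_zero, sum_prod_mul_apply_mul_apply hw1 hik, hX, hX]
        _ = _ := by
            rw [Finset.sum_add_distrib]
            simp
    have hsum : ∑ ω : κ → α, (∏ i, w i (ω i)) *
        (∑ i, X i (ω i) - (∑ i, X i (ω i)) ^ 2 / (4 * l)) =
        ∑ i, z i - (∑ ω : κ → α, (∏ i, w i (ω i)) * (∑ i, X i (ω i)) ^ 2) / (4 * l) := by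
      rw [← hE1, Finset.sum_div, ← Finset.sum_sub_distrib]
      refine Finset.sum_congr rfl fun ω _ => ?_
      ring
    refine le_trans ?_ (Finset.sum_le_sum fun ω _ => mul_le_mul_of_nonneg_left (hpt _) (hW0 ω))
    rw [hsum]
    have h1 : (∑ ω : κ → α, (∏ i, w i (ω i)) * (∑ i, X i (ω i)) ^ 2) / (4 * l) ≤
        ((∑ i, z i) ^ 2 + ∑ i, z i) / (4 * l) := by gcongr
    -- Here Σz ≤ l bounds the square by a quarter of Σz, and l ≥ 3 bounds the rest by a twelfth.
    -- What remains is 2/3 > 1 - 1/e + 1/32.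
    have h2 : ((∑ i, z i) ^ 2 + ∑ i, z i) / (4 * l) ≤ (∑ i, z i) / 3 := by
      rw [div_le_iff₀ (by positivity)]
      nlinarith
    nlinarith

end FiniteProduct

namespace Exchange

variable {n M : ℕ} {ι : Type} (E : Exchange n M ι)

/-! ### Optimal solutions of the decoupled linear programs -/

theorem prob_nonneg (i : Fin n) (j : ι) (v : E.bids) : 0 ≤ E.prob i j v := (E.prob_mem i j).1 v

theorem sum_prob (i : Fin n) (j : ι) : ∑ v, E.prob i j v = 1 := (E.prob_mem i j).2

/-- The value that the bids of network `i` contribute to the objective of the decoupled LP. -/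
noncomputable def lpPart (y : Fin n → E.bids → Fin M → ℝ) (i : Fin n) : ℝ :=
  ∑ v : E.bids, ∑ l, (v : ℝ) * E.discount l * y i v l

variable {E}

theorem objective_eq (c x : Fin n → ℝ) (y : Fin n → E.bids → Fin M → ℝ) :
    E.objective c x y = ∑ i, (E.lpPart y i - c i * x i) := by
  unfold objective lpPart
  rw [Finset.sum_sub_distrib, Finset.sum_comm]

theorem objective_change_price (c c' x : Fin n → ℝ) (y : Fin n → E.bids → Fin M → ℝ) :
    E.objective c' x y = E.objective c x y - ∑ i, (c' i - c i) * x i := by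
  rw [objective_eq, objective_eq, ← Finset.sum_sub_distrib]
  exact Finset.sum_congr rfl fun i _ => by ring

namespace Feasible

variable {j : ι} {x : Fin n → ℝ} {y : Fin n → E.bids → Fin M → ℝ}

theorem zero : E.Feasible j 0 0 where
  slot_le l := by simp
  x_le i := by simp
  y_le i v := by simp
  x_nonneg i := le_rfl
  y_nonneg i v l := le_rfl

/-- Discounted bids are at most L, and the bids of network i have total LP mass at most x i. -/
theorem lpPart_le (h : E.Feasible j x y) (i : Fin n) : E.lpPart y i ≤ E.maxBid * x i := by
  calc E.lpPart y i ≤ ∑ v : E.bids, E.maxBid * (E.prob i j v * x i) := by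
        refine Finset.sum_le_sum fun v _ => ?_
        refine le_trans ?_ (mul_le_mul_of_nonneg_left (h.y_le i v) E.maxBid_nonneg)
        rw [Finset.mul_sum]
        refine Finset.sum_le_sum fun l _ => mul_le_mul_of_nonneg_right ?_ (h.y_nonneg i v l)
        calc (v : ℝ) * E.discount l ≤ v * 1 :=
              mul_le_mul_of_nonneg_left (E.discount_le_one l) (E.bid_nonneg v)
          _ ≤ E.maxBid := by simpa using E.le_maxBid v
    _ = E.maxBid * x i := by
        rw [← Finset.mul_sum, ← Finset.sum_mul, E.sum_prob, one_mul]

/-- Network `i` may be dropped from a feasible solution. -/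
theorem drop (h : E.Feasible j x y) (i : Fin n) :
    E.Feasible j (Function.update x i 0) (Function.update y i 0) where
  slot_le l := by
    refine le_trans (Finset.sum_le_sum fun k _ => Finset.sum_le_sum fun v _ => ?_) (h.slot_le l)
    by_cases hk : k = i
    · subst hk; simpa using h.y_nonneg k v l
    · simp [hk]
  x_le k := by
    by_cases hk : k = i
    · subst hk; simp
    · simpa [hk] using h.x_le k
  y_le k v := by
    by_cases hk : k = i
    · subst hk; simp
    · simpa [hk] using h.y_le k v
  x_nonneg k := by
    by_cases hk : k = i
    · subst hk; simp
    · simpa [hk] using h.x_nonneg k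
  y_nonneg k v l := by
    by_cases hk : k = i
    · subst hk; simp
    · simpa [hk] using h.y_nonneg k v l

theorem objective_drop (c : Fin n → ℝ) (i : Fin n) :
    E.objective c (Function.update x i 0) (Function.update y i 0) =
      E.objective c x y - (E.lpPart y i - c i * x i) := by
  rw [objective_eq, objective_eq, ← Finset.add_sum_erase _ _ (Finset.mem_univ i),
    ← Finset.add_sum_erase _ _ (Finset.mem_univ i)]
  have : ∑ k ∈ Finset.univ.erase i, (E.lpPart (Function.update y i 0) k -
      c k * Function.update x i 0 k) =
      ∑ k ∈ Finset.univ.erase i, (E.lpPart y k - c k * x k) := by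
    refine Finset.sum_congr rfl fun k hk => ?_
    have hk := Finset.ne_of_mem_erase hk
    simp [lpPart, hk]
  rw [this]
  simp [lpPart]

end Feasible

theorem lpValue_nonneg (j : ι) (c : Fin n → ℝ) : 0 ≤ E.lpValue j c :=
  Real.sSup_nonneg' ⟨0, ⟨0, 0, Feasible.zero, by simp [objective]⟩, le_rfl⟩

theorem lpValue_eq_zero {j : ι} {c : Fin n → ℝ} (hc : ∀ i, E.maxBid ≤ c i) :
    E.lpValue j c = 0 := by
  refine le_antisymm (Real.sSup_nonpos ?_) (lpValue_nonneg j c)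
  rintro z ⟨x, y, h, rfl⟩
  rw [objective_eq]
  refine Finset.sum_nonpos fun i _ => ?_
  have := h.lpPart_le i
  have := mul_le_mul_of_nonneg_right (hc i) (h.x_nonneg i)
  linarith

namespace IsOptimalCallOut

variable {j : ι} {c c' x x' : Fin n → ℝ}

theorem objective_le_lpValue (h : E.IsOptimalCallOut j c x) {x' : Fin n → ℝ}
    {y' : Fin n → E.bids → Fin M → ℝ} (h' : E.Feasible j x' y') :
    E.objective c x' y' ≤ E.lpValue j c := by
  obtain ⟨y, _, hopt⟩ := h
  refine le_csSup ⟨E.objective c x y, ?_⟩ ⟨x', y', h', rfl⟩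
  rintro z ⟨x'', y'', h'', rfl⟩
  exact hopt _ _ h''

theorem exists_eq (h : E.IsOptimalCallOut j c x) : ∃ y, E.Feasible j x y ∧
    E.objective c x y = E.lpValue j c := by
  obtain ⟨y, hf, hopt⟩ := id h
  refine ⟨y, hf, le_antisymm (h.objective_le_lpValue hf) ?_⟩
  refine csSup_le ⟨_, x, y, hf, rfl⟩ ?_
  rintro z ⟨x'', y'', h'', rfl⟩
  exact hopt _ _ h''

theorem nonneg (h : E.IsOptimalCallOut j c x) (i : Fin n) : 0 ≤ x i := h.choose_spec.1.x_nonneg i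

theorem le_one (h : E.IsOptimalCallOut j c x) (i : Fin n) : x i ≤ 1 := h.choose_spec.1.x_le i

/-- Otherwise dropping network i would improve the optimum. This converts the surplus of the
rounding bound into a statement about payments. -/
theorem mul_le_lpPart (h : E.IsOptimalCallOut j c x) {y : Fin n → E.bids → Fin M → ℝ}
    (hf : E.Feasible j x y) (hy : E.objective c x y = E.lpValue j c) (i : Fin n) :
    c i * x i ≤ E.lpPart y i := by
  have := h.objective_le_lpValue (hf.drop i)
  rw [Feasible.objective_drop, hy] at this
  linarith

/-- The payment of a network would exceed its possible contribution. Prices above L thus switch a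
network off, which is used for the boundary of the price grid and for tiny budgets. -/
theorem eq_zero (h : E.IsOptimalCallOut j c x) {i : Fin n} (hi : E.maxBid < c i) : x i = 0 := by
  obtain ⟨y, hf, hy⟩ := h.exists_eq
  have h1 := h.mul_le_lpPart hf hy i
  have h2 := hf.lpPart_le i
  have h3 := hf.x_nonneg i
  nlinarith

/-- Monotonicity of the subgradients of a convex function: add the two inequalities that compare
each solution with the other at its own prices. -/
theorem sum_mul_nonneg (h : E.IsOptimalCallOut j c x) (h' : E.IsOptimalCallOut j c' x') :
    0 ≤ ∑ i, (c' i - c i) * (x i - x' i) := by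
  obtain ⟨y, hf, hy⟩ := h.exists_eq
  obtain ⟨y', hf', hy'⟩ := h'.exists_eq
  have h1 := h.objective_le_lpValue hf'
  have h2 := h'.objective_le_lpValue hf
  rw [← hy] at h1
  rw [← hy'] at h2
  rw [objective_change_price c c'] at h2
  rw [objective_change_price c c' x' y'] at h2
  have : ∑ i, (c' i - c i) * (x i - x' i) =
      ∑ i, (c' i - c i) * x i - ∑ i, (c' i - c i) * x' i := by
    rw [← Finset.sum_sub_distrib]
    exact Finset.sum_congr rfl fun i _ => by ring
  linarith

/-- The LP value is a maximum of functions affine in the prices, and -x is a subgradient at c. -/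
theorem lpValue_le_add (h : E.IsOptimalCallOut j c x) (h' : E.IsOptimalCallOut j c' x') :
    E.lpValue j c ≤ E.lpValue j c' + ∑ i, (c' i - c i) * x i := by
  obtain ⟨y, hf, hy⟩ := h.exists_eq
  have := h'.objective_le_lpValue hf
  rw [objective_change_price c c', hy] at this
  linarith

end IsOptimalCallOut

/-! ### Independent rounding -/

variable (E)

theorem sum_slotRate_sub {l' : ℕ} (hl' : l' ≤ M) :
    ∑ l ∈ Finset.range M, (if l' ≤ l then E.slotRate l - E.slotRate (l + 1) else 0) =
      E.slotRate l' := by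
  rw [← Finset.sum_filter]
  have : (Finset.range M).filter (fun l => l' ≤ l) = Finset.Ico l' M := by
    ext l; simp only [Finset.mem_filter, Finset.mem_range, Finset.mem_Ico]; omega
  rw [this, Finset.sum_Ico_eq_sum_range]
  have h := Finset.sum_range_sub' (fun k => E.slotRate (l' + k)) (M - l')
  simp only [add_zero, ← add_assoc] at h
  rw [h, show l' + (M - l') = M by omega, E.slotRate_of_le le_rfl, sub_zero]

/-- Abel summation: a concave function of the number of bids is a nonnegative combination of
truncations min(l + 1, N), and each of these can be rounded separately. -/
theorem sum_range_slotRate (N : ℕ) :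
    ∑ l ∈ Finset.range N, E.slotRate l =
      ∑ l ∈ Finset.range M, (E.slotRate l - E.slotRate (l + 1)) * ((min (l + 1) N : ℕ) : ℝ) := by
  have h : ∀ l', E.slotRate l' = ∑ l ∈ Finset.range M,
      (if l' ≤ l then E.slotRate l - E.slotRate (l + 1) else 0) := by
    intro l'
    rcases le_total l' M with hl | hl
    · exact (E.sum_slotRate_sub hl).symm
    · rw [E.slotRate_of_le hl, Finset.sum_eq_zero]
      intro l hlM
      rw [if_neg (by have := Finset.mem_range.1 hlM; omega)]
  rw [Finset.sum_congr rfl fun l' _ => h l', Finset.sum_comm]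
  refine Finset.sum_congr rfl fun l _ => ?_
  rw [← Finset.sum_filter, Finset.sum_const, nsmul_eq_mul, mul_comm]
  congr 2
  have : (Finset.range N).filter (fun l' => l' ≤ l) = Finset.range (min (l + 1) N) := by
    ext k; simp only [Finset.mem_filter, Finset.mem_range]; omega
  rw [this, Finset.card_range]

/-- The probability of the bids `b` on impression `j`. -/
noncomputable def bidProb (j : ι) (b : Fin n → E.bids) : ℝ := ∏ i, E.prob i j (b i)

theorem bidProb_nonneg (j : ι) (b : Fin n → E.bids) : 0 ≤ E.bidProb j b :=
  Finset.prod_nonneg fun i _ => E.prob_nonneg i j _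

theorem sum_bidProb (j : ι) : ∑ b, E.bidProb j b = 1 :=
  sum_prod_eq_one (w := fun i => E.prob i j) fun i => E.sum_prob i j

/-- The expected value on impression `j` when each network `i` is called out independently with
probability `x i`. -/
noncomputable def roundValue (j : ι) (x : Fin n → ℝ) : ℝ :=
  ∑ β : Fin n → Bool, ∑ b, (∏ i, if β i then x i else 1 - x i) * E.bidProb j b *
    E.slotValue (Finset.univ.filter fun i => β i = true) b

variable {E}

/-- The same decomposition by bid level v and slot number l on the side of the LP, so that the two
sides can be compared layer by layer. -/
theorem lpPart_eq_sum_gap (y : Fin n → E.bids → Fin M → ℝ) (i : Fin n) :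
    E.lpPart y i = ∑ v ∈ E.bids, ∑ l ∈ Finset.range M,
      E.gap v * (E.slotRate l - E.slotRate (l + 1)) *
        ∑ v' : E.bids, if v ≤ v' then ∑ l' : Fin M, if (l' : ℕ) ≤ l then y i v' l' else 0 else 0 := by
  unfold lpPart
  have h : ∀ (v' : E.bids) (l' : Fin M), (v' : ℝ) * E.discount l' * y i v' l' =
      ∑ v ∈ E.bids, ∑ l ∈ Finset.range M, E.gap v * (E.slotRate l - E.slotRate (l + 1)) *
        if v ≤ v' then (if (l' : ℕ) ≤ l then y i v' l' else 0) else 0 := by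
    intro v' l'
    conv_lhs => rw [E.eq_sum_gap v'.2, ← E.slotRate_fin, ← E.sum_slotRate_sub l'.2.le,
      Finset.sum_mul_sum, Finset.sum_mul]
    refine Finset.sum_congr rfl fun v _ => ?_
    rw [Finset.sum_mul]
    refine Finset.sum_congr rfl fun l _ => ?_
    split_ifs <;> ring
  simp only [h]
  have h2 : ∀ (v : ℝ) (l : ℕ), (∑ v' : E.bids, if v ≤ v' then
      ∑ l' : Fin M, if (l' : ℕ) ≤ l then y i v' l' else 0 else 0) =
      ∑ v' : E.bids, ∑ l' : Fin M, if v ≤ v' then (if (l' : ℕ) ≤ l then y i v' l' else 0) else 0 := by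
    intro v l
    refine Finset.sum_congr rfl fun v' _ => ?_
    split_ifs <;> simp
  simp only [h2, Finset.mul_sum]
  rw [Finset.sum_congr rfl fun v' _ => Finset.sum_comm]
  rw [Finset.sum_comm]
  refine Finset.sum_congr rfl fun v _ => ?_
  rw [Finset.sum_congr rfl fun v' _ => Finset.sum_comm]
  rw [Finset.sum_comm]

/-- Both sides are mixtures over layers (v, l) with the same weights of total at most L. In a layer,
rounding collects the truncated number of independent events "called out and bidding at least v", to
which `le_expect_min` applies. -/
theorem Feasible.le_roundValue {j : ι} {x : Fin n → ℝ} {y : Fin n → E.bids → Fin M → ℝ}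
    (h : E.Feasible j x y) (hL : 0 < E.maxBid) :
    (1 - 1 / Real.exp 1) * ∑ i, E.lpPart y i + 1 / (32 * E.maxBid) * ∑ i, E.lpPart y i ^ 2 ≤
      E.roundValue j x := by
  classical
  let I := E.bids ×ˢ Finset.range M
  let W : ℝ × ℕ → ℝ := fun p => E.gap p.1 * (E.slotRate p.2 - E.slotRate (p.2 + 1))
  have hW0 : ∀ p, 0 ≤ W p := fun p =>
    mul_nonneg (E.gap_nonneg _) (sub_nonneg.2 (E.slotRate_antitone (Nat.le_succ _)))
  let z : ℝ × ℕ → Fin n → ℝ := fun p i =>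
    ∑ v' : E.bids, if p.1 ≤ v' then ∑ l' : Fin M, if (l' : ℕ) ≤ p.2 then y i v' l' else 0 else 0
  have hV : ∀ i, E.lpPart y i = ∑ p ∈ I, W p * z p i := by
    intro i
    rw [lpPart_eq_sum_gap, Finset.sum_product]
  have hWsum : ∑ p ∈ I, W p ≤ E.maxBid := by
    rw [Finset.sum_product]
    simp only [W]
    simp only [← Finset.mul_sum]
    rw [← Finset.sum_mul, E.sum_gap]
    have := E.sum_slotRate_sub (Nat.zero_le M)
    simp only [Nat.zero_le, if_true] at this
    rw [this]
    exact mul_le_of_le_one_right hL.le (E.slotRate_le_one 0)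
  -- Cauchy–Schwarz against weights of total at most L. This is the origin of the factor 1/L in the
  -- surplus.
  have hVsq : ∀ i, E.lpPart y i ^ 2 ≤ E.maxBid * ∑ p ∈ I, W p * z p i ^ 2 := by
    intro i
    rw [hV]
    refine (Finset.sum_sq_le_sum_mul_sum_of_sq_le_mul I (f := W) (g := fun p => W p * z p i ^ 2)
      (fun p _ => hW0 p) (fun p _ => mul_nonneg (hW0 p) (sq_nonneg _)) fun p _ => le_of_eq (by ring)).trans ?_
    exact mul_le_mul_of_nonneg_right hWsum
      (Finset.sum_nonneg fun p _ => mul_nonneg (hW0 p) (sq_nonneg _))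
  let w : Fin n → Bool × E.bids → ℝ := fun i a => (if a.1 then x i else 1 - x i) * E.prob i j a.2
  have hw0 : ∀ i a, 0 ≤ w i a := by
    intro i a
    refine mul_nonneg ?_ (E.prob_nonneg i j _)
    split_ifs
    · exact h.x_nonneg i
    · exact sub_nonneg.2 (h.x_le i)
  have hw1 : ∀ i, ∑ a, w i a = 1 := by
    intro i
    simp only [w]
    rw [Fintype.sum_prod_type, Fintype.sum_bool]
    simp only [if_true, Bool.false_eq_true, if_false]
    rw [← Finset.mul_sum, ← Finset.mul_sum, E.sum_prob]
    ring
  have hterm : ∀ ω : Fin n → Bool × E.bids,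
      (∏ i, if (ω i).1 then x i else 1 - x i) * E.bidProb j (fun i => (ω i).2) *
        E.slotValue (Finset.univ.filter fun i => (ω i).1 = true) (fun i => (ω i).2) =
      ∑ p ∈ I, W p * ((∏ i, w i (ω i)) * ((min (p.2 + 1) (Finset.univ.filter fun i =>
        (ω i).1 = true ∧ p.1 ≤ (ω i).2).card : ℕ) : ℝ)) := by
    intro ω
    have hcount : ∀ v : ℝ, E.numAbove (Finset.univ.filter fun i => (ω i).1 = true)
        (fun i => (ω i).2) v =
        (Finset.univ.filter fun i => (ω i).1 = true ∧ v ≤ (ω i).2).card := by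
      intro v
      unfold numAbove
      congr 1
      ext i
      simp
    rw [slotValue_eq_sum_gap, Finset.sum_product]
    simp only [sum_range_slotRate, hcount, bidProb, w, W, Finset.prod_mul_distrib,
      Finset.mul_sum]
    refine Finset.sum_congr rfl fun v _ => Finset.sum_congr rfl fun l _ => ?_
    ring
  have hround : E.roundValue j x = ∑ p ∈ I, W p * ∑ ω : Fin n → Bool × E.bids,
      (∏ i, w i (ω i)) * ((min (p.2 + 1) (Finset.univ.filter fun i =>
        (ω i).1 = true ∧ p.1 ≤ (ω i).2).card : ℕ) : ℝ) := by
    unfold roundValue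
    rw [← Fintype.sum_prod_type',
      ← (Equiv.arrowProdEquivProdArrow (Fin n) (fun _ => Bool) (fun _ => E.bids)).sum_comp]
    simp only [Finset.mul_sum]
    rw [Finset.sum_comm]
    exact Finset.sum_congr rfl fun ω _ => hterm ω
  have hmain : ∀ p ∈ I, (1 - 1 / Real.exp 1) * ∑ i, z p i + 1 / 32 * ∑ i, z p i ^ 2 ≤
      ∑ ω : Fin n → Bool × E.bids,
      (∏ i, w i (ω i)) * ((min (p.2 + 1) (Finset.univ.filter fun i =>
        (ω i).1 = true ∧ p.1 ≤ (ω i).2).card : ℕ) : ℝ) := by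
    intro p hp
    -- Slots are numbered from 0, so the slots up to `p.2` are at most `p.2 + 1` in number and carry
    -- at most that much LP mass, which is the truncation level.
    refine le_expect_min (w := w) (fun _ a => a.1 = true ∧ p.1 ≤ a.2) hw0 hw1 (l := p.2 + 1)
      (by omega) (z := z p) ?_ ?_ ?_
    · intro i
      refine Finset.sum_nonneg fun v _ => ?_
      split_ifs
      · exact Finset.sum_nonneg fun l _ => by
          split_ifs
          · exact h.y_nonneg i v l
          · exact le_rfl
      · exact le_rfl
    · intro i
      simp only [w]
      rw [Fintype.sum_prod_type, Fintype.sum_bool]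
      simp only [if_true, true_and, Bool.false_eq_true, false_and, if_false, mul_zero,
        Finset.sum_const_zero, add_zero]
      refine Finset.sum_le_sum fun v _ => ?_
      split_ifs
      · rw [mul_one, mul_comm]
        refine le_trans (Finset.sum_le_sum fun l _ => ?_) (h.y_le i v)
        split_ifs
        · exact le_rfl
        · exact h.y_nonneg i v l
      · simp
    · calc ∑ i, z p i ≤ ∑ i, ∑ v' : E.bids, ∑ l' : Fin M, if (l' : ℕ) ≤ p.2 then y i v' l' else 0 := by
            refine Finset.sum_le_sum fun i _ => Finset.sum_le_sum fun v _ => ?_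
            split_ifs
            · exact le_rfl
            · exact Finset.sum_nonneg fun l _ => by
                split_ifs
                · exact h.y_nonneg i v l
                · exact le_rfl
        _ = ∑ l' : Fin M, if (l' : ℕ) ≤ p.2 then ∑ i, ∑ v' : E.bids, y i v' l' else 0 := by
            rw [Finset.sum_congr rfl fun i _ => Finset.sum_comm, Finset.sum_comm]
            refine Finset.sum_congr rfl fun l' _ => ?_
            split_ifs <;> simp
        _ ≤ ∑ l' : Fin M, if (l' : ℕ) ≤ p.2 then 1 else 0 := by
            refine Finset.sum_le_sum fun l' _ => ?_
            split_ifs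
            · exact h.slot_le l'
            · exact le_rfl
        _ = ((Finset.univ.filter fun l' : Fin M => (l' : ℕ) ≤ p.2).card : ℝ) := by
            rw [Finset.card_filter]; push_cast; rfl
        _ ≤ ((p.2 + 1 : ℕ) : ℝ) := by
            rw [Nat.cast_le, ← Finset.card_range (p.2 + 1)]
            refine Finset.card_le_card_of_injOn (fun l => (l : ℕ)) ?_ (fun a _ b _ hab => Fin.ext hab)
            intro l hl
            simp at hl ⊢
            omega
  rw [hround]
  refine le_trans ?_ (Finset.sum_le_sum fun p hp => mul_le_mul_of_nonneg_left (hmain p hp) (hW0 p))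
  have e1 : ∑ i, E.lpPart y i = ∑ p ∈ I, W p * ∑ i, z p i := by
    simp only [hV, Finset.mul_sum]
    rw [Finset.sum_comm]
  have e2 : ∑ i, E.lpPart y i ^ 2 ≤ E.maxBid * ∑ p ∈ I, W p * ∑ i, z p i ^ 2 := by
    refine (Finset.sum_le_sum fun i _ => hVsq i).trans (le_of_eq ?_)
    rw [← Finset.mul_sum, Finset.sum_comm]
    simp only [Finset.mul_sum]
  have e3 : 1 / (32 * E.maxBid) * ∑ i, E.lpPart y i ^ 2 ≤
      1 / 32 * ∑ p ∈ I, W p * ∑ i, z p i ^ 2 := by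
    rw [show (1 : ℝ) / (32 * E.maxBid) = 1 / 32 / E.maxBid by rw [div_div], div_mul_eq_mul_div,
      div_le_iff₀ hL]
    nlinarith
  rw [e1]
  refine (add_le_add_right e3 _).trans (le_of_eq ?_)
  rw [Finset.mul_sum, Finset.mul_sum, ← Finset.sum_add_distrib]
  exact Finset.sum_congr rfl fun p _ => by ring

/-- Independent rounding of an optimal solution of the decoupled LP retains `1 - 1/e` of its
value, with a surplus that is quadratic in the payments of the networks. -/
theorem IsOptimalCallOut.le_roundValue {j : ι} {c x : Fin n → ℝ} (h : E.IsOptimalCallOut j c x)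
    (hL : 0 < E.maxBid) (hc : ∀ i, 0 ≤ c i) :
    (1 - 1 / Real.exp 1) * (E.lpValue j c + ∑ i, c i * x i) +
      1 / (32 * E.maxBid) * ∑ i, (c i * x i) ^ 2 ≤ E.roundValue j x := by
  obtain ⟨y, hf, hy⟩ := h.exists_eq
  have h1 := hf.le_roundValue hL
  have h2 : ∑ i, E.lpPart y i = E.lpValue j c + ∑ i, c i * x i := by
    rw [← hy, objective_eq, ← Finset.sum_add_distrib]
    exact Finset.sum_congr rfl fun i _ => by ring
  have h3 : ∑ i, (c i * x i) ^ 2 ≤ ∑ i, E.lpPart y i ^ 2 := Finset.sum_le_sum fun i _ =>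
    pow_le_pow_left₀ (mul_nonneg (hc i) (h.nonneg i)) (h.mul_le_lpPart hf hy i) 2
  rw [h2] at h1
  have : 1 / (32 * E.maxBid) * ∑ i, (c i * x i) ^ 2 ≤
      1 / (32 * E.maxBid) * ∑ i, E.lpPart y i ^ 2 :=
    mul_le_mul_of_nonneg_left h3 (by positivity)
  linarith

/-- The expected net value of calling out the networks in `S` at prices `c` is at most the value
of the decoupled LP. -/
theorem IsOptimalCallOut.expect_slotValue_le {j : ι} {c x : Fin n → ℝ}
    (h : E.IsOptimalCallOut j c x) (S : Finset (Fin n)) :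
    ∑ b, E.bidProb j b * E.slotValue S b ≤ E.lpValue j c + ∑ i ∈ S, c i := by
  classical
  choose is hnd hmem hval using E.exists_assignment S
  -- The probability that network i bids v and is placed in slot l: the true slot allocation, read
  -- as an LP solution.
  let y : Fin n → E.bids → Fin M → ℝ := fun i v l =>
    ∑ b, E.bidProb j b * if (is b)[(l : ℕ)]? = some i ∧ b i = v then 1 else 0
  have hmarg : ∀ i (v : E.bids), ∑ b, E.bidProb j b * (if b i = v then 1 else 0) =
      E.prob i j v := by
    intro i v
    have := sum_prod_mul_apply (w := fun i => E.prob i j) (fun i => E.sum_prob i j) i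
      fun u => if u = v then 1 else 0
    simp only [mul_ite, mul_one, mul_zero, Finset.sum_ite_eq', Finset.mem_univ, if_true] at this ⊢
    exact this
  have hf : E.Feasible j (fun i => if i ∈ S then 1 else 0) y := by
    refine ⟨fun l => ?_, fun i => ?_, fun i v => ?_, fun i => ?_, fun i v l => ?_⟩
    · simp only [y]
      rw [Finset.sum_congr rfl fun i _ => Finset.sum_comm, Finset.sum_comm]
      refine (Finset.sum_le_sum fun b _ => ?_).trans (E.sum_bidProb j).le
      rw [Finset.sum_congr rfl fun i _ => (Finset.mul_sum _ _ _).symm, ← Finset.mul_sum]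
      refine mul_le_of_le_one_right (E.bidProb_nonneg j b) ?_
      have : ∀ i, (∑ v : E.bids, if (is b)[(l : ℕ)]? = some i ∧ b i = v then (1 : ℝ) else 0) =
          if (is b)[(l : ℕ)]? = some i then 1 else 0 := by
        intro i
        by_cases hi : (is b)[(l : ℕ)]? = some i <;> simp [hi]
      simp only [this]
      cases hopt : (is b)[(l : ℕ)]? with
      | none => simp
      | some k => simp
    · split_ifs <;> simp
    · simp only [y]
      rw [Finset.sum_comm, ← hmarg, Finset.sum_mul]
      refine Finset.sum_le_sum fun b _ => ?_
      rw [← Finset.mul_sum, mul_assoc]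
      refine mul_le_mul_of_nonneg_left ?_ (E.bidProb_nonneg j b)
      by_cases hb : b i = v
      · simp only [hb, and_true, if_true, one_mul]
        by_cases hi : i ∈ S
        · rw [if_pos hi]
          by_cases hex : ∃ l : Fin M, (is b)[(l : ℕ)]? = some i
          · obtain ⟨l, hl⟩ := hex
            rw [Finset.sum_eq_single l]
            · simp [hl]
            · intro l' _ hne
              refine if_neg fun hl' => hne ?_
              have hlt : (l : ℕ) < (is b).length := by
                by_contra hcon
                rw [List.getElem?_eq_none (by omega)] at hl
                cases hl
              exact Fin.ext ((List.getElem?_inj hlt (hnd b)).1 (hl.trans hl'.symm)).symm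
            · simp
          · push Not at hex
            rw [Finset.sum_eq_zero]
            · exact zero_le_one
            · intro l _; exact if_neg (hex l)
        · rw [if_neg hi, Finset.sum_eq_zero]
          intro l _
          exact if_neg fun hl => hi (hmem b i (List.mem_of_getElem? hl))
      · simp [hb]
    · split_ifs <;> simp
    · exact Finset.sum_nonneg fun b _ => mul_nonneg (E.bidProb_nonneg j b) (by split_ifs <;> simp)
  have hle := h.objective_le_lpValue hf
  have hobj : E.objective c (fun i => if i ∈ S then 1 else 0) y =
      ∑ b, E.bidProb j b * E.slotValue S b - ∑ i ∈ S, c i := by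
    rw [objective]
    congr 1
    · simp only [hval, y, Finset.mul_sum]
      rw [Finset.sum_congr rfl fun v _ => Finset.sum_congr rfl fun i _ => Finset.sum_comm,
        Finset.sum_congr rfl fun v _ => Finset.sum_comm, Finset.sum_comm]
      refine Finset.sum_congr rfl fun b _ => ?_
      rw [Finset.sum_comm, Finset.sum_comm (t := Finset.univ (α := Fin n))]
      refine Finset.sum_congr rfl fun i _ => ?_
      rw [Finset.sum_comm]
      refine Finset.sum_congr rfl fun l _ => ?_
      rw [Finset.sum_eq_single (b i)]
      · by_cases hi : (is b)[(l : ℕ)]? = some i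
        · simp only [hi, and_self, if_true]; ring
        · simp [hi]
      · intro v _ hv
        simp [Ne.symm hv]
      · simp
    · simp
  linarith

end Exchange

/-! ### Averages over the unit cube -/

/-- Resampling one coordinate preserves a product measure. -/
theorem measurePreserving_update {κ X : Type*} [Fintype κ] [DecidableEq κ] [MeasurableSpace X]
    (ν : Measure X) [IsProbabilityMeasure ν] (k : κ) :
    MeasurePreserving (fun p : (κ → X) × X => Function.update p.1 k p.2)
      ((Measure.pi fun _ : κ => ν).prod ν) (Measure.pi fun _ => ν) where
  measurable := by
    refine measurable_pi_iff.2 fun i => ?_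
    by_cases hi : i = k
    · subst hi; simpa using measurable_snd
    · simp only [Function.update_of_ne hi]
      exact (measurable_pi_apply i).comp measurable_fst
  map_eq := by
    refine (Measure.pi_eq fun s hs => ?_).symm
    have hmeas : Measurable fun p : (κ → X) × X => Function.update p.1 k p.2 := by
      refine measurable_pi_iff.2 fun i => ?_
      by_cases hi : i = k
      · subst hi; simpa using measurable_snd
      · simp only [Function.update_of_ne hi]
        exact (measurable_pi_apply i).comp measurable_fst
    rw [Measure.map_apply hmeas (MeasurableSet.univ_pi hs)]
    have : (fun p : (κ → X) × X => Function.update p.1 k p.2) ⁻¹' Set.univ.pi s =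
        Set.univ.pi (Function.update s k Set.univ) ×ˢ s k := by
      ext p
      simp only [Set.mem_preimage, Set.mem_pi, Set.mem_univ, true_imp_iff, Set.mem_prod]
      constructor
      · intro h
        refine ⟨fun i => ?_, by simpa using h k⟩
        by_cases hi : i = k
        · subst hi; simp
        · simpa [hi] using h i
      · rintro ⟨h1, h2⟩ i
        by_cases hi : i = k
        · subst hi; simpa using h2
        · simpa [hi] using h1 i
    rw [this, Measure.prod_prod, Measure.pi_pi, ← Finset.mul_prod_erase _ _ (Finset.mem_univ k),
      ← Finset.mul_prod_erase _ _ (Finset.mem_univ k), mul_comm]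
    simp only [Function.update_self, measure_univ, one_mul]
    congr 1
    refine Finset.prod_congr rfl fun i hi => ?_
    rw [Function.update_of_ne (Finset.ne_of_mem_erase hi)]

theorem integral_eq_integral_update {κ X : Type*} [Fintype κ] [DecidableEq κ] [MeasurableSpace X]
    (ν : Measure X) [IsProbabilityMeasure ν] (k : κ) {F : (κ → X) → ℝ}
    (hF : Integrable F (Measure.pi fun _ => ν)) :
    ∫ u, F u ∂(Measure.pi fun _ => ν) =
      ∫ u, ∫ v, F (Function.update u k v) ∂ν ∂(Measure.pi fun _ => ν) := by
  have h := measurePreserving_update ν k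
  have hF' : AEStronglyMeasurable F (((Measure.pi fun _ : κ => ν).prod ν).map
      fun p : (κ → X) × X => Function.update p.1 k p.2) := by
    rw [h.map_eq]; exact hF.aestronglyMeasurable
  calc ∫ u, F u ∂(Measure.pi fun _ => ν) = ∫ u, F u ∂(((Measure.pi fun _ : κ => ν).prod ν).map
      fun p : (κ → X) × X => Function.update p.1 k p.2) := by rw [h.map_eq]
    _ = ∫ p : (κ → X) × X, F (Function.update p.1 k p.2) ∂((Measure.pi fun _ : κ => ν).prod ν) :=
      integral_map h.measurable.aemeasurable hF'
    _ = _ := integral_prod (fun p : (κ → X) × X => F (Function.update p.1 k p.2))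
      (h.integrable_comp_of_integrable hF)

theorem integrable_of_mem_unit {X : Type*} [MeasurableSpace X] {μ : Measure X} [IsFiniteMeasure μ]
    {f : X → ℝ} (hf : Measurable f) (h0 : ∀ x, 0 ≤ f x) (h1 : ∀ x, f x ≤ 1) : Integrable f μ :=
  Integrable.of_bound hf.aestronglyMeasurable 1 (Filter.Eventually.of_forall fun x => by
    rw [Real.norm_eq_abs, abs_of_nonneg (h0 x)]; exact h1 x)

theorem integral_unitInterval_eq (f : ℝ → ℝ) :
    ∫ v : unitInterval, f v = ∫ v in (0 : ℝ)..1, f v := by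
  rw [intervalIntegral.integral_of_le zero_le_one, ← integral_Icc_eq_integral_Ioc]
  exact integral_subtype measurableSet_Icc f

/-- The windows of length η starting at a and b differ, up to common parts, by two pieces of length
|a - b|, on each of which the integral lies between 0 and |a - b|. -/
theorem abs_integral_window_sub_le {h : ℝ → ℝ} (hm : Measurable h) (h0 : ∀ x, 0 ≤ h x)
    (h1 : ∀ x, h x ≤ 1) {η : ℝ} (hη : 0 < η) (a b : ℝ) :
    |(∫ v : unitInterval, h (a + η * v)) - ∫ v : unitInterval, h (b + η * v)| ≤ |a - b| / η := by
  have hint : ∀ c d : ℝ, IntervalIntegrable h volume c d := fun c d =>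
    ⟨integrable_of_mem_unit hm h0 h1, integrable_of_mem_unit hm h0 h1⟩
  have hone : ∀ c d : ℝ, c ≤ d → 0 ≤ ∫ x in c..d, h x ∧ ∫ x in c..d, h x ≤ d - c := by
    intro c d hcd
    refine ⟨intervalIntegral.integral_nonneg hcd fun x _ => h0 x, ?_⟩
    have := intervalIntegral.integral_mono_on hcd (hint c d) (intervalIntegrable_const (c := 1))
      fun x _ => h1 x
    simpa using this
  have key : ∀ c d : ℝ, c ≤ d →
      |(∫ x in c..(c + η), h x) - ∫ x in d..(d + η), h x| ≤ d - c := by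
    intro c d hcd
    rw [intervalIntegral.integral_interval_sub_interval_comm (hint _ _) (hint _ _) (hint _ _)]
    have h2 := hone c d hcd
    have h3 := hone (c + η) (d + η) (by linarith)
    rw [abs_le]
    constructor <;> linarith [h2.1, h2.2, h3.1, h3.2]
  rw [integral_unitInterval_eq fun v => h (a + η * v),
    integral_unitInterval_eq fun v => h (b + η * v),
    intervalIntegral.integral_comp_add_mul _ hη.ne', intervalIntegral.integral_comp_add_mul _ hη.ne',
    ← smul_sub, smul_eq_mul, abs_mul, abs_of_pos (inv_pos.2 hη), mul_zero, mul_one, add_zero,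
    add_zero, inv_mul_eq_div]
  refine div_le_div_of_nonneg_right ?_ hη.le
  rcases le_total a b with hab | hab
  · rw [abs_sub_comm a b, abs_of_nonneg (sub_nonneg.2 hab)]
    exact key a b hab
  · rw [abs_sub_comm, abs_of_nonneg (sub_nonneg.2 hab)]
    exact key b a hab

section Cube

variable {n : ℕ}

/-- The point of the cube `[0, η]ⁿ` with relative coordinates `u`. -/
def cubePoint (η : ℝ) (u : Fin n → unitInterval) : Fin n → ℝ := fun i => η * u i

theorem measurable_cubePoint (η : ℝ) : Measurable (cubePoint η : (Fin n → unitInterval) → _) :=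
  measurable_pi_iff.2 fun i =>
    (measurable_subtype_coe.comp (measurable_pi_apply i)).const_mul η

theorem add_cubePoint_update (η : ℝ) (lam : Fin n → ℝ) (u : Fin n → unitInterval) (k : Fin n)
    (v : unitInterval) : lam + cubePoint η (Function.update u k v) =
      Function.update (lam + cubePoint η u) k (lam k + η * v) := by
  ext i
  by_cases hi : i = k
  · subst hi; simp [cubePoint]
  · simp [cubePoint, hi]

theorem integral_cube_eq {g : (Fin n → ℝ) → ℝ} (hm : Measurable g) (h0 : ∀ x, 0 ≤ g x)
    (h1 : ∀ x, g x ≤ 1) (η : ℝ) (lam : Fin n → ℝ) (k : Fin n) :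
    ∫ u, g (lam + cubePoint η u) = ∫ u : Fin n → unitInterval, ∫ v : unitInterval,
      g (Function.update (lam + cubePoint η u) k (lam k + η * v)) := by
  have := integral_eq_integral_update (volume : Measure unitInterval) k
    (F := fun u : Fin n → unitInterval => g (lam + cubePoint η u))
    (integrable_of_mem_unit (hm.comp ((measurable_cubePoint η).const_add lam)) (fun _ => h0 _)
      fun _ => h1 _)
  simp only [add_cubePoint_update] at this
  exact this

/-- Passes from x to y by changing one coordinate at a time. -/
theorem abs_sub_le_of_coordinatewise {f : (Fin n → ℝ) → ℝ} {C : ℝ}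
    (h : ∀ x k a, |f (Function.update x k a) - f x| ≤ C * |a - x k|) (x y : Fin n → ℝ) :
    |f y - f x| ≤ C * ∑ k, |y k - x k| := by
  classical
  have key : ∀ A : Finset (Fin n), |f (A.piecewise y x) - f x| ≤ C * ∑ k ∈ A, |y k - x k| := by
    intro A
    induction A using Finset.induction_on with
    | empty => simp
    | insert k A hk ih =>
      rw [Finset.piecewise_insert, Finset.sum_insert hk, mul_add]
      have := h (A.piecewise y x) k (y k)
      rw [Finset.piecewise_eq_of_notMem _ _ _ hk] at this
      calc _ ≤ |f (Function.update (A.piecewise y x) k (y k)) - f (A.piecewise y x)| +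
            |f (A.piecewise y x) - f x| := abs_sub_le _ _ _
        _ ≤ _ := add_le_add this ih
  simpa using key Finset.univ

/-- The average of a function with values in `[0, 1]` over a cube of side `η` is
`1/η`-Lipschitz in the position of the cube. -/
theorem abs_integral_cube_sub_le {g : (Fin n → ℝ) → ℝ} (hm : Measurable g) (h0 : ∀ x, 0 ≤ g x)
    (h1 : ∀ x, g x ≤ 1) {η : ℝ} (hη : 0 < η) (lam lam' : Fin n → ℝ) :
    |(∫ u, g (lam' + cubePoint η u)) - ∫ u, g (lam + cubePoint η u)| ≤
      1 / η * ∑ k, |lam' k - lam k| := by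
  refine abs_sub_le_of_coordinatewise (f := fun lam => ∫ u, g (lam + cubePoint η u))
    (fun lam k a => ?_) lam lam'
  have e : ∀ u : Fin n → unitInterval, ∀ c, Function.update (Function.update lam k a +
      cubePoint η u) k c = Function.update (lam + cubePoint η u) k c := by
    intro u c
    ext i
    by_cases hi : i = k
    · subst hi; simp
    · simp [hi]
  have hint : ∀ b : ℝ, Integrable fun u : Fin n → unitInterval => ∫ v : unitInterval,
      g (Function.update (lam + cubePoint η u) k (b + η * v)) := by
    intro b
    refine integrable_of_mem_unit ?_ (fun u => integral_nonneg fun v => h0 _) fun u => ?_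
    · refine StronglyMeasurable.measurable (StronglyMeasurable.integral_prod_right'
        (f := fun p : (Fin n → unitInterval) × unitInterval =>
          g (Function.update (lam + cubePoint η p.1) k (b + η * p.2))) ?_)
      refine (hm.comp (measurable_pi_iff.2 fun i => ?_)).stronglyMeasurable
      by_cases hi : i = k
      · subst hi
        simpa using (measurable_subtype_coe.comp measurable_snd).const_mul η |>.const_add b
      · simp only [Function.update_of_ne hi, Pi.add_apply, cubePoint]
        exact ((measurable_subtype_coe.comp ((measurable_pi_apply i).comp
          measurable_fst)).const_mul η).const_add _
    · refine (integral_mono_of_nonneg (Filter.Eventually.of_forall fun v => h0 _)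
        (integrable_const (1 : ℝ)) (Filter.Eventually.of_forall fun v => h1 _)).trans ?_
      simp
  rw [integral_cube_eq hm h0 h1 η _ k, integral_cube_eq hm h0 h1 η lam k]
  simp only [e, Function.update_self]
  rw [← integral_sub (hint _) (hint _), one_div_mul_eq_div, ← Real.norm_eq_abs]
  refine (norm_integral_le_of_norm_le_const (C := |a - lam k| / η)
    (Filter.Eventually.of_forall fun u => ?_)).trans ?_
  · exact abs_integral_window_sub_le
      (h := fun x => g (Function.update (lam + cubePoint η u) k x))
      (hm.comp (measurable_update _)) (fun _ => h0 _) (fun _ => h1 _) hη _ _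
  · simp

end Cube

namespace Exchange

variable {n M : ℕ} {ι : Type} {E : Exchange n M ι}

/-! ### Solvers of the decoupled linear programs -/

/-- The part of an optimal solution that belongs to network `i` decreases in its price. -/
theorem IsOptimalCallOut.apply_le {j : ι} {c x x' : Fin n → ℝ} {i : Fin n} {a b : ℝ}
    (h : E.IsOptimalCallOut j (Function.update c i a) x)
    (h' : E.IsOptimalCallOut j (Function.update c i b) x') (hab : a < b) : x' i ≤ x i := by
  have := h.sum_mul_nonneg h'
  rw [Finset.sum_eq_single i (fun k _ hk => by simp [hk]) (by simp)] at this
  simp only [Function.update_self] at this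
  nlinarith

/-- At a continuity point of f, the values of f on both sides squeeze g. A monotone function has
only countably many discontinuities. -/
theorem countable_ne_of_interleaved {f g : ℝ → ℝ} (hf : Antitone f)
    (h1 : ∀ a b, a < b → g b ≤ f a) (h2 : ∀ a b, a < b → f b ≤ g a) :
    {x | f x ≠ g x}.Countable := by
  refine Set.Countable.mono (s₁ := {x | f x ≠ g x}) ?_ hf.countable_not_continuousAt
  intro x hx
  change ¬ContinuousAt f x
  intro hc
  refine hx (le_antisymm ?_ ?_)
  · refine le_of_tendsto (f := f) (x := nhdsWithin x (Set.Ioi x))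
      (hc.tendsto.mono_left nhdsWithin_le_nhds) ?_
    filter_upwards [self_mem_nhdsWithin] with b hb using h2 x b hb
  · refine ge_of_tendsto (f := f) (x := nhdsWithin x (Set.Iio x))
      (hc.tendsto.mono_left nhdsWithin_le_nhds) ?_
    filter_upwards [self_mem_nhdsWithin] with b hb using h1 b x hb

namespace IsSolver

variable {solve solve' : ι → (Fin n → ℝ) → Fin n → ℝ}

theorem measurable_apply (h : E.IsSolver solve) (j : ι) (i : Fin n) :
    Measurable fun c => solve j c i := (measurable_pi_apply i).comp (h j).1

theorem nonneg (h : E.IsSolver solve) (j : ι) (c : Fin n → ℝ) (i : Fin n) : 0 ≤ solve j c i :=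
  ((h j).2 c).nonneg i

theorem le_one (h : E.IsSolver solve) (j : ι) (c : Fin n → ℝ) (i : Fin n) : solve j c i ≤ 1 :=
  ((h j).2 c).le_one i

theorem countable_ne (h : E.IsSolver solve) (h' : E.IsSolver solve') (j : ι) (c : Fin n → ℝ)
    (i : Fin n) : {a | solve j (Function.update c i a) i ≠
      solve' j (Function.update c i a) i}.Countable := by
  refine countable_ne_of_interleaved (fun a b hab => ?_)
    (fun a b hab => ((h j).2 _).apply_le ((h' j).2 _) hab)
    (fun a b hab => ((h' j).2 _).apply_le ((h j).2 _) hab)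
  rcases hab.eq_or_lt with rfl | hab
  · exact le_rfl
  · exact ((h j).2 _).apply_le ((h j).2 _) hab

end IsSolver

/-- The average over the perturbation of the `p`-th power of the probability of calling out
network `i` on impression `j` at prices `lam`. -/
noncomputable def avgUse (solve : ι → (Fin n → ℝ) → Fin n → ℝ) (η : ℝ) (p : ℕ) (i : Fin n)
    (lam : Fin n → ℝ) (j : ι) : ℝ :=
  ∫ u, solve j (lam + cubePoint η u) i ^ p

namespace IsSolver

variable {solve solve' : ι → (Fin n → ℝ) → Fin n → ℝ}

theorem integrable_pow (h : E.IsSolver solve) (η : ℝ) (p : ℕ) (i : Fin n) (lam : Fin n → ℝ)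
    (j : ι) : Integrable fun u => solve j (lam + cubePoint η u) i ^ p :=
  integrable_of_mem_unit (((h.measurable_apply j i).comp
    ((measurable_cubePoint η).const_add lam)).pow_const p)
    (fun _ => pow_nonneg (h.nonneg _ _ _) _) fun _ => pow_le_one₀ (h.nonneg _ _ _) (h.le_one _ _ _)

theorem avgUse_nonneg (h : E.IsSolver solve) (η : ℝ) (p : ℕ) (i : Fin n) (lam : Fin n → ℝ)
    (j : ι) : 0 ≤ avgUse solve η p i lam j :=
  integral_nonneg fun _ => pow_nonneg (h.nonneg _ _ _) _

theorem avgUse_le_one (h : E.IsSolver solve) (η : ℝ) (p : ℕ) (i : Fin n) (lam : Fin n → ℝ)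
    (j : ι) : avgUse solve η p i lam j ≤ 1 := by
  refine (integral_mono (h.integrable_pow η p i lam j) (integrable_const (1 : ℝ))
    fun _ => pow_le_one₀ (h.nonneg _ _ _) (h.le_one _ _ _)).trans ?_
  simp

/-- Jensen's inequality, from the nonnegative variance. It lets Q_i bound the variance also of
impressions whose perturbation has been averaged out. -/
theorem avgUse_one_sq_le (h : E.IsSolver solve) (η : ℝ) (i : Fin n) (lam : Fin n → ℝ) (j : ι) :
    avgUse solve η 1 i lam j ^ 2 ≤ avgUse solve η 2 i lam j := by
  set a := avgUse solve η 1 i lam j with ha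
  have h1 := h.integrable_pow η 1 i lam j
  have h2 := h.integrable_pow η 2 i lam j
  have : 0 ≤ ∫ u, (solve j (lam + cubePoint η u) i - a) ^ 2 := integral_nonneg fun _ => sq_nonneg _
  have e : ∀ u : Fin n → unitInterval, (solve j (lam + cubePoint η u) i - a) ^ 2 =
      solve j (lam + cubePoint η u) i ^ 2 -
      ((2 * a) * solve j (lam + cubePoint η u) i ^ 1 - a ^ 2) := by
    intro u; ring
  simp only [e] at this
  have h3 : Integrable fun u : Fin n → unitInterval =>
      2 * a * solve j (lam + cubePoint η u) i ^ 1 - a ^ 2 :=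
    (h1.const_mul _).sub (integrable_const _)
  rw [integral_sub h2 h3, integral_sub (h1.const_mul _) (integrable_const _),
    integral_const_mul] at this
  simp only [integral_const, probReal_univ, one_smul] at this
  change 0 ≤ avgUse solve η 2 i lam j - (2 * a * a - a ^ 2) at this
  nlinarith

/-- Along the own price of network i, two solvers differ on a countable set only, so averaging over
that coordinate of the perturbation removes the dependence on the solver. -/
theorem avgUse_eq (h : E.IsSolver solve) (h' : E.IsSolver solve') {η : ℝ} (hη : 0 < η) (p : ℕ)
    (i : Fin n) (lam : Fin n → ℝ) (j : ι) :
    avgUse solve η p i lam j = avgUse solve' η p i lam j := by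
  unfold avgUse
  rw [integral_cube_eq (g := fun c => solve j c i ^ p) ((h.measurable_apply j i).pow_const p)
      (fun _ => pow_nonneg (h.nonneg _ _ _) _)
      (fun _ => pow_le_one₀ (h.nonneg _ _ _) (h.le_one _ _ _)) η lam i,
    integral_cube_eq (g := fun c => solve' j c i ^ p) ((h'.measurable_apply j i).pow_const p)
      (fun _ => pow_nonneg (h'.nonneg _ _ _) _)
      (fun _ => pow_le_one₀ (h'.nonneg _ _ _) (h'.le_one _ _ _)) η lam i]
  refine integral_congr_ae (Filter.Eventually.of_forall fun u => ?_)
  refine integral_congr_ae ?_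
  have hc := (h.countable_ne h' j (lam + cubePoint η u) i).preimage_of_injOn
    (f := fun v : unitInterval => lam i + η * (v : ℝ))
    (fun v _ w _ hvw => Subtype.ext (mul_left_cancel₀ hη.ne' (add_left_cancel hvw)))
  filter_upwards [hc.ae_notMem volume] with v hv
  simp only [Set.mem_preimage, Set.mem_ofPred_eq, not_not] at hv
  rw [hv]

theorem abs_avgUse_sub_le (h : E.IsSolver solve) {η : ℝ} (hη : 0 < η) (p : ℕ)
    (i : Fin n) (lam lam' : Fin n → ℝ) (j : ι) :
    |avgUse solve η p i lam' j - avgUse solve η p i lam j| ≤ 1 / η * ∑ k, |lam' k - lam k| :=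
  abs_integral_cube_sub_le (g := fun c => solve j c i ^ p) ((h.measurable_apply j i).pow_const p)
      (fun _ => pow_nonneg (h.nonneg _ _ _) _)
      (fun _ => pow_le_one₀ (h.nonneg _ _ _) (h.le_one _ _ _)) hη lam lam'

theorem avgUse_eq_zero (h : E.IsSolver solve) {η : ℝ} (hη : 0 < η) {p : ℕ} (hp : p ≠ 0)
    {i : Fin n} {lam : Fin n → ℝ} (hi : E.maxBid < lam i) (j : ι) :
    avgUse solve η p i lam j = 0 := by
  unfold avgUse
  rw [integral_eq_zero_of_ae]
  refine Filter.Eventually.of_forall fun u => ?_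
  have : E.maxBid < (lam + cubePoint η u) i := by
    have := mul_nonneg hη.le (u i).2.1
    simp only [Pi.add_apply, cubePoint]
    linarith
  change solve j (lam + cubePoint η u) i ^ p = 0
  rw [((h j).2 _).eq_zero this, zero_pow hp]

end IsSolver

end Exchange

/-! ### Expectations over lists of independent outcomes -/

section ListExp

variable {S : Type*} [MeasurableSpace S]

/-- A function on lists that is measurable on the lists of each length. -/
def ListMeasurable {α : Type*} [MeasurableSpace α] (F : List S → α) : Prop :=
  ∀ k, Measurable fun ω : Fin k → S => F (List.ofFn ω)

/-- A real function on lists that is measurable and bounded on the lists of each length. -/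
structure Tame (F : List S → ℝ) : Prop where
  measurable : ListMeasurable F
  bounded : ∀ k, ∃ C, ∀ ω : Fin k → S, |F (List.ofFn ω)| ≤ C

/-- The expectation over a list of `k` independent outcomes with law `μ`. -/
noncomputable def listExp (μ : Measure S) (k : ℕ) (F : List S → ℝ) : ℝ :=
  ∫ ω : Fin k → S, F (List.ofFn ω) ∂(Measure.pi fun _ => μ)

theorem listExp_const_mul (μ : Measure S) (c : ℝ) (F : List S → ℝ) (k : ℕ) :
    listExp μ k (fun l => c * F l) = c * listExp μ k F := integral_const_mul _ _

theorem ListMeasurable.append_right {α : Type*} [MeasurableSpace α] {F : List S → α}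
    (hF : ListMeasurable F) (e : List S) : ListMeasurable fun l => F (l ++ e) := by
  intro k
  have h : ∀ ω : Fin k → S, List.ofFn ω ++ e = List.ofFn (Fin.append ω e.get) := by
    intro ω; rw [List.ofFn_fin_append, List.ofFn_get]
  simp only [h]
  refine (hF (k + e.length)).comp (measurable_pi_iff.2 fun i => ?_)
  refine Fin.addCases (fun i => ?_) (fun i => ?_) i
  · simpa using measurable_pi_apply i
  · simp

theorem ListMeasurable.comp {α β : Type*} [MeasurableSpace α] [MeasurableSpace β] {F : List S → α}
    (hF : ListMeasurable F) {g : α → β} (hg : Measurable g) : ListMeasurable fun l => g (F l) :=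
  fun k => hg.comp (hF k)

theorem ListMeasurable.cons {α : Type*} [MeasurableSpace α] {F : List S → α}
    (h : ListMeasurable F) (k : ℕ) :
    Measurable fun p : S × (Fin k → S) => F (p.1 :: List.ofFn p.2) := by
  have hc : Measurable fun p : S × (Fin k → S) => (Fin.cons p.1 p.2 : Fin (k + 1) → S) := by
    refine measurable_pi_iff.2 fun i => ?_
    refine Fin.cases ?_ (fun i => ?_) i
    · simpa using measurable_fst
    · simp only [Fin.cons_succ]
      exact (measurable_pi_apply i).comp measurable_snd
  have := (h (k + 1)).comp hc
  simpa only [Function.comp_def, List.ofFn_succ, Fin.cons_zero, Fin.cons_succ] using this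

namespace Tame

variable {F G : List S → ℝ}

theorem const (c : ℝ) : Tame fun _ : List S => c :=
  ⟨fun _ => measurable_const, fun _ => ⟨|c|, fun _ => le_rfl⟩⟩

theorem add (hF : Tame F) (hG : Tame G) : Tame fun l => F l + G l where
  measurable k := (hF.measurable k).add (hG.measurable k)
  bounded k := by
    obtain ⟨A, hA⟩ := hF.bounded k
    obtain ⟨B, hB⟩ := hG.bounded k
    exact ⟨A + B, fun ω => (abs_add_le _ _).trans (add_le_add (hA ω) (hB ω))⟩

theorem mul (hF : Tame F) (hG : Tame G) : Tame fun l => F l * G l where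
  measurable k := (hF.measurable k).mul (hG.measurable k)
  bounded k := by
    obtain ⟨A, hA⟩ := hF.bounded k
    obtain ⟨B, hB⟩ := hG.bounded k
    refine ⟨A * B, fun ω => ?_⟩
    rw [abs_mul]
    exact mul_le_mul (hA ω) (hB ω) (abs_nonneg _) ((abs_nonneg _).trans (hA ω))

theorem const_mul (hF : Tame F) (c : ℝ) : Tame fun l => c * F l := (const c).mul hF

theorem sub (hF : Tame F) (hG : Tame G) : Tame fun l => F l - G l := by
  simpa [sub_eq_add_neg] using hF.add (hG.const_mul (-1))

theorem sum {κ : Type*} (s : Finset κ) {F : κ → List S → ℝ} (hF : ∀ k ∈ s, Tame (F k)) :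
    Tame fun l => ∑ k ∈ s, F k l := by
  classical
  induction s using Finset.induction_on with
  | empty => simpa using const 0
  | insert a s ha ih =>
    simp only [Finset.sum_insert ha]
    exact (hF a (Finset.mem_insert_self _ _)).add
      (ih fun k hk => hF k (Finset.mem_insert_of_mem hk))

theorem append_right (hF : Tame F) (e : List S) : Tame fun l => F (l ++ e) where
  measurable := hF.measurable.append_right e
  bounded k := by
    obtain ⟨C, hC⟩ := hF.bounded (k + e.length)
    refine ⟨C, fun ω => ?_⟩
    have := hC (Fin.append ω e.get)
    rwa [List.ofFn_fin_append, List.ofFn_get] at this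

variable {μ : Measure S} [IsProbabilityMeasure μ]

theorem integrable (hF : Tame F) (k : ℕ) :
    Integrable (fun ω : Fin k → S => F (List.ofFn ω)) (Measure.pi fun _ => μ) := by
  obtain ⟨C, hC⟩ := hF.bounded k
  exact Integrable.of_bound (hF.measurable k).aestronglyMeasurable C
    (Filter.Eventually.of_forall hC)

theorem exists_bound_cons (hF : Tame F) (k : ℕ) :
    ∃ C, ∀ s, ∀ ω : Fin k → S, |F (s :: List.ofFn ω)| ≤ C := by
  obtain ⟨C, hC⟩ := hF.bounded (k + 1)
  refine ⟨C, fun s ω => ?_⟩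
  have := hC (Fin.cons s ω)
  simpa [List.ofFn_succ] using this

theorem integral_cons (hF : Tame F) : Tame fun l => ∫ s, F (s :: l) ∂μ where
  measurable k := by
    have : StronglyMeasurable fun p : (Fin k → S) × S => F (p.2 :: List.ofFn p.1) :=
      ((hF.measurable.cons k).comp (measurable_snd.prodMk measurable_fst)).stronglyMeasurable
    exact this.integral_prod_right'.measurable
  bounded k := by
    obtain ⟨C, hC⟩ := hF.exists_bound_cons k
    refine ⟨C, fun ω => ?_⟩
    have := norm_integral_le_of_norm_le_const (μ := μ) (f := fun s => F (s :: List.ofFn ω))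
      (Filter.Eventually.of_forall fun s => hC s ω)
    simpa using this

end Tame

variable {μ : Measure S} [IsProbabilityMeasure μ] {F G : List S → ℝ}

@[simp]
theorem listExp_zero (F : List S → ℝ) : listExp μ 0 F = F [] := by simp [listExp]

@[simp]
theorem listExp_const (k : ℕ) (c : ℝ) : listExp μ k (fun _ => c) = c := by simp [listExp]

theorem listExp_add (hF : Tame F) (hG : Tame G) (k : ℕ) :
    listExp μ k (fun l => F l + G l) = listExp μ k F + listExp μ k G :=
  integral_add (hF.integrable k) (hG.integrable k)

theorem listExp_sub (hF : Tame F) (hG : Tame G) (k : ℕ) :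
    listExp μ k (fun l => F l - G l) = listExp μ k F - listExp μ k G :=
  integral_sub (hF.integrable k) (hG.integrable k)

theorem listExp_sum {κ : Type*} (s : Finset κ) {F : κ → List S → ℝ} (hF : ∀ k ∈ s, Tame (F k))
    (k : ℕ) : listExp μ k (fun l => ∑ i ∈ s, F i l) = ∑ i ∈ s, listExp μ k (F i) :=
  integral_finsetSum _ fun i hi => (hF i hi).integrable k

theorem listExp_mono (hF : Tame F) (hG : Tame G) {k : ℕ}
    (h : ∀ l : List S, l.length = k → F l ≤ G l) : listExp μ k F ≤ listExp μ k G :=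
  integral_mono (hF.integrable k) (hG.integrable k) fun ω => h _ (by simp)

theorem listExp_succ (hF : Tame F) (k : ℕ) :
    listExp μ (k + 1) F = listExp μ k fun l => ∫ s, F (s :: l) ∂μ := by
  have hp := measurePreserving_piFinSuccAbove (fun _ : Fin (k + 1) => μ) 0
  have h1 := hp.integral_comp' fun p : S × (Fin k → S) => F (p.1 :: List.ofFn p.2)
  have h2 : ∀ ω : Fin (k + 1) → S, (fun p : S × (Fin k → S) => F (p.1 :: List.ofFn p.2))
      (MeasurableEquiv.piFinSuccAbove (fun _ => S) 0 ω) = F (List.ofFn ω) := by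
    intro ω
    simp only [List.ofFn_succ]
    rfl
  simp only [h2] at h1
  unfold listExp
  rw [h1, integral_prod_symm]
  obtain ⟨C, hC⟩ := hF.exists_bound_cons k
  exact Integrable.of_bound (hF.measurable.cons k).aestronglyMeasurable C
    (Filter.Eventually.of_forall fun p => hC p.1 p.2)

theorem listExp_succ_append (hF : Tame F) (k : ℕ) (e : List S) :
    listExp μ (k + 1) (fun l => F (l ++ e)) =
      listExp μ k fun l => (fun l => ∫ s, F (s :: l) ∂μ) (l ++ e) :=
  listExp_succ (hF.append_right e) k

theorem Tame.listExp_append (hF : Tame F) (k : ℕ) :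
    Tame fun e => listExp μ k fun l => F (l ++ e) := by
  induction k generalizing F with
  | zero => simpa using hF
  | succ k ih =>
    simp only [listExp_succ_append hF]
    exact ih hF.integral_cons

/-- Lists are most recent first, so `e` holds the first t outcomes and `l` the k later ones. -/
theorem listExp_add_length (hF : Tame F) (k t : ℕ) :
    listExp μ (k + t) F = listExp μ t fun e => listExp μ k fun l => F (l ++ e) := by
  induction k generalizing F with
  | zero => simp
  | succ k ih =>
    rw [Nat.add_right_comm, listExp_succ hF, ih hF.integral_cons]
    simp only [listExp_succ_append hF]

theorem listExp_prod_map (f : S → ℝ) (k : ℕ) :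
    listExp μ k (fun l => (l.map f).prod) = (∫ s, f s ∂μ) ^ k := by
  unfold listExp
  simp only [List.map_ofFn, List.prod_ofFn, Function.comp_apply]
  simpa using integral_fintype_prod_eq_pow (ι := Fin k) (μ := μ) f

theorem Tame.prod_map {f : S → ℝ} (hf : Measurable f) {C : ℝ} (hC : ∀ s, |f s| ≤ C) :
    Tame fun l : List S => (l.map f).prod where
  measurable k := by
    simp only [List.map_ofFn, List.prod_ofFn, Function.comp_apply]
    exact Finset.measurable_prod _ fun i _ => hf.comp (measurable_pi_apply i)
  bounded k := by
    refine ⟨C ^ k, fun ω => ?_⟩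
    simp only [List.map_ofFn, List.prod_ofFn, Function.comp_apply, Finset.abs_prod]
    refine (Finset.prod_le_prod (fun _ _ => abs_nonneg _) fun i _ => hC (ω i)).trans ?_
    simp

theorem Tame.sum_map {f : S → ℝ} (hf : Measurable f) {C : ℝ} (hC : ∀ s, |f s| ≤ C) :
    Tame fun l : List S => (l.map f).sum where
  measurable k := by
    simp only [List.map_ofFn, List.sum_ofFn, Function.comp_apply]
    exact Finset.measurable_sum _ fun i _ => hf.comp (measurable_pi_apply i)
  bounded k := by
    refine ⟨k * C, fun ω => ?_⟩
    simp only [List.map_ofFn, List.sum_ofFn, Function.comp_apply]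
    refine (Finset.abs_sum_le_sum_abs _ _).trans
      ((Finset.sum_le_sum fun i _ => hC (ω i)).trans ?_)
    simp

theorem listExp_sum_map {f : S → ℝ} (hf : Measurable f) {C : ℝ} (hC : ∀ s, |f s| ≤ C) (k : ℕ) :
    listExp μ k (fun l => (l.map f).sum) = k * ∫ s, f s ∂μ := by
  have hi : Integrable f μ := Integrable.of_bound hf.aestronglyMeasurable C
    (Filter.Eventually.of_forall hC)
  induction k with
  | zero => simp
  | succ k ih =>
    rw [listExp_succ (Tame.sum_map hf hC)]
    simp only [List.map_cons, List.sum_cons]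
    have : ∀ l : List S, ∫ s, (f s + (l.map f).sum) ∂μ = ∫ s, f s ∂μ + (l.map f).sum := by
      intro l
      rw [integral_add hi (integrable_const _)]
      simp
    simp only [this]
    rw [listExp_add (Tame.const _) (Tame.sum_map hf hC), ih, listExp_const]
    push_cast
    ring

/-- The variance of a sum of independent variables. -/
theorem listExp_sq_sum_map {f : S → ℝ} (hf : Measurable f) {C : ℝ} (hC : ∀ s, |f s| ≤ C)
    (h0 : ∫ s, f s ∂μ = 0) (k : ℕ) :
    listExp μ k (fun l => (l.map f).sum ^ 2) = k * ∫ s, f s ^ 2 ∂μ := by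
  have hi : Integrable f μ := Integrable.of_bound hf.aestronglyMeasurable C
    (Filter.Eventually.of_forall hC)
  have hi2 : Integrable (fun s => f s ^ 2) μ :=
    Integrable.of_bound (hf.pow_const 2).aestronglyMeasurable (C ^ 2)
      (Filter.Eventually.of_forall fun s => by
        rw [Real.norm_eq_abs, abs_pow]
        exact pow_le_pow_left₀ (abs_nonneg _) (hC s) 2)
  have ht : Tame fun l : List S => (l.map f).sum ^ 2 := by
    simpa [sq] using (Tame.sum_map hf hC).mul (Tame.sum_map hf hC)
  induction k with
  | zero => simp
  | succ k ih =>
    rw [listExp_succ ht]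
    simp only [List.map_cons, List.sum_cons]
    have : ∀ l : List S, ∫ s, (f s + (l.map f).sum) ^ 2 ∂μ =
        ∫ s, f s ^ 2 ∂μ + (l.map f).sum ^ 2 := by
      intro l
      have e : ∀ s, (f s + (l.map f).sum) ^ 2 =
          f s ^ 2 + (2 * (l.map f).sum * f s + (l.map f).sum ^ 2) := fun s => by ring
      have hi3 : Integrable (fun s => 2 * (l.map f).sum * f s + (l.map f).sum ^ 2) μ :=
        (hi.const_mul _).add (integrable_const _)
      simp only [e]
      rw [integral_add hi2 hi3, integral_add (hi.const_mul _) (integrable_const _),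
        integral_const_mul, h0]
      simp
    simp only [this]
    rw [listExp_add (Tame.const _) ht, ih, listExp_const]
    push_cast
    ring

end ListExp

namespace Exchange

variable {n M : ℕ} {ι : Type} (E : Exchange n M ι)

/-! ### Exploitation with capacities -/

section Exploit

variable {S : Type*} (want : S → Fin n → Bool) (bid : S → Fin n → E.bids) (K : Fin n → ℝ)

/-- The number of outcomes in which network `i` is wanted. -/
def wantCount (i : Fin n) (l : List S) : ℕ := l.countP fun s => want s i

/-- The number of outcomes in which network `i` is wanted, cut off at its capacity. -/
noncomputable def usedCount (i : Fin n) (l : List S) : ℕ := min (wantCount want i l) ⌊K i⌋₊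

/-- The total value when each wanted network is called out as long as its capacity permits. -/
noncomputable def exploitValue : List S → ℝ
  | [] => 0
  | s :: l => E.slotValue (Finset.univ.filter fun i =>
      want s i = true ∧ (wantCount want i l + 1 : ℝ) ≤ K i) (bid s) + exploitValue l

theorem exploitValue_nonneg (l : List S) : 0 ≤ E.exploitValue want bid K l := by
  induction l with
  | nil => exact le_rfl
  | cons s l ih => exact add_nonneg (E.slotValue_nonneg _ _) ih

variable {want bid K}

/-- Testing the demand so far against the capacity is equivalent to testing the calls so far: both
fail from the moment the capacity is exhausted. -/
theorem usedCount_cons (hK : ∀ i, 0 ≤ K i) (i : Fin n) (s : S) (l : List S) :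
    (usedCount want K i (s :: l) : ℝ) = usedCount want K i l +
      (if want s i then 1 else 0) * (if (wantCount want i l + 1 : ℝ) ≤ K i then 1 else 0) := by
  have h : ((wantCount want i l + 1 : ℝ) ≤ K i) ↔ wantCount want i l + 1 ≤ ⌊K i⌋₊ := by
    rw [Nat.le_floor_iff (hK i)]; push_cast; rfl
  simp only [h]
  have e : wantCount want i (s :: l) = wantCount want i l + if want s i then 1 else 0 := by
    simp [wantCount, List.countP_cons]
  unfold usedCount
  rw [e]
  by_cases hw : want s i = true
  · simp only [hw, if_true, one_mul]
    split_ifs with h2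
    · rw [min_eq_left h2, min_eq_left (by omega)]; push_cast; rfl
    · rw [min_eq_right (by omega), min_eq_right (by omega)]; simp
  · simp [hw]

theorem wantCount_eq_sum (i : Fin n) (l : List S) :
    (wantCount want i l : ℝ) = (l.map fun s => if want s i then (1 : ℝ) else 0).sum := by
  induction l with
  | nil => simp [wantCount]
  | cons s l ih =>
    rw [List.map_cons, List.sum_cons, ← ih]
    by_cases hw : want s i = true <;> simp [wantCount, hw, add_comm]

variable [MeasurableSpace S]

theorem measurable_want_apply (hw : Measurable want) (i : Fin n) :
    Measurable fun s => if want s i then (1 : ℝ) else 0 :=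
  (measurable_of_countable fun b : Bool => if b then (1 : ℝ) else 0).comp
    ((measurable_pi_apply i).comp hw)

theorem abs_ite_le_one (p : Prop) [Decidable p] : |if p then (1 : ℝ) else 0| ≤ 1 := by
  split_ifs <;> simp

theorem tame_wantCount (hw : Measurable want) (i : Fin n) :
    Tame fun l : List S => (wantCount want i l : ℝ) := by
  simp only [wantCount_eq_sum]
  exact Tame.sum_map (measurable_want_apply hw i) (C := 1) fun s => abs_ite_le_one _

theorem listMeasurable_wantCount (hw : Measurable want) (i : Fin n) :
    ListMeasurable fun l : List S => wantCount want i l := by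
  have := (tame_wantCount hw i).measurable.comp Nat.measurable_floor
  simpa using this

theorem tame_usedCount (hw : Measurable want) (i : Fin n) :
    Tame fun l : List S => (usedCount want K i l : ℝ) where
  measurable := (listMeasurable_wantCount hw i).comp
    (measurable_from_nat (f := fun w => ((min w ⌊K i⌋₊ : ℕ) : ℝ)))
  bounded k := ⟨⌊K i⌋₊, fun ω => by
    rw [abs_of_nonneg (Nat.cast_nonneg _), Nat.cast_le]; exact min_le_right _ _⟩

theorem tame_exploitValue (hw : Measurable want) (hb : Measurable bid) :
    Tame (E.exploitValue want bid K) := by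
  have hstep : ∀ k, Measurable fun p : S × (Fin k → S) =>
      E.slotValue (Finset.univ.filter fun i => want p.1 i = true ∧
        (wantCount want i (List.ofFn p.2) + 1 : ℝ) ≤ K i) (bid p.1) := by
    intro k
    have h1 : Measurable fun p : S × (Fin k → S) =>
        ((want p.1, bid p.1), fun i => wantCount want i (List.ofFn p.2)) :=
      ((hw.comp measurable_fst).prodMk (hb.comp measurable_fst)).prodMk
        (measurable_pi_iff.2 fun i => (listMeasurable_wantCount hw i k).comp measurable_snd)
    exact (measurable_of_countable fun q : ((Fin n → Bool) × (Fin n → E.bids)) × (Fin n → ℕ) =>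
      E.slotValue (Finset.univ.filter fun i => q.1.1 i = true ∧ (q.2 i + 1 : ℝ) ≤ K i) q.1.2).comp h1
  refine ⟨fun k => ?_, fun k => ?_⟩
  · induction k with
    | zero => simpa only [List.ofFn_zero] using measurable_const
    | succ k ih =>
      have hm : Measurable fun ω : Fin (k + 1) → S => (ω 0, fun i : Fin k => ω i.succ) :=
        (measurable_pi_apply 0).prodMk (measurable_pi_iff.2 fun i => measurable_pi_apply i.succ)
      simp only [List.ofFn_succ, exploitValue]
      exact ((hstep k).comp hm).add (ih.comp (measurable_snd.comp hm))
  · refine ⟨k * (n * E.maxBid), fun ω => ?_⟩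
    rw [abs_of_nonneg (E.exploitValue_nonneg want bid K _)]
    have : ∀ l : List S, E.exploitValue want bid K l ≤ l.length * (n * E.maxBid) := by
      intro l
      induction l with
      | nil => simp [exploitValue]
      | cons s l ih =>
        rw [exploitValue, List.length_cons]
        have := E.slotValue_le (Finset.univ.filter fun i => want s i = true ∧
          (wantCount want i l + 1 : ℝ) ≤ K i) (bid s)
        push_cast
        linarith
    simpa using this (List.ofFn ω)

variable (want bid) (μ : Measure S)

/-- The probability that network `i` is wanted. -/
noncomputable def wantProb (i : Fin n) : ℝ := ∫ s, (if want s i then 1 else 0) ∂μ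

/-- The expected contribution of network `i` if all wanted networks are called out. -/
noncomputable def expContribution (i : Fin n) : ℝ :=
  ∫ s, E.contribution (Finset.univ.filter fun i => want s i = true) (bid s) i ∂μ

variable {want bid μ}

theorem expContribution_nonneg (i : Fin n) : 0 ≤ E.expContribution want bid μ i :=
  integral_nonneg fun _ => E.contribution_nonneg _ _ _

theorem wantProb_nonneg (i : Fin n) : 0 ≤ wantProb want μ i :=
  integral_nonneg fun _ => by dsimp only; split_ifs <;> simp

variable [IsProbabilityMeasure μ]

theorem integrable_of_want_bid (hw : Measurable want) (hb : Measurable bid)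
    (g : (Fin n → Bool) → (Fin n → E.bids) → ℝ) : Integrable (fun s => g (want s) (bid s)) μ := by
  have hm : Measurable fun s => g (want s) (bid s) :=
    (measurable_of_countable fun q : (Fin n → Bool) × (Fin n → E.bids) => g q.1 q.2).comp
      (hw.prodMk hb)
  refine Integrable.of_bound hm.aestronglyMeasurable (∑ q : (Fin n → Bool) × (Fin n → E.bids),
    |g q.1 q.2|) (Filter.Eventually.of_forall fun s => ?_)
  exact Finset.single_le_sum (f := fun q : (Fin n → Bool) × (Fin n → E.bids) => |g q.1 q.2|)
    (fun q _ => abs_nonneg _) (Finset.mem_univ (want s, bid s))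

theorem integrable_want (hw : Measurable want) (i : Fin n) :
    Integrable (fun s => if want s i then (1 : ℝ) else 0) μ :=
  Integrable.of_bound (measurable_want_apply hw i).aestronglyMeasurable 1
    (Filter.Eventually.of_forall fun _ => abs_ite_le_one _)

theorem expContribution_le (hw : Measurable want) (hb : Measurable bid) (i : Fin n) :
    E.expContribution want bid μ i ≤ E.maxBid * wantProb want μ i := by
  unfold expContribution wantProb
  rw [← integral_const_mul]
  refine integral_mono (E.integrable_of_want_bid hw hb fun w b => E.contribution
    (Finset.univ.filter fun i => w i = true) b i) ((integrable_want hw i).const_mul _) fun s => ?_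
  have := E.contribution_le (Finset.univ.filter fun i => want s i = true) (bid s) i
  simpa using this

/-- Each call of network i is worth r i on average, even though capacities interact: whether i still
has capacity depends on the past only, hence is independent of the current step, and exhausted
networks only raise the contributions of the others. -/
theorem sum_mul_le_listExp_exploitValue (hw : Measurable want) (hb : Measurable bid)
    (hK : ∀ i, 0 ≤ K i) {r : Fin n → ℝ}
    (hr : ∀ i, r i * wantProb want μ i = E.expContribution want bid μ i) (k : ℕ) :
    ∑ i, r i * listExp μ k (fun l => (usedCount want K i l : ℝ)) ≤
      listExp μ k (E.exploitValue want bid K) := by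
  have hV := E.tame_exploitValue (K := K) hw hb
  have hU : Tame fun l : List S => ∑ i, r i * (usedCount want K i l : ℝ) :=
    Tame.sum _ fun i _ => (tame_usedCount hw i).const_mul (r i)
  have hD := hV.sub hU
  have key : ∀ k, 0 ≤ listExp μ k fun l => E.exploitValue want bid K l -
      ∑ i, r i * (usedCount want K i l : ℝ) := by
    intro k
    induction k with
    | zero => simp [exploitValue, usedCount, wantCount]
    | succ k ih =>
      rw [listExp_succ hD]
      refine ih.trans (listExp_mono hD hD.integral_cons fun l _ => ?_)
      -- Availability before the current step; the head of the list is the latest outcome, and `l`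
      -- is the past.
      set A : Fin n → ℝ := fun i => if (wantCount want i l + 1 : ℝ) ≤ K i then 1 else 0 with hA
      have e : ∀ s, E.exploitValue want bid K (s :: l) -
          ∑ i, r i * (usedCount want K i (s :: l) : ℝ) =
          (E.exploitValue want bid K l - ∑ i, r i * (usedCount want K i l : ℝ)) +
          (E.slotValue (Finset.univ.filter fun i => want s i = true ∧
            (wantCount want i l + 1 : ℝ) ≤ K i) (bid s) -
          ∑ i, r i * A i * if want s i then 1 else 0) := by
        intro s
        rw [exploitValue]
        simp only [usedCount_cons hK, mul_add, Finset.sum_add_distrib]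
        have : ∀ i, r i * ((if want s i then 1 else 0) *
            if (wantCount want i l + 1 : ℝ) ≤ K i then 1 else 0) =
            r i * A i * if want s i then 1 else 0 := fun i => by simp only [hA]; ring
        simp only [this]
        ring
      have hi1 : Integrable (fun s => E.slotValue (Finset.univ.filter fun i => want s i = true ∧
            (wantCount want i l + 1 : ℝ) ≤ K i) (bid s)) μ :=
        E.integrable_of_want_bid hw hb fun w b => E.slotValue (Finset.univ.filter fun i =>
          w i = true ∧ (wantCount want i l + 1 : ℝ) ≤ K i) b
      have hi2 : ∀ i ∈ Finset.univ, Integrable (fun s => r i * A i * if want s i then 1 else 0) μ :=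
        fun i _ => (integrable_want hw i).const_mul _
      simp only [e]
      have hi3 : Integrable (fun s => E.slotValue (Finset.univ.filter fun i => want s i = true ∧
          (wantCount want i l + 1 : ℝ) ≤ K i) (bid s) -
          ∑ i, r i * A i * if want s i then 1 else 0) μ := hi1.sub (integrable_finsetSum _ hi2)
      rw [integral_add (integrable_const _) hi3,
        integral_sub hi1 (integrable_finsetSum _ hi2), integral_finsetSum _ hi2]
      simp only [integral_const_mul, integral_const, probReal_univ, one_smul]
      have h3 : ∀ i, r i * A i * ∫ s, (if want s i then (1 : ℝ) else 0) ∂μ =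
          ∫ s, A i * E.contribution (Finset.univ.filter fun i => want s i = true) (bid s) i ∂μ := by
        intro i
        rw [integral_const_mul]
        have := hr i
        unfold wantProb expContribution at this
        rw [← this]; ring
      simp only [h3]
      rw [← integral_finsetSum _ fun i _ => (E.integrable_of_want_bid hw hb fun w b =>
        E.contribution (Finset.univ.filter fun i => w i = true) b i).const_mul _]
      refine le_add_of_nonneg_right (sub_nonneg.2 (integral_mono (integrable_finsetSum _
        fun i _ => (E.integrable_of_want_bid hw hb fun w b => E.contribution
        (Finset.univ.filter fun i => w i = true) b i).const_mul _) hi1 fun s => ?_))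
      -- Submodularity, with the available networks as the subset that is kept.
      have h4 := E.sum_contribution_le (Finset.univ.filter fun i => want s i = true)
        (Finset.univ.filter fun i => (wantCount want i l + 1 : ℝ) ≤ K i) (bid s)
      rw [← Finset.filter_and, Finset.sum_filter] at h4
      refine le_trans (le_of_eq ?_) h4
      refine Finset.sum_congr rfl fun i _ => ?_
      simp only [hA]
      split_ifs <;> simp
  have := key k
  rw [listExp_sub hV hU, listExp_sum _ fun i _ => (tame_usedCount hw i).const_mul (r i)] at this
  simp only [listExp_const_mul] at this
  linarith

/-- The demand cut off by the capacity is at most a positive deviation from the mean, plus 1 for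
rounding the capacity down. The variance of the demand is at most its mean kU. -/
theorem le_listExp_usedCount (hw : Measurable want) (i : Fin n) {k : ℕ}
    (hK : k * wantProb want μ i ≤ K i) {a : ℝ} (ha : 0 < a) :
    k * wantProb want μ i - 1 - a / 2 - k * wantProb want μ i / (2 * a) ≤
      listExp μ k fun l => (usedCount want K i l : ℝ) := by
  set U := wantProb want μ i with hU
  have hm := measurable_want_apply hw i
  have hint := integrable_want (μ := μ) hw i
  have hm' : Measurable fun s => (if want s i then (1 : ℝ) else 0) - U := hm.sub_const U
  have hbd : ∀ s, |(if want s i then (1 : ℝ) else 0) - U| ≤ 1 + |U| := fun s =>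
    (abs_sub _ _).trans (add_le_add_left (abs_ite_le_one _) _)
  have h0 : ∫ s, ((if want s i then (1 : ℝ) else 0) - U) ∂μ = 0 := by
    rw [integral_sub hint (integrable_const _)]
    simp only [integral_const, probReal_univ, one_smul]
    exact sub_self _
  have hsq : ∫ s, ((if want s i then (1 : ℝ) else 0) - U) ^ 2 ∂μ = U - U ^ 2 := by
    have e : ∀ s, ((if want s i then (1 : ℝ) else 0) - U) ^ 2 =
        (1 - 2 * U) * (if want s i then (1 : ℝ) else 0) + U ^ 2 := by
      intro s; split_ifs <;> ring
    simp only [e]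
    rw [integral_add (hint.const_mul _) (integrable_const _), integral_const_mul]
    simp only [integral_const, probReal_univ, one_smul]
    change (1 - 2 * U) * U + U ^ 2 = _
    ring
  have hvar := listExp_sq_sum_map (μ := μ) hm' hbd h0 k
  have htsq : Tame fun l : List S =>
      (l.map fun s => (if want s i then (1 : ℝ) else 0) - U).sum ^ 2 := by
    simpa [sq] using (Tame.sum_map hm' hbd).mul (Tame.sum_map hm' hbd)
  have hmean : listExp μ k (fun l => (wantCount want i l : ℝ)) = k * U := by
    simp only [wantCount_eq_sum]
    exact listExp_sum_map hm (fun s => abs_ite_le_one _) k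
  have htL : Tame fun l : List S => (wantCount want i l : ℝ) - ((1 + a / 2) + 1 / (2 * a) *
      (l.map fun s => (if want s i then (1 : ℝ) else 0) - U).sum ^ 2) :=
    (tame_wantCount hw i).sub ((Tame.const _).add (htsq.const_mul _))
  have hle := listExp_mono (μ := μ) htL (tame_usedCount (K := K) hw i) (k := k) fun l hl => by
    have e1 : (l.map fun s => (if want s i then (1 : ℝ) else 0) - U).sum =
        wantCount want i l - k * U := by
      rw [wantCount_eq_sum, ← hl]
      clear hl
      induction l with
      | nil => simp
      | cons s l ih => simp only [List.map_cons, List.sum_cons, ih, List.length_cons]; push_cast; ring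
    rw [e1]
    set W : ℝ := ((wantCount want i l : ℕ) : ℝ) with hW
    -- The inequality x ≤ a/2 + x²/(2a) replaces the positive part by a multiple of the variance.
    have h1 : W - k * U ≤ a / 2 + 1 / (2 * a) * (W - k * U) ^ 2 := by
      rw [one_div_mul_eq_div, ← sub_le_iff_le_add', le_div_iff₀ (by positivity)]
      nlinarith [sq_nonneg (W - k * U - a)]
    have h2 : 0 ≤ a / 2 + 1 / (2 * a) * (W - k * U) ^ 2 := by positivity
    unfold usedCount
    rw [Nat.cast_min, le_min_iff]
    refine ⟨by linarith, ?_⟩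
    have := Nat.lt_floor_add_one (K i)
    linarith
  rw [listExp_sub (tame_wantCount hw i) ((Tame.const _).add (htsq.const_mul _)),
    listExp_add (Tame.const _) (htsq.const_mul _), listExp_const, listExp_const_mul, hvar, hsq,
    hmean] at hle
  refine le_trans ?_ hle
  have h5 : 1 / (2 * a) * (k * (U - U ^ 2)) ≤ k * U / (2 * a) := by
    rw [one_div_mul_eq_div]
    refine div_le_div_of_nonneg_right ?_ (by positivity)
    exact mul_le_mul_of_nonneg_left (by nlinarith [sq_nonneg U]) (Nat.cast_nonneg k)
  linarith

/-- The expected value of exploitation when the capacities exceed the expected demands. -/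
theorem le_listExp_exploitValue (hw : Measurable want) (hb : Measurable bid) {k m : ℕ}
    (hkm : k ≤ m) (hm : 0 < m) (hK : ∀ i, m * wantProb want μ i ≤ K i) {a : ℝ} (ha : 0 < a) :
    (k - a * m / 2) * ∑ i, E.expContribution want bid μ i - n * E.maxBid * (1 + 1 / (2 * a)) ≤
      listExp μ k (E.exploitValue want bid K) := by
  have hm' : (0 : ℝ) < m := Nat.cast_pos.2 hm
  have hkm' : (k : ℝ) ≤ m := Nat.cast_le.2 hkm
  have hK0 : ∀ i, 0 ≤ K i := fun i =>
    (mul_nonneg hm'.le (wantProb_nonneg (μ := μ) (want := want) i)).trans (hK i)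
  -- Mean contribution per call. If network i is never wanted then its contribution is zero as well,
  -- and the quotient may take any value.
  let r : Fin n → ℝ := fun i => E.expContribution want bid μ i / wantProb want μ i
  have hr : ∀ i, r i * wantProb want μ i = E.expContribution want bid μ i := by
    intro i
    by_cases h0 : wantProb want μ i = 0
    · have h1 := E.expContribution_le (μ := μ) hw hb i
      have h2 := E.expContribution_nonneg (μ := μ) (want := want) (bid := bid) i
      rw [h0, mul_zero] at h1
      rw [h0, mul_zero]
      exact le_antisymm h2 h1
    · exact div_mul_cancel₀ _ h0
  refine le_trans ?_ (E.sum_mul_le_listExp_exploitValue (μ := μ) hw hb hK0 hr k)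
  have key : ∀ i, (k - a * m / 2) * E.expContribution want bid μ i -
      E.maxBid * (1 + 1 / (2 * a)) ≤ r i * listExp μ k fun l => (usedCount want K i l : ℝ) := by
    intro i
    set U := wantProb want μ i with hU
    set G := E.expContribution want bid μ i with hG
    have hL := E.maxBid_nonneg
    rcases (wantProb_nonneg (μ := μ) (want := want) i).eq_or_lt with h0 | h0
    · have h1 := hr i
      rw [← h0, mul_zero] at h1
      have h2 : r i = 0 := by simp [r, ← h0]
      rw [h2, zero_mul, ← hG] at *
      rw [← h1]
      have : 0 ≤ E.maxBid * (1 + 1 / (2 * a)) := by positivity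
      linarith
    · have hrL : r i ≤ E.maxBid := by
        rw [div_le_iff₀ h0]; exact E.expContribution_le hw hb i
      have hr0 : 0 ≤ r i := div_nonneg (E.expContribution_nonneg i) h0.le
      have h1 := le_listExp_usedCount (μ := μ) (K := K) hw i (k := k)
        ((mul_le_mul_of_nonneg_right hkm' h0.le).trans (hK i))
        -- Scaling the parameter with the expected demand makes the first loss a fixed fraction of
        -- the demand, and the second one bounded by 1/(2a).
        (a := a * m * U) (mul_pos (mul_pos ha hm') h0)
      rw [← hU] at h1
      have h2 := mul_le_mul_of_nonneg_left h1 hr0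
      refine le_trans ?_ h2
      have h3 : k * U / (2 * (a * m * U)) ≤ 1 / (2 * a) := by
        rw [div_le_div_iff₀ (mul_pos two_pos (mul_pos (mul_pos ha hm') h0)) (mul_pos two_pos ha)]
        have := mul_le_mul_of_nonneg_right hkm' (mul_pos ha h0).le
        nlinarith
      have h4 : r i * (1 + k * U / (2 * (a * m * U))) ≤ E.maxBid * (1 + 1 / (2 * a)) :=
        mul_le_mul hrL (by linarith) (by positivity) hL
      have h5 := hr i
      rw [← hU, ← hG] at h5
      have h6 : r i * (k * U - 1 - a * m * U / 2 - k * U / (2 * (a * m * U))) =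
          (k - a * m / 2) * (r i * U) - r i * (1 + k * U / (2 * (a * m * U))) := by ring
      rw [h6, h5]
      linarith
  have := Finset.sum_le_sum fun i (_ : i ∈ Finset.univ) => key i
  rw [Finset.sum_sub_distrib, ← Finset.mul_sum, Finset.sum_const, Finset.card_univ,
    Fintype.card_fin, nsmul_eq_mul] at this
  linarith

end Exploit

end Exchange

namespace Exchange

variable {n M : ℕ} {ι : Type} (E : Exchange n M ι)

/-! ### The law of one arrival together with the randomness of LP-Val -/

theorem measurable_bool_of_lt {X : Type*} [MeasurableSpace X] {f g : X → ℝ} (hf : Measurable f)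
    (hg : Measurable g) : Measurable fun x => decide (f x < g x) := by
  refine measurable_to_bool ?_
  have : (fun x => decide (f x < g x)) ⁻¹' {true} = {x | f x < g x} := by ext x; simp
  rw [this]
  exact measurableSet_lt hf hg

theorem integral_coin {y : ℝ} (h0 : 0 ≤ y) (h1 : y ≤ 1) (β : Bool) :
    ∫ c : unitInterval, (if decide ((c : ℝ) < y) = β then (1 : ℝ) else 0) =
      if β then y else 1 - y := by
  have hI : ∫ c : unitInterval, (if (c : ℝ) < y then (1 : ℝ) else 0) = y := by
    have hs : {c : unitInterval | (c : ℝ) < y} = Set.Iio ⟨y, h0, h1⟩ := by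
      ext c; exact Iff.rfl
    have : ∀ c : unitInterval, (if (c : ℝ) < y then (1 : ℝ) else 0) =
        (Set.Iio (⟨y, h0, h1⟩ : unitInterval)).indicator (fun _ => (1 : ℝ)) c := by
      intro c
      by_cases hc : (c : ℝ) < y
      · rw [if_pos hc, Set.indicator_of_mem]; exact hc
      · rw [if_neg hc, Set.indicator_of_notMem]; exact hc
    simp only [this]
    rw [integral_indicator_const _ measurableSet_Iio, Measure.real, unitInterval.volume_Iio]
    simp [h0]
  have hint : Integrable fun c : unitInterval => (if (c : ℝ) < y then (1 : ℝ) else 0) := by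
    refine integrable_of_mem_unit ?_ (fun c => by split_ifs <;> simp)
      fun c => by split_ifs <;> simp
    exact Measurable.ite (measurableSet_lt measurable_subtype_coe measurable_const)
      measurable_const measurable_const
  cases β
  · have : ∀ c : unitInterval, (if decide ((c : ℝ) < y) = false then (1 : ℝ) else 0) =
        1 - if (c : ℝ) < y then (1 : ℝ) else 0 := by
      intro c; by_cases hc : (c : ℝ) < y <;> simp [hc]
    simp only [this]
    rw [integral_sub (integrable_const _) hint, hI]
    simp
  · simpa using hI

theorem integral_coins {y : Fin n → ℝ} (h0 : ∀ i, 0 ≤ y i) (h1 : ∀ i, y i ≤ 1)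
    (h : (Fin n → Bool) → ℝ) :
    ∫ c : Fin n → unitInterval, h (fun i => decide ((c i : ℝ) < y i)) =
      ∑ β : Fin n → Bool, (∏ i, if β i then y i else 1 - y i) * h β := by
  have e : ∀ c : Fin n → unitInterval, h (fun i => decide ((c i : ℝ) < y i)) =
      ∑ β : Fin n → Bool, (∏ i, if decide ((c i : ℝ) < y i) = β i then (1 : ℝ) else 0) * h β := by
    intro c
    rw [Finset.sum_eq_single fun i => decide ((c i : ℝ) < y i)]
    · simp
    · intro β _ hβ
      rw [Finset.prod_boole, if_neg, zero_mul]
      intro hall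
      exact hβ (funext fun i => (hall i (Finset.mem_univ i)).symm)
    · simp
  have hm : ∀ i (β : Bool), Measurable fun c : unitInterval =>
      if decide ((c : ℝ) < y i) = β then (1 : ℝ) else 0 := fun i β =>
    (measurable_of_countable fun b : Bool => if b = β then (1 : ℝ) else 0).comp
      (measurable_bool_of_lt measurable_subtype_coe measurable_const)
  simp only [e]
  rw [integral_finsetSum]
  · refine Finset.sum_congr rfl fun β _ => ?_
    rw [integral_mul_const, integral_fintype_prod_volume_eq_prod (fun i (c : unitInterval) =>
      if decide ((c : ℝ) < y i) = β i then (1 : ℝ) else 0)]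
    simp only [integral_coin (h0 _) (h1 _)]
  · intro β _
    refine Integrable.mul_const (integrable_of_mem_unit ?_ (fun c => ?_) fun c => ?_) _
    · exact Finset.measurable_prod _ fun i _ => (hm i (β i)).comp (measurable_pi_apply i)
    · exact Finset.prod_nonneg fun i _ => by split_ifs <;> simp
    · exact Finset.prod_le_one (fun i _ => by split_ifs <;> simp) fun i _ => by split_ifs <;> simp

/-- Integration over the randomness of one arrival: the perturbation remains, and each coin is
replaced by its probability. -/
theorem integral_perturb_coin {x : (Fin n → unitInterval) → Fin n → ℝ} (hx : Measurable x)
    (h0 : ∀ u i, 0 ≤ x u i) (h1 : ∀ u i, x u i ≤ 1) (h : (Fin n → Bool) → ℝ) :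
    ∫ z : Fin n → unitInterval × unitInterval,
      h (fun i => decide (((z i).2 : ℝ) < x (fun k => (z k).1) i)) =
      ∫ u, ∑ β : Fin n → Bool, (∏ i, if β i then x u i else 1 - x u i) * h β := by
  have hp := (volume_measurePreserving_arrowProdEquivProdArrow unitInterval unitInterval
    (Fin n)).integral_comp' fun p : (Fin n → unitInterval) × (Fin n → unitInterval) =>
      h (fun i => decide ((p.2 i : ℝ) < x p.1 i))
  have hm : Measurable fun p : (Fin n → unitInterval) × (Fin n → unitInterval) =>
      h (fun i => decide ((p.2 i : ℝ) < x p.1 i)) :=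
    (measurable_of_countable h).comp (measurable_pi_iff.2 fun i => measurable_bool_of_lt
      (measurable_subtype_coe.comp ((measurable_pi_apply i).comp measurable_snd))
      ((measurable_pi_apply i).comp (hx.comp measurable_fst)))
  refine hp.trans ?_
  rw [Measure.volume_eq_prod, integral_prod]
  · exact integral_congr_ae (Filter.Eventually.of_forall fun u => integral_coins (h0 u) (h1 u) h)
  · refine Integrable.of_bound hm.aestronglyMeasurable (∑ β, |h β|)
      (Filter.Eventually.of_forall fun p => ?_)
    exact Finset.single_le_sum (f := fun β => |h β|) (fun _ _ => abs_nonneg _)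
      (Finset.mem_univ _)

variable [Fintype ι]

theorem arrivalProb_nonneg {q : ι → ℝ} (hq : q ∈ stdSimplex ℝ ι) (a : E.Arrival) :
    0 ≤ E.arrivalProb q a := mul_nonneg (hq.1 _) (E.bidProb_nonneg _ _)

theorem arrivalProb_eq (q : ι → ℝ) (a : E.Arrival) :
    E.arrivalProb q a = q a.1 * E.bidProb a.1 a.2 := rfl

theorem sum_arrivalProb_mul (q : ι → ℝ) (g : ι → ℝ) :
    ∑ a : E.Arrival, E.arrivalProb q a * g a.1 = ∑ j, q j * g j := by
  rw [Fintype.sum_prod_type]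
  refine Finset.sum_congr rfl fun j _ => ?_
  simp only [arrivalProb_eq]
  rw [← Finset.sum_mul, ← Finset.mul_sum, E.sum_bidProb, mul_one]

theorem sum_arrivalProb {q : ι → ℝ} (hq : q ∈ stdSimplex ℝ ι) : ∑ a, E.arrivalProb q a = 1 := by
  have := E.sum_arrivalProb_mul q fun _ => 1
  simpa [hq.2] using this

/-- The randomness of one arrival: the random numbers of LP-Val and the arrival itself. -/
abbrev Step (E : Exchange n M ι) : Type := (Fin n → unitInterval × unitInterval) × E.Arrival

variable [MeasurableSpace ι] [MeasurableSingletonClass ι]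

/-- The law of one arrival. -/
noncomputable def arrivalLaw (q : ι → ℝ) : Measure E.Arrival :=
  ∑ a, ENNReal.ofReal (E.arrivalProb q a) • Measure.dirac a

theorem arrivalLaw_singleton (q : ι → ℝ) (a : E.Arrival) :
    E.arrivalLaw q {a} = ENNReal.ofReal (E.arrivalProb q a) := by
  classical
  unfold arrivalLaw
  rw [Measure.finsetSum_apply, Finset.sum_eq_single a]
  · simp
  · intro b _ hb
    simp [hb]
  · simp

theorem isProbabilityMeasure_arrivalLaw {q : ι → ℝ} (hq : q ∈ stdSimplex ℝ ι) :
    IsProbabilityMeasure (E.arrivalLaw q) where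
  measure_univ := by
    unfold arrivalLaw
    rw [Measure.finsetSum_apply]
    simp only [Measure.smul_apply, measure_univ, smul_eq_mul, mul_one]
    rw [← ENNReal.ofReal_sum_of_nonneg fun a _ => E.arrivalProb_nonneg hq a,
      E.sum_arrivalProb hq, ENNReal.ofReal_one]

/-- The law of the randomness of one arrival. -/
noncomputable def stepLaw (q : ι → ℝ) : Measure E.Step := volume.prod (E.arrivalLaw q)

theorem isProbabilityMeasure_stepLaw {q : ι → ℝ} (hq : q ∈ stdSimplex ℝ ι) :
    IsProbabilityMeasure (E.stepLaw q) := by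
  have := E.isProbabilityMeasure_arrivalLaw hq
  unfold stepLaw
  infer_instance

theorem integral_arrivalLaw {q : ι → ℝ} (hq : q ∈ stdSimplex ℝ ι) (f : E.Arrival → ℝ) :
    ∫ a, f a ∂(E.arrivalLaw q) = ∑ a, E.arrivalProb q a * f a := by
  have := E.isProbabilityMeasure_arrivalLaw hq
  rw [integral_fintype (Integrable.of_finite)]
  refine Finset.sum_congr rfl fun a _ => ?_
  rw [Measure.real, arrivalLaw_singleton, ENNReal.toReal_ofReal (E.arrivalProb_nonneg hq a),
    smul_eq_mul]

theorem integral_pi_arrivalLaw {q : ι → ℝ} (hq : q ∈ stdSimplex ℝ ι) {m : ℕ}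
    (f : (Fin m → E.Arrival) → ℝ) : ∫ a, f a ∂(Measure.pi fun _ => E.arrivalLaw q) =
      ∑ a : Fin m → E.Arrival, (∏ s, E.arrivalProb q (a s)) * f a := by
  have := E.isProbabilityMeasure_arrivalLaw hq
  rw [integral_fintype (Integrable.of_finite)]
  refine Finset.sum_congr rfl fun a _ => ?_
  rw [Measure.real, Measure.pi_singleton, ENNReal.toReal_prod, smul_eq_mul]
  congr 1
  refine Finset.prod_congr rfl fun s _ => ?_
  rw [arrivalLaw_singleton, ENNReal.toReal_ofReal (E.arrivalProb_nonneg hq _)]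

theorem integral_stepLaw {q : ι → ℝ} (hq : q ∈ stdSimplex ℝ ι) {f : E.Step → ℝ}
    (hf : Integrable f (E.stepLaw q)) :
    ∫ s, f s ∂(E.stepLaw q) = ∑ a, E.arrivalProb q a * ∫ z, f (z, a) := by
  have := E.isProbabilityMeasure_arrivalLaw hq
  rw [← E.integral_arrivalLaw hq fun a => ∫ z, f (z, a)]
  exact integral_prod_symm _ hf

/-- The perturbation of an arrival. -/
def Step.shift {E : Exchange n M ι} (η : ℝ) (s : E.Step) : Fin n → ℝ :=
  cubePoint η fun i => (s.1 i).1

/-- The networks that LP-Val wants to call out on an arrival, at prices `lam`. -/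
noncomputable def lpWant (solve : ι → (Fin n → ℝ) → Fin n → ℝ) (η : ℝ) (lam : Fin n → ℝ)
    (s : E.Step) (i : Fin n) : Bool :=
  decide (((s.1 i).2 : ℝ) < solve s.2.1 (lam + Step.shift η s) i)

/-- A function on a product with a finite discrete space is measurable if its sections are. -/
theorem measurable_of_forall_section {X Y Z : Type*} [MeasurableSpace X] [MeasurableSpace Y]
    [MeasurableSpace Z] [Countable Y] [MeasurableSingletonClass Y] {f : X × Y → Z}
    (h : ∀ y, Measurable fun x => f (x, y)) : Measurable f :=
  measurable_from_prod_countable_left h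

variable {E}

theorem measurable_shift (η : ℝ) : Measurable (Step.shift (E := E) η) :=
  (measurable_cubePoint η).comp (measurable_pi_iff.2 fun i =>
    measurable_fst.comp ((measurable_pi_apply i).comp measurable_fst))

theorem IsSolver.measurable_uncurry {solve : ι → (Fin n → ℝ) → Fin n → ℝ} (h : E.IsSolver solve) :
    Measurable fun p : (Fin n → ℝ) × ι => solve p.2 p.1 :=
  measurable_of_forall_section fun j => (h j).1

theorem IsSolver.measurable_price {solve : ι → (Fin n → ℝ) → Fin n → ℝ} (h : E.IsSolver solve)
    (η : ℝ) : Measurable fun p : (Fin n → ℝ) × E.Step => solve p.2.2.1 (p.1 + Step.shift η p.2) :=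
  h.measurable_uncurry.comp ((measurable_fst.add ((measurable_shift η).comp measurable_snd)).prodMk
    (measurable_fst.comp (measurable_snd.comp measurable_snd)))

theorem IsSolver.measurable_lpWant {solve : ι → (Fin n → ℝ) → Fin n → ℝ} (h : E.IsSolver solve)
    (η : ℝ) : Measurable fun p : (Fin n → ℝ) × E.Step => E.lpWant solve η p.1 p.2 :=
  measurable_pi_iff.2 fun i => measurable_bool_of_lt
    (measurable_subtype_coe.comp (measurable_snd.comp ((measurable_pi_apply i).comp
      (measurable_fst.comp measurable_snd))))
    ((measurable_pi_apply i).comp (h.measurable_price η))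

theorem measurable_bid : Measurable fun s : E.Step => s.2.2 := measurable_snd.comp measurable_snd

/-- Expectation of a function of the wanted networks and the bids. -/
theorem IsSolver.integral_lpWant {solve : ι → (Fin n → ℝ) → Fin n → ℝ} (h : E.IsSolver solve)
    (η : ℝ) (lam : Fin n → ℝ) {q : ι → ℝ} (hq : q ∈ stdSimplex ℝ ι)
    (g : (Fin n → Bool) → (Fin n → E.bids) → ℝ) :
    ∫ s, g (E.lpWant solve η lam s) s.2.2 ∂(E.stepLaw q) = ∑ a : E.Arrival, E.arrivalProb q a *
      ∫ u, ∑ β : Fin n → Bool, (∏ i, if β i then solve a.1 (lam + cubePoint η u) i else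
        1 - solve a.1 (lam + cubePoint η u) i) * g β a.2 := by
  have := E.isProbabilityMeasure_stepLaw hq
  have hw : Measurable (E.lpWant solve η lam) :=
    (h.measurable_lpWant η).comp (measurable_const.prodMk measurable_id)
  rw [E.integral_stepLaw hq (E.integrable_of_want_bid hw measurable_bid g)]
  refine Finset.sum_congr rfl fun a _ => ?_
  congr 1
  exact integral_perturb_coin (x := fun u => solve a.1 (lam + cubePoint η u))
    ((h a.1).1.comp ((measurable_cubePoint η).const_add lam)) (fun u => h.nonneg _ _)
    (fun u => h.le_one _ _) fun w => g w a.2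

/-- The average over impressions and perturbations of the `p`-th powers of call-out
probabilities. -/
noncomputable def meanUse (solve : ι → (Fin n → ℝ) → Fin n → ℝ) (η : ℝ) (q : ι → ℝ) (p : ℕ)
    (i : Fin n) (lam : Fin n → ℝ) : ℝ := ∑ j, q j * avgUse solve η p i lam j

theorem IsSolver.wantProb_lpWant {solve : ι → (Fin n → ℝ) → Fin n → ℝ} (h : E.IsSolver solve)
    (η : ℝ) (lam : Fin n → ℝ) {q : ι → ℝ} (hq : q ∈ stdSimplex ℝ ι) (i : Fin n) :
    wantProb (E.lpWant solve η lam) (E.stepLaw q) i = meanUse solve η q 1 i lam := by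
  unfold wantProb
  rw [h.integral_lpWant η lam hq fun β _ => if β i then (1 : ℝ) else 0, meanUse,
    ← E.sum_arrivalProb_mul]
  refine Finset.sum_congr rfl fun a _ => ?_
  congr 1
  unfold avgUse
  refine integral_congr_ae (Filter.Eventually.of_forall fun u => ?_)
  have := sum_prod_mul_apply (w := fun i (b : Bool) => if b then solve a.1 (lam + cubePoint η u) i
    else 1 - solve a.1 (lam + cubePoint η u) i) (fun i => by simp) i
    fun b => if b then (1 : ℝ) else 0
  simp only [pow_one]
  rw [this]
  simp

theorem sum_expContribution {S : Type*} [MeasurableSpace S] {μ : Measure S}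
    [IsProbabilityMeasure μ] {want : S → Fin n → Bool} {bid : S → Fin n → E.bids}
    (hw : Measurable want) (hb : Measurable bid) : ∑ i, E.expContribution want bid μ i =
      ∫ s, E.slotValue (Finset.univ.filter fun i => want s i = true) (bid s) ∂μ := by
  unfold expContribution
  rw [← integral_finsetSum _ fun i _ => E.integrable_of_want_bid hw hb fun w b =>
    E.contribution (Finset.univ.filter fun i => w i = true) b i]
  simp only [slotValue_eq_sum_contribution]

theorem measurable_roundValue (j : ι) : Measurable (E.roundValue j) := by
  unfold roundValue
  refine Finset.measurable_sum _ fun β _ => Finset.measurable_sum _ fun b _ => ?_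
  refine ((Finset.measurable_prod _ fun i _ => ?_).mul_const _).mul_const _
  by_cases hβ : β i = true
  · simpa [hβ] using measurable_pi_apply i
  · simpa [hβ] using (measurable_pi_apply i).const_sub 1

theorem IsSolver.sum_expContribution_lpWant {solve : ι → (Fin n → ℝ) → Fin n → ℝ}
    (h : E.IsSolver solve) (η : ℝ) (lam : Fin n → ℝ) {q : ι → ℝ} (hq : q ∈ stdSimplex ℝ ι) :
    ∑ i, E.expContribution (E.lpWant solve η lam) (fun s => s.2.2) (E.stepLaw q) i =
      ∑ j, q j * ∫ u, E.roundValue j (solve j (lam + cubePoint η u)) := by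
  have := E.isProbabilityMeasure_stepLaw hq
  have hw : Measurable (E.lpWant solve η lam) :=
    (h.measurable_lpWant η).comp (measurable_const.prodMk measurable_id)
  rw [sum_expContribution hw measurable_bid, h.integral_lpWant η lam hq fun w b =>
    E.slotValue (Finset.univ.filter fun i => w i = true) b, Fintype.sum_prod_type]
  refine Finset.sum_congr rfl fun j _ => ?_
  simp only [arrivalProb_eq, mul_assoc, ← Finset.mul_sum]
  congr 1
  simp only [← integral_const_mul]
  have hprod : ∀ β : Fin n → Bool, Integrable fun u => ∏ i, if β i then
      solve j (lam + cubePoint η u) i else 1 - solve j (lam + cubePoint η u) i := by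
    intro β
    have hs : ∀ i, Measurable fun u => solve j (lam + cubePoint η u) i := fun i =>
      (h.measurable_apply j i).comp ((measurable_cubePoint η).const_add lam)
    refine integrable_of_mem_unit (Finset.measurable_prod _ fun i _ => ?_)
      (fun u => Finset.prod_nonneg fun i _ => ?_) fun u => Finset.prod_le_one (fun i _ => ?_)
        fun i _ => ?_
    · by_cases hβ : β i = true
      · simpa [hβ] using hs i
      · simpa [hβ] using (hs i).const_sub 1
    · split_ifs
      · exact h.nonneg _ _ _
      · exact sub_nonneg.2 (h.le_one _ _ _)
    · split_ifs
      · exact h.nonneg _ _ _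
      · exact sub_nonneg.2 (h.le_one _ _ _)
    · split_ifs
      · exact h.le_one _ _ _
      · exact sub_le_self _ (h.nonneg _ _ _)
  rw [← integral_finsetSum]
  · refine integral_congr_ae (Filter.Eventually.of_forall fun u => ?_)
    simp only [roundValue, Finset.mul_sum]
    rw [Finset.sum_comm]
    refine Finset.sum_congr rfl fun β _ => Finset.sum_congr rfl fun b _ => ?_
    ring
  · intro b _
    exact (integrable_finsetSum _ fun β _ => (hprod β).mul_const _).const_mul _

end Exchange

theorem Tame.of_finite {S : Type*} [MeasurableSpace S] [Finite S] [MeasurableSingletonClass S]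
    (F : List S → ℝ) : Tame F where
  measurable _ := measurable_of_countable _
  bounded k := by
    have := Fintype.ofFinite S
    exact ⟨∑ ω : Fin k → S, |F (List.ofFn ω)|, fun ω =>
      Finset.single_le_sum (f := fun ω : Fin k → S => |F (List.ofFn ω)|)
        (fun _ _ => abs_nonneg _) (Finset.mem_univ ω)⟩

namespace Exchange

variable {n M : ℕ} {ι : Type} (E : Exchange n M ι)

/-! ### The Lagrangian upper bound -/

theorem callCount_observe_cons (i : Fin n) (T : Finset (Fin n)) (a : E.Arrival)
    (h : List E.Round) : E.callCount i (E.observe T a :: h) =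
      E.callCount i h + if i ∈ T then 1 else 0 := by
  unfold callCount observe
  rw [List.countP_cons]
  by_cases hi : i ∈ T <;> simp [hi]

section UpperBound

variable [Fintype ι]

/-- The Lagrangian dual of the expected LP at prices `lam`. -/
noncomputable def dualValue (q : ι → ℝ) (lam : Fin n → ℝ) : ℝ :=
  ∑ j, q j * E.lpValue j lam + ∑ i, lam i * E.rate i

variable {E}

theorem dualValue_nonneg {q : ι → ℝ} (hq : q ∈ stdSimplex ℝ ι) {lam : Fin n → ℝ} (hl : 0 ≤ lam) :
    0 ≤ E.dualValue q lam :=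
  add_nonneg (Finset.sum_nonneg fun j _ => mul_nonneg (hq.1 j) (lpValue_nonneg j lam))
    (Finset.sum_nonneg fun i _ => mul_nonneg (hl i) (E.rate_nonneg i))

variable [MeasurableSpace ι] [MeasurableSingletonClass ι]

theorem ruleValue_eq_listExp {q : ι → ℝ} (hq : q ∈ stdSimplex ℝ ι) (m : ℕ) (R : E.Rule) :
    E.ruleValue q m R = listExp (E.arrivalLaw q) m (E.totalValue R) / m := by
  unfold ruleValue listExp
  rw [E.integral_pi_arrivalLaw hq]

/-- Weak duality round by round: given the past and the impression, the called set is fixed, so its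
expected value net of prices is at most the LP value. The past is arbitrary, so adaptivity does not
help. -/
theorem IsSolver.listExp_sub_le {solve : ι → (Fin n → ℝ) → Fin n → ℝ} (h : E.IsSolver solve)
    {q : ι → ℝ} (hq : q ∈ stdSimplex ℝ ι) (lam : Fin n → ℝ) (R : E.Rule) (k : ℕ) :
    listExp (E.arrivalLaw q) k (fun as => E.totalValue R as -
      ∑ i, lam i * (E.callCount i (E.play R as) : ℝ)) ≤ k * ∑ j, q j * E.lpValue j lam := by
  have := E.isProbabilityMeasure_arrivalLaw hq
  induction k with
  | zero => simp [totalValue, play, callCount]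
  | succ k ih =>
    rw [listExp_succ (Tame.of_finite _)]
    set F : List E.Arrival → ℝ := fun as => E.totalValue R as -
      ∑ i, lam i * (E.callCount i (E.play R as) : ℝ) with hF
    have hle : listExp (E.arrivalLaw q) k (fun as => ∫ a, F (a :: as) ∂(E.arrivalLaw q)) ≤
        listExp (E.arrivalLaw q) k (fun as => F as + ∑ j, q j * E.lpValue j lam) := by
      refine listExp_mono (Tame.of_finite _) (Tame.of_finite _) fun as _ => ?_
      rw [E.integral_arrivalLaw hq]
      have e : ∀ a : E.Arrival, F (a :: as) = F as +
          (E.slotValue (R (E.play R as) a.1) a.2 - ∑ i ∈ R (E.play R as) a.1, lam i) := by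
        intro a
        simp only [hF, totalValue, play, callCount_observe_cons]
        push_cast
        simp only [mul_add, Finset.sum_add_distrib, mul_ite, mul_one, mul_zero,
          Finset.sum_ite_mem, Finset.univ_inter]
        ring
      simp only [e, mul_add, Finset.sum_add_distrib]
      rw [← Finset.sum_mul, E.sum_arrivalProb hq, one_mul]
      refine add_le_add_right ?_ _
      rw [Fintype.sum_prod_type]
      refine Finset.sum_le_sum fun j _ => ?_
      simp only [arrivalProb_eq, mul_assoc, ← Finset.mul_sum]
      refine mul_le_mul_of_nonneg_left ?_ (hq.1 j)
      have h2 := ((h j).2 lam).expect_slotValue_le (R (E.play R as) j)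
      simp only [mul_sub, Finset.sum_sub_distrib]
      rw [← Finset.sum_mul, E.sum_bidProb, one_mul]
      linarith
    refine hle.trans ?_
    rw [listExp_add (Tame.of_finite _) (Tame.const _), listExp_const]
    push_cast
    linarith

/-- No admissible policy performs better than the Lagrangian dual of the expected LP. -/
theorem IsSolver.value_le {solve : ι → (Fin n → ℝ) → Fin n → ℝ} (h : E.IsSolver solve)
    {q : ι → ℝ} (hq : q ∈ stdSimplex ℝ ι) {lam : Fin n → ℝ} (hl : 0 ≤ lam) {m : ℕ} (hm : 0 < m)
    {P : E.Policy} (hP : P.Admissible m) : P.value q m ≤ E.dualValue q lam := by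
  have := E.isProbabilityMeasure_arrivalLaw hq
  have hm' : (0 : ℝ) < m := Nat.cast_pos.2 hm
  have hae : ∀ᵐ θ ∂P.law, E.ruleValue q m (P.rule θ) ≤ E.dualValue q lam := by
    filter_upwards [hP.2] with θ hθ
    rw [ruleValue_eq_listExp hq, div_le_iff₀ hm']
    have h1 := h.listExp_sub_le hq lam (P.rule θ) m
    rw [listExp_sub (Tame.of_finite _) (Tame.of_finite _)] at h1
    have h2 : listExp (E.arrivalLaw q) m (fun as => ∑ i, lam i *
        (E.callCount i (E.play (P.rule θ) as) : ℝ)) ≤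
        listExp (E.arrivalLaw q) m fun _ => ∑ i, lam i * (E.rate i * m) :=
      listExp_mono (Tame.of_finite _) (Tame.const _) fun as has =>
        Finset.sum_le_sum fun i _ => mul_le_mul_of_nonneg_left (hθ as has i) (hl i)
    rw [listExp_const] at h2
    have h3 : ∑ i, lam i * (E.rate i * m) = m * ∑ i, lam i * E.rate i := by
      rw [Finset.mul_sum]; exact Finset.sum_congr rfl fun i _ => by ring
    unfold dualValue
    linarith
  unfold Policy.value
  by_cases hint : Integrable (fun θ => E.ruleValue q m (P.rule θ)) P.law
  · refine (integral_mono_ae hint (integrable_const _) hae).trans ?_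
    simp
  -- A non-integrable value would be the default 0, which the nonnegative dual still dominates.
  · rw [integral_undef hint]
    exact dualValue_nonneg hq hl

end UpperBound

/-! ### LP-Val as a deterministic function of the randomness of the arrivals -/

section Simulation

variable {m t : ℕ} {η : ℝ} {learn : E.Sample t → Fin n → ℝ}
  {solve : ι → (Fin n → ℝ) → Fin n → ℝ}

theorem mem_lpValRule {θ : LPSeed n m} {h : List E.Round} {j : ι} {i : Fin n} :
    i ∈ E.lpValRule m t η learn solve θ h j ↔ ∃ hh : t ≤ h.length,
      coin θ h.length i <
        solve j (learn (E.sampleOf t η θ h hh) + perturbation η θ h.length) i ∧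
      (E.callCount i h + 1 : ℝ) ≤ E.rate i * m := by
  classical
  unfold lpValRule
  by_cases hh : t ≤ h.length <;> simp [hh]

theorem callCount_play_lpValRule_le (θ : LPSeed n m) (as : List E.Arrival) (i : Fin n) :
    (E.callCount i (E.play (E.lpValRule m t η learn solve θ) as) : ℝ) ≤ E.rate i * m := by
  induction as with
  | nil => simpa [play, callCount] using mul_nonneg (E.rate_nonneg i) (Nat.cast_nonneg m)
  | cons a as ih =>
    rw [play, callCount_observe_cons]
    split_ifs with hi
    · obtain ⟨_, _, h⟩ := E.mem_lpValRule.1 hi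
      push_cast
      exact h
    · simpa using ih

theorem measurable_perturbation (η : ℝ) (s : ℕ) :
    Measurable fun θ : LPSeed n m => perturbation η θ s := by
  refine measurable_pi_iff.2 fun i => ?_
  unfold perturbation
  split_ifs with hs
  · exact (measurable_subtype_coe.comp (measurable_fst.comp ((measurable_pi_apply i).comp
      (measurable_pi_apply _)))).const_mul η
  · exact measurable_const

theorem measurable_coin (s : ℕ) (i : Fin n) : Measurable fun θ : LPSeed n m => coin θ s i := by
  unfold coin
  split_ifs with hs
  · exact measurable_subtype_coe.comp (measurable_snd.comp ((measurable_pi_apply i).comp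
      (measurable_pi_apply _)))
  · exact measurable_const

variable {E}

theorem lpVal_admissible (hlearn : E.IsLearner t learn) (hsolve : E.IsSolver solve) :
    (E.lpVal m t η learn solve).Admissible m := by
  refine ⟨fun h j T => ?_, Filter.Eventually.of_forall fun θ as _ i =>
    E.callCount_play_lpValRule_le θ as i⟩
  change MeasurableSet {θ : LPSeed n m | E.lpValRule m t η learn solve θ h j = T}
  have hi : ∀ i, MeasurableSet {θ : LPSeed n m | i ∈ E.lpValRule m t η learn solve θ h j} := by
    intro i
    simp only [mem_lpValRule]
    by_cases hh : t ≤ h.length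
    · simp only [hh, exists_true_left]
      by_cases hc : (E.callCount i h + 1 : ℝ) ≤ E.rate i * m
      · simp only [hc, and_true]
        refine measurableSet_lt (measurable_coin _ i) ((hsolve.measurable_apply j i).comp
          (Measurable.add ?_ (measurable_perturbation η _)))
        exact (hlearn.1 fun s : Fin t => (h.reverse[(s : ℕ)]'(by
          simpa using lt_of_lt_of_le s.2 hh)).1).comp
          (measurable_pi_iff.2 fun s => measurable_perturbation η s)
      · simp only [hc, and_false]
        exact MeasurableSet.empty
    · simp only [hh, IsEmpty.exists_iff]
      exact MeasurableSet.empty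
  have : {θ : LPSeed n m | E.lpValRule m t η learn solve θ h j = T} =
      ⋂ i, {θ | i ∈ E.lpValRule m t η learn solve θ h j ↔ i ∈ T} := by
    ext θ
    simp only [Set.mem_iInter]
    exact Finset.ext_iff
  rw [this]
  refine MeasurableSet.iInter fun i => ?_
  by_cases hT : i ∈ T
  · simpa only [hT, iff_true] using hi i
  · simp only [hT, iff_false]
    exact (hi i).compl

variable (E)

/-- The random numbers of LP-Val for arrival number `s`. -/
noncomputable def seedAt (θ : LPSeed n m) (s : ℕ) : Fin n → unitInterval × unitInterval :=
  if hs : s < m then θ ⟨s, hs⟩ else fun _ => (0, 0)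

/-- The arrivals paired with the random numbers of LP-Val, most recent first. -/
noncomputable def steps (θ : LPSeed n m) : List E.Arrival → List E.Step
  | [] => []
  | a :: as => (seedAt θ as.length, a) :: steps θ as

theorem length_steps (θ : LPSeed n m) (as : List E.Arrival) :
    (E.steps θ as).length = as.length := by
  induction as with
  | nil => rfl
  | cons a as ih => simp [steps, ih]

theorem length_play (R : E.Rule) (as : List E.Arrival) : (E.play R as).length = as.length := by
  induction as with
  | nil => rfl
  | cons a as ih => simp [play, ih]

theorem reverse_steps_getElem? (θ : LPSeed n m) (as : List E.Arrival) (s : ℕ) :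
    (E.steps θ as).reverse[s]? = as.reverse[s]?.map fun a => (seedAt θ s, a) := by
  induction as with
  | nil => simp [steps]
  | cons a as ih =>
    rw [steps, List.reverse_cons, List.reverse_cons, List.getElem?_append, List.getElem?_append, ih]
    simp only [List.length_reverse, length_steps]
    split_ifs with h
    · rfl
    · by_cases h2 : s = as.length
      · subst h2; simp
      · rw [List.getElem?_eq_none (by simp; omega), List.getElem?_eq_none (by simp; omega)]
        rfl

theorem reverse_play_getElem? (R : E.Rule) (as : List E.Arrival) (s : ℕ) :
    (E.play R as).reverse[s]?.map Prod.fst = as.reverse[s]?.map Prod.fst := by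
  rw [← List.getElem?_map, ← List.getElem?_map, List.map_reverse, List.map_reverse]
  congr 2
  induction as with
  | nil => rfl
  | cons a as ih => simp [play, observe, ih]

/-- The multipliers learned from the randomness of the exploration phase. -/
noncomputable def learned (t : ℕ) (η : ℝ) (learn : E.Sample t → Fin n → ℝ) (e : List E.Step) :
    Fin n → ℝ :=
  if h : e.length = t then
    learn fun s => let p := e.reverse[(s : ℕ)]'(by simp [h]); (p.2.1, Step.shift η p)
  else 0

theorem perturbation_eq {θ : LPSeed n m} {s : ℕ} (hs : s < m) (a : E.Arrival) :
    perturbation η θ s = Step.shift (E := E) η (seedAt θ s, a) := by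
  ext i
  simp [perturbation, Step.shift, cubePoint, seedAt, hs]

theorem coin_eq {θ : LPSeed n m} {s : ℕ} (hs : s < m) (i : Fin n) :
    coin θ s i = (seedAt θ s i).2 := by
  simp [coin, seedAt, hs]

/-- The sample that LP-Val reads off its history does not depend on later arrivals nor on its own
rule, hence is a function of the steps of the exploration phase alone. -/
theorem learned_steps (θ : LPSeed n m) (as e : List E.Arrival) (R : E.Rule) (he : e.length = t)
    (hm : t ≤ m) (hh : t ≤ (E.play R (as ++ e)).length) :
    learn (E.sampleOf t η θ (E.play R (as ++ e)) hh) = E.learned t η learn (E.steps θ e) := by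
  unfold learned
  rw [dif_pos (by rw [length_steps, he])]
  congr 1
  ext1 s
  have hs : (s : ℕ) < e.reverse.length := by simp [he]
  have h1 := E.reverse_steps_getElem? θ e s
  have h2 := E.reverse_play_getElem? R (as ++ e) s
  rw [List.reverse_append, List.getElem?_append_left hs] at h2
  have hs1 : (s : ℕ) < (E.steps θ e).reverse.length := by simp [length_steps, he]
  have hs2 : (s : ℕ) < (E.play R (as ++ e)).reverse.length := by simp [length_play]; omega
  rw [List.getElem?_eq_getElem hs, List.getElem?_eq_getElem hs1] at h1
  rw [List.getElem?_eq_getElem hs, List.getElem?_eq_getElem hs2] at h2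
  simp only [Option.map_some, Option.some_inj] at h1 h2
  unfold sampleOf
  refine Prod.ext ?_ ?_
  · simp only [h1]; exact h2
  · simp only [h1]
    exact E.perturbation_eq (lt_of_lt_of_le s.2 hm) _

theorem lpValRule_eq_empty (θ : LPSeed n m) {h : List E.Round} (hh : h.length < t) (j : ι) :
    E.lpValRule m t η learn solve θ h j = ∅ := by
  unfold lpValRule
  rw [dif_neg (by omega)]

theorem slotValue_empty (b : Fin n → E.bids) : E.slotValue ∅ b = 0 := by
  rw [slotValue_eq_sum_contribution]
  refine Finset.sum_eq_zero fun i _ => le_antisymm ?_ (E.contribution_nonneg _ _ _)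
  simpa using E.contribution_le ∅ b i

theorem explore_eq_zero (θ : LPSeed n m) (e : List E.Arrival) (he : e.length ≤ t) :
    E.totalValue (E.lpValRule m t η learn solve θ) e = 0 ∧
      ∀ i, E.callCount i (E.play (E.lpValRule m t η learn solve θ) e) = 0 := by
  induction e with
  | nil => exact ⟨rfl, fun i => rfl⟩
  | cons a e ih =>
    obtain ⟨h1, h2⟩ := ih (by simp at he; omega)
    have hempty := E.lpValRule_eq_empty (η := η) (learn := learn) (solve := solve) θ
      (h := E.play (E.lpValRule m t η learn solve θ) e) (t := t)
      (by rw [length_play]; simpa using he) a.1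
    refine ⟨?_, fun i => ?_⟩
    · rw [totalValue, hempty, h1, slotValue_empty, add_zero]
    · rw [play, callCount_observe_cons, hempty, h2]; simp

/-- The value of LP-Val as a function of the randomness of all arrivals. -/
noncomputable def lpGain (m t : ℕ) (η : ℝ) (learn : E.Sample t → Fin n → ℝ)
    (solve : ι → (Fin n → ℝ) → Fin n → ℝ) (l : List E.Step) : ℝ :=
  E.exploitValue (E.lpWant solve η (E.learned t η learn (l.drop (l.length - t))))
    (fun s => s.2.2) (fun i => E.rate i * m) (l.take (l.length - t))

theorem steps_append_take (θ : LPSeed n m) (as e : List E.Arrival) :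
    ∃ l, E.steps θ (as ++ e) = l ++ E.steps θ e ∧ l.length = as.length := by
  induction as with
  | nil => exact ⟨[], by simp⟩
  | cons a as ih =>
    obtain ⟨l, hl, hlen⟩ := ih
    exact ⟨(seedAt θ (as ++ e).length, a) :: l, by simp [steps, hl], by simp [hlen]⟩

/-- After exploration LP-Val runs at fixed prices. By induction the actual number of calls is the
demand truncated at the capacity, so its capacity test agrees with the one in `exploitValue`. -/
theorem exploit_eq (θ : LPSeed n m) (as e : List E.Arrival) (he : e.length = t)
    (hm : (as ++ e).length ≤ m) {l : List E.Step} (hl : E.steps θ (as ++ e) = l ++ E.steps θ e) :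
    E.totalValue (E.lpValRule m t η learn solve θ) (as ++ e) =
      E.exploitValue (E.lpWant solve η (E.learned t η learn (E.steps θ e)))
        (fun s => s.2.2) (fun i => E.rate i * m) l ∧
    ∀ i, E.callCount i (E.play (E.lpValRule m t η learn solve θ) (as ++ e)) =
      usedCount (E.lpWant solve η (E.learned t η learn (E.steps θ e)))
        (fun i => E.rate i * m) i l := by
  induction as generalizing l with
  | nil =>
    obtain ⟨h1, h2⟩ := E.explore_eq_zero (η := η) (learn := learn) (solve := solve) (t := t) θ e
      he.le
    have : l = [] := by simpa using hl
    subst this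
    exact ⟨by simpa [exploitValue] using h1, fun i => by
      simpa [usedCount, wantCount] using h2 i⟩
  | cons a as ih =>
    obtain ⟨l', hl', hlen'⟩ := E.steps_append_take θ as e
    have hlt : (as ++ e).length < m := by simp at hm ⊢; omega
    have hl2 : l = (seedAt θ (as ++ e).length, a) :: l' := by
      rw [List.cons_append, steps, hl', ← List.cons_append] at hl
      exact (List.append_cancel_right hl).symm
    obtain ⟨h1, h2⟩ := ih hlt.le hl'
    set R := E.lpValRule m t η learn solve θ with hR
    set lam := E.learned t η learn (E.steps θ e) with hlam
    set s : E.Step := (seedAt θ (as ++ e).length, a) with hs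
    have hK : ∀ i, 0 ≤ E.rate i * m := fun i => mul_nonneg (E.rate_nonneg i) (Nat.cast_nonneg m)
    have hh : t ≤ (E.play R (as ++ e)).length := by rw [length_play]; simp; omega
    have hset : R (E.play R (as ++ e)) a.1 = Finset.univ.filter fun i =>
        E.lpWant solve η lam s i = true ∧
          (wantCount (E.lpWant solve η lam) i l' + 1 : ℝ) ≤ E.rate i * m := by
      ext i
      rw [hR, mem_lpValRule, ← hR]
      simp only [hh, exists_true_left, Finset.mem_filter, Finset.mem_univ, true_and]
      rw [E.learned_steps (η := η) (learn := learn) θ as e R he (by simp at hlt; omega), length_play,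
        E.perturbation_eq hlt a, coin_eq hlt, h2 i]
      refine and_congr (by simp [lpWant, hs, hlam]) ?_
      -- Both tests compare integers with ⌊ρ_i m⌋, and truncating the count at this floor does not
      -- change the outcome.
      have hf : ∀ w : ℕ, ((w : ℝ) + 1 ≤ E.rate i * m) ↔ w + 1 ≤ ⌊E.rate i * m⌋₊ := by
        intro w
        rw [Nat.le_floor_iff (hK i)]; push_cast; rfl
      rw [hf, hf, usedCount]
      omega
    subst hl2
    refine ⟨?_, fun i => ?_⟩
    · rw [List.cons_append, totalValue, h1, hset, exploitValue]
    · have h3 := usedCount_cons (want := E.lpWant solve η lam) hK i s l'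
      rw [List.cons_append, play, callCount_observe_cons, h2, hset]
      have h4 : ((usedCount (E.lpWant solve η lam) (fun i => E.rate i * m) i (s :: l') : ℕ) : ℝ) =
          ((usedCount (E.lpWant solve η lam) (fun i => E.rate i * m) i l' +
          if i ∈ Finset.univ.filter (fun i => E.lpWant solve η lam s i = true ∧
          (wantCount (E.lpWant solve η lam) i l' + 1 : ℝ) ≤ E.rate i * m) then 1 else 0 : ℕ) :
            ℝ) := by
        rw [h3]
        push_cast
        congr 1
        simp only [Finset.mem_filter, Finset.mem_univ, true_and]
        by_cases hw : E.lpWant solve η lam s i = true <;> simp [hw]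
      exact_mod_cast h4.symm

theorem totalValue_eq_lpGain (θ : LPSeed n m) (as : List E.Arrival) (hm : as.length = m)
    (ht : t ≤ m) : E.totalValue (E.lpValRule m t η learn solve θ) as =
      E.lpGain m t η learn solve (E.steps θ as) := by
  have hsplit := List.take_append_drop (m - t) as
  set as' := as.take (m - t) with has'
  set e := as.drop (m - t) with he
  have helen : e.length = t := by simp [he]; omega
  obtain ⟨l, hl, hlen⟩ := E.steps_append_take θ as' e
  have h := (E.exploit_eq (η := η) (learn := learn) (solve := solve) θ as' e helen
    (by rw [hsplit, hm]) hl).1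
  rw [hsplit] at h hl
  rw [h, hl, lpGain]
  have hlen2 : (l ++ E.steps θ e).length - t = l.length := by
    rw [List.length_append, length_steps, helen]; omega
  rw [hlen2, List.take_left', List.drop_left'] <;> rfl

/-- Seeds are numbered in order of arrival and lists are most recent first, whence the reversal. -/
theorem steps_ofFn (θ : LPSeed n m) (a : Fin m → E.Arrival) :
    E.steps θ (List.ofFn a) = List.ofFn fun s => (θ s.rev, a s) := by
  have key : ∀ k (hk : k ≤ m) (b : Fin k → E.Arrival),
      E.steps θ (List.ofFn b) = List.ofFn fun s : Fin k => (θ ⟨k - 1 - s, by omega⟩, b s) := by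
    intro k
    induction k with
    | zero => intro hk b; simp [steps]
    | succ k ih =>
      intro hk b
      rw [List.ofFn_succ, steps, ih (by omega), List.ofFn_succ]
      have h1 : seedAt θ (List.ofFn fun i : Fin k => b i.succ).length = θ ⟨k, by omega⟩ := by
        rw [List.length_ofFn, seedAt, dif_pos (by omega)]
      rw [h1]
      congr 1
      congr 1
      ext1 s
      congr 2
      simp only [Fin.val_succ, Fin.mk.injEq]
      omega
  rw [key m le_rfl a]
  congr 1
  ext1 s
  congr 2
  ext
  simp [Fin.rev]
  omega

end Simulation

end Exchange

namespace Exchange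

variable {n M : ℕ} {ι : Type} {E : Exchange n M ι} [Fintype ι] [MeasurableSpace ι]
  [MeasurableSingletonClass ι] {m t : ℕ} {η : ℝ} {learn : E.Sample t → Fin n → ℝ}
  {solve : ι → (Fin n → ℝ) → Fin n → ℝ}

/-! ### The performance of LP-Val as an expectation over independent steps -/

theorem learned_ofFn (ω : Fin t → E.Step) : E.learned t η learn (List.ofFn ω) =
    learn fun s => ((ω s.rev).2.1, Step.shift η (ω s.rev)) := by
  unfold learned
  rw [dif_pos (List.length_ofFn)]
  congr 1
  ext1 s
  have : (List.ofFn ω).reverse[(s : ℕ)]'(by simp) = ω s.rev := by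
    rw [List.getElem_reverse, List.getElem_ofFn]
    congr 1
    ext
    simp [Fin.rev]
    omega
  simp only [this]

theorem measurable_learned (hlearn : E.IsLearner t learn) :
    Measurable fun ω : Fin t → E.Step => E.learned t η learn (List.ofFn ω) := by
  simp only [learned_ofFn]
  have h1 : Measurable fun p : (Fin t → Fin n → ℝ) × (Fin t → ι) =>
      learn fun s => (p.2 s, p.1 s) :=
    measurable_of_forall_section fun j => hlearn.1 j
  have h2 : Measurable fun ω : Fin t → E.Step =>
      ((fun s => Step.shift η (ω (Fin.rev s)) : Fin t → Fin n → ℝ),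
        (fun s => (ω (Fin.rev s)).2.1 : Fin t → ι)) :=
    (measurable_pi_iff.2 fun s => (measurable_shift η).comp (measurable_pi_apply _)).prodMk
      (measurable_pi_iff.2 fun s => measurable_fst.comp (measurable_snd.comp
        (measurable_pi_apply _)))
  exact h1.comp h2

/-- Allows the prices to be carried as part of each outcome, from which joint measurability in
prices and outcomes follows. -/
theorem exploitValue_map {S S' : Type*} (φ : S → S') (want : S' → Fin n → Bool)
    (bid : S' → Fin n → E.bids) (K : Fin n → ℝ) (l : List S) :
    E.exploitValue want bid K (l.map φ) =
      E.exploitValue (fun s => want (φ s)) (fun s => bid (φ s)) K l := by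
  induction l with
  | nil => rfl
  | cons s l ih =>
    have hcount : ∀ i, wantCount want i (l.map φ) = wantCount (fun s => want (φ s)) i l := by
      intro i; rw [wantCount, List.countP_map]; rfl
    rw [List.map_cons, exploitValue, exploitValue, ih]
    congr 2
    exact Finset.filter_congr fun i _ => by rw [hcount]

theorem IsSolver.measurable_exploitValue (h : E.IsSolver solve) (η : ℝ) (K : Fin n → ℝ) (k : ℕ) :
    Measurable fun p : (Fin n → ℝ) × (Fin k → E.Step) =>
      E.exploitValue (E.lpWant solve η p.1) (fun s => s.2.2) K (List.ofFn p.2) := by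
  have h1 := (E.tame_exploitValue (K := K) (h.measurable_lpWant η)
    (bid := fun p : (Fin n → ℝ) × E.Step => p.2.2.2) (measurable_bid.comp measurable_snd)).measurable k
  have h2 : Measurable fun p : (Fin n → ℝ) × (Fin k → E.Step) =>
      (fun i => (p.1, p.2 i) : Fin k → (Fin n → ℝ) × E.Step) :=
    measurable_pi_iff.2 fun i => measurable_fst.prodMk
      ((measurable_pi_apply i).comp measurable_snd)
  have h3 := h1.comp h2
  have e : ∀ p : (Fin n → ℝ) × (Fin k → E.Step), (List.ofFn fun i => (p.1, p.2 i)) =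
      (List.ofFn p.2).map fun s => (p.1, s) := by
    intro p; rw [List.map_ofFn]; rfl
  simpa only [Function.comp_def, e, exploitValue_map] using h3

theorem exploitValue_le {S : Type*} (want : S → Fin n → Bool)
    (bid : S → Fin n → E.bids) (K : Fin n → ℝ) (l : List S) :
    E.exploitValue want bid K l ≤ l.length * (n * E.maxBid) := by
  induction l with
  | nil => simp [exploitValue]
  | cons s l ih =>
    rw [exploitValue, List.length_cons]
    have := E.slotValue_le (Finset.univ.filter fun i => want s i = true ∧
      (wantCount want i l + 1 : ℝ) ≤ K i) (bid s)
    push_cast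
    linarith

theorem tame_lpGain (hlearn : E.IsLearner t learn) (h : E.IsSolver solve) :
    Tame (E.lpGain m t η learn solve) where
  measurable k := by
    rcases le_or_gt t k with htk | htk
    · obtain ⟨k, rfl⟩ := Nat.exists_eq_add_of_le' htk
      have e : ∀ ω : Fin (k + t) → E.Step, E.lpGain m t η learn solve (List.ofFn ω) =
          E.exploitValue (E.lpWant solve η (E.learned t η learn
            (List.ofFn fun s => ω (Fin.natAdd k s)))) (fun s => s.2.2) (fun i => E.rate i * m)
            (List.ofFn fun s => ω (Fin.castAdd t s)) := by
        intro ω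
        have : List.ofFn ω = (List.ofFn fun s => ω (Fin.castAdd t s)) ++
            List.ofFn fun s => ω (Fin.natAdd k s) := by
          rw [← List.ofFn_fin_append]
          congr 1
          exact (Fin.append_castAdd_natAdd (f := ω)).symm
        rw [lpGain, List.length_ofFn, Nat.add_sub_cancel, this, List.take_left' (by simp),
          List.drop_left' (by simp)]
      simp only [e]
      have h2 : Measurable fun ω : Fin (k + t) → E.Step =>
          (E.learned t η learn (List.ofFn fun s => ω (Fin.natAdd k s)),
            (fun s => ω (Fin.castAdd t s) : Fin k → E.Step)) :=
        Measurable.prodMk ((measurable_learned hlearn).comp (measurable_pi_iff.2 fun s : Fin t =>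
          measurable_pi_apply (Fin.natAdd k s)))
          (measurable_pi_iff.2 fun s : Fin k => measurable_pi_apply (Fin.castAdd t s))
      exact (h.measurable_exploitValue η (fun i => E.rate i * m) k).comp h2
    · have e : ∀ ω : Fin k → E.Step, E.lpGain m t η learn solve (List.ofFn ω) = 0 := by
        intro ω
        rw [lpGain, List.length_ofFn, show k - t = 0 by omega, List.take_zero]
        rfl
      simp only [e]
      exact measurable_const
  bounded k := by
    refine ⟨k * (n * E.maxBid), fun ω => ?_⟩
    unfold lpGain
    rw [abs_of_nonneg (E.exploitValue_nonneg _ _ _ _)]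
    refine (exploitValue_le _ _ _ _).trans (mul_le_mul_of_nonneg_right ?_
      (mul_nonneg (Nat.cast_nonneg n) E.maxBid_nonneg))
    rw [Nat.cast_le]
    simp

/-- Seeds and arrivals are independent, and the law of i.i.d. seeds is invariant under reversing
their order, so pairing the two lists gives i.i.d. steps. -/
theorem lpVal_value_eq (hlearn : E.IsLearner t learn) (h : E.IsSolver solve) {q : ι → ℝ}
    (hq : q ∈ stdSimplex ℝ ι) (htm : t ≤ m) : (E.lpVal m t η learn solve).value q m =
      listExp (E.stepLaw q) m (E.lpGain m t η learn solve) / m := by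
  have := E.isProbabilityMeasure_arrivalLaw hq
  have := E.isProbabilityMeasure_stepLaw hq
  let Φ : (Fin m → Fin n → unitInterval × unitInterval) × (Fin m → E.Arrival) → ℝ :=
    fun p => E.lpGain m t η learn solve (List.ofFn fun s => (p.1 s, p.2 s))
  have htame := tame_lpGain (m := m) (η := η) hlearn h
  have h1 : listExp (E.stepLaw q) m (E.lpGain m t η learn solve) =
      ∫ p, Φ p ∂((Measure.pi fun _ => volume).prod (Measure.pi fun _ => E.arrivalLaw q)) :=
    (measurePreserving_arrowProdEquivProdArrow (Fin n → unitInterval × unitInterval) E.Arrival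
      (Fin m) (fun _ => volume) (fun _ => E.arrivalLaw q)).integral_comp' Φ
  have hΦ : Integrable Φ ((Measure.pi fun _ => volume).prod
      (Measure.pi fun _ => E.arrivalLaw q)) := by
    obtain ⟨C, hC⟩ := htame.bounded m
    refine Integrable.of_bound (Measurable.aestronglyMeasurable ?_) C
      (Filter.Eventually.of_forall fun p => hC _)
    refine (htame.measurable m).comp (f := fun p : (Fin m → Fin n → unitInterval × unitInterval) ×
      (Fin m → E.Arrival) => fun s => (p.1 s, p.2 s)) (measurable_pi_iff.2 fun s => ?_)
    exact ((measurable_pi_apply s).comp measurable_fst).prodMk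
      ((measurable_pi_apply s).comp measurable_snd)
  rw [h1, integral_prod _ hΦ]
  have h2 := (volume_measurePreserving_piCongrLeft
    (fun _ : Fin m => Fin n → unitInterval × unitInterval) Fin.revPerm).integral_comp'
      fun z => ∫ a, Φ (z, a) ∂(Measure.pi fun _ => E.arrivalLaw q)
  have key : ∀ (θ : LPSeed n m) (a : Fin m → E.Arrival),
      E.totalValue (E.lpValRule m t η learn solve θ) (List.ofFn a) =
      Φ (MeasurableEquiv.piCongrLeft (fun _ => Fin n → unitInterval × unitInterval)
        Fin.revPerm θ, a) := by
    intro θ a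
    rw [E.totalValue_eq_lpGain θ _ List.length_ofFn htm, steps_ofFn]
    have hrev : ∀ s, MeasurableEquiv.piCongrLeft (fun _ : Fin m => Fin n → unitInterval × unitInterval)
        Fin.revPerm θ s = θ s.rev := by
      intro s
      have := Equiv.piCongrLeft_apply_apply (fun _ : Fin m => Fin n → unitInterval × unitInterval)
        Fin.revPerm θ s.rev
      rw [Fin.revPerm_apply, Fin.rev_rev] at this
      exact this
    simp only [Φ, hrev]
  refine Eq.trans ?_ (congrArg (· / (m : ℝ)) h2)
  unfold Policy.value
  rw [← integral_div]
  refine integral_congr_ae (Filter.Eventually.of_forall fun θ => ?_)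
  dsimp only
  rw [E.integral_pi_arrivalLaw hq]
  exact congrArg (· / (m : ℝ)) (Finset.sum_congr rfl fun a _ => congrArg _ (key θ a))

/-- Conditioning on the exploration phase: the later steps are independent of it, and the learned
prices are constant for them. -/
theorem le_listExp_lpGain (hlearn : E.IsLearner t learn) (h : E.IsSolver solve) {q : ι → ℝ}
    (hq : q ∈ stdSimplex ℝ ι) (htm : t ≤ m) {H : List E.Step → ℝ} (hH : Tame H)
    (hle : ∀ e : List E.Step, e.length = t → H e ≤ listExp (E.stepLaw q) (m - t)
      (E.exploitValue (E.lpWant solve η (E.learned t η learn e)) (fun s => s.2.2)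
        fun i => E.rate i * m)) :
    listExp (E.stepLaw q) t H ≤ listExp (E.stepLaw q) m (E.lpGain m t η learn solve) := by
  have := E.isProbabilityMeasure_stepLaw hq
  have htame := tame_lpGain (m := m) (η := η) hlearn h
  obtain ⟨k, rfl⟩ := Nat.exists_eq_add_of_le' htm
  rw [listExp_add_length htame]
  refine listExp_mono hH (htame.listExp_append k) fun e he => (hle e he).trans (le_of_eq ?_)
  rw [Nat.add_sub_cancel]
  unfold listExp
  refine integral_congr_ae (Filter.Eventually.of_forall fun ω => ?_)
  dsimp only
  have hlen : (List.ofFn ω ++ e).length - t = k := by simp [he]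
  rw [lpGain, hlen, List.take_left' (by simp), List.drop_left' (by simp)]

/-! ### The value of rounding at given multipliers -/

theorem IsSolver.integrable_roundValue (h : E.IsSolver solve) (η : ℝ) (lam : Fin n → ℝ) (j : ι) :
    Integrable fun u => E.roundValue j (solve j (lam + cubePoint η u)) := by
  have hm : Measurable fun u => E.roundValue j (solve j (lam + cubePoint η u)) :=
    (measurable_roundValue j).comp ((h j).1.comp ((measurable_cubePoint η).const_add lam))
  refine Integrable.of_bound hm.aestronglyMeasurable
    (∑ β : Fin n → Bool, ∑ b, E.bidProb j b *
      E.slotValue (Finset.univ.filter fun i => β i = true) b)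
    (Filter.Eventually.of_forall fun u => ?_)
  have h0 : ∀ (β : Fin n → Bool) i, 0 ≤ if β i then solve j (lam + cubePoint η u) i else
      1 - solve j (lam + cubePoint η u) i := fun β i => by
    split_ifs
    · exact h.nonneg _ _ _
    · exact sub_nonneg.2 (h.le_one _ _ _)
  have h1 : ∀ (β : Fin n → Bool) i, (if β i then solve j (lam + cubePoint η u) i else
      1 - solve j (lam + cubePoint η u) i) ≤ 1 := fun β i => by
    split_ifs
    · exact h.le_one _ _ _
    · exact sub_le_self _ (h.nonneg _ _ _)
  unfold roundValue
  rw [Real.norm_eq_abs, abs_of_nonneg (Finset.sum_nonneg fun β _ => Finset.sum_nonneg fun b _ =>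
    mul_nonneg (mul_nonneg (Finset.prod_nonneg fun i _ => h0 β i) (E.bidProb_nonneg j b))
      (E.slotValue_nonneg _ _))]
  refine Finset.sum_le_sum fun β _ => Finset.sum_le_sum fun b _ => ?_
  rw [mul_assoc]
  exact mul_le_of_le_one_left (mul_nonneg (E.bidProb_nonneg j b) (E.slotValue_nonneg _ _))
    (Finset.prod_le_one (fun i _ => h0 β i) fun i _ => h1 β i)

theorem one_sub_inv_exp_nonneg : (0 : ℝ) ≤ 1 - 1 / Real.exp 1 := by
  have : 1 / Real.exp 1 ≤ 1 := by
    rw [div_le_one (Real.exp_pos 1)]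
    exact Real.one_le_exp zero_le_one
  linarith

/-- Rounding the perturbed decoupled LPs at multipliers `lam` retains `1 - 1/e` of the dual value,
up to a loss from call-outs that are paid for but not used, and with a quadratic surplus. -/
theorem IsSolver.le_sum_expContribution (h : E.IsSolver solve) (hL : 0 < E.maxBid) (hη : 0 < η)
    {lam : Fin n → ℝ} (hl : 0 ≤ lam) {q : ι → ℝ} (hq : q ∈ stdSimplex ℝ ι) :
    (1 - 1 / Real.exp 1) * (E.dualValue q lam - n * η -
      ∑ i, lam i * (E.rate i - meanUse solve η q 1 i lam)) +
      1 / (32 * E.maxBid) * ∑ i, lam i ^ 2 * meanUse solve η q 2 i lam ≤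
    ∑ i, E.expContribution (E.lpWant solve η lam) (fun s => s.2.2) (E.stepLaw q) i := by
  rw [h.sum_expContribution_lpWant η lam hq]
  set γ : ℝ := 1 - 1 / Real.exp 1 with hγ
  have hγ0 : 0 ≤ γ := one_sub_inv_exp_nonneg
  set c : ℝ := 1 / (32 * E.maxBid) with hc
  have hc0 : 0 ≤ c := by positivity
  -- For each perturbation: optimal rounding at the perturbed prices, the subgradient inequality to
  -- return to λ at a cost of at most nη, and perturbed prices that are at least λ.
  have hpoint : ∀ j u, γ * (E.lpValue j lam - n * η + ∑ i, lam i * solve j (lam + cubePoint η u) i ^ 1) +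
      c * ∑ i, lam i ^ 2 * solve j (lam + cubePoint η u) i ^ 2 ≤
      E.roundValue j (solve j (lam + cubePoint η u)) := by
    intro j u
    have hw0 : ∀ i, 0 ≤ cubePoint η u i := fun i => mul_nonneg hη.le (u i).2.1
    have hw1 : ∀ i, cubePoint η u i ≤ η := fun i => mul_le_of_le_one_right hη.le (u i).2.2
    have h1 := ((h j).2 (lam + cubePoint η u)).le_roundValue hL
      fun i => add_nonneg (hl i) (hw0 i)
    have h2 := ((h j).2 lam).lpValue_le_add ((h j).2 (lam + cubePoint η u))
    have h3 : ∑ i, ((lam + cubePoint η u) i - lam i) * solve j lam i ≤ n * η := by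
      calc _ ≤ ∑ _i : Fin n, η := by
            refine Finset.sum_le_sum fun i _ => ?_
            rw [Pi.add_apply, add_sub_cancel_left]
            calc _ ≤ η * 1 := mul_le_mul (hw1 i) (h.le_one _ _ _) (h.nonneg _ _ _) hη.le
              _ = η := mul_one η
        _ = n * η := by simp
    have h4 : ∀ i, lam i * solve j (lam + cubePoint η u) i ≤
        (lam + cubePoint η u) i * solve j (lam + cubePoint η u) i := fun i =>
      mul_le_mul_of_nonneg_right (le_add_of_nonneg_right (hw0 i)) (h.nonneg _ _ _)
    have h5 : ∑ i, lam i * solve j (lam + cubePoint η u) i ^ 1 ≤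
        ∑ i, (lam + cubePoint η u) i * solve j (lam + cubePoint η u) i :=
      Finset.sum_le_sum fun i _ => by rw [pow_one]; exact h4 i
    have h6 : ∑ i, lam i ^ 2 * solve j (lam + cubePoint η u) i ^ 2 ≤
        ∑ i, ((lam + cubePoint η u) i * solve j (lam + cubePoint η u) i) ^ 2 :=
      Finset.sum_le_sum fun i _ => by
        rw [← mul_pow]
        exact pow_le_pow_left₀ (mul_nonneg (hl i) (h.nonneg _ _ _)) (h4 i) 2
    have h7 := mul_le_mul_of_nonneg_left h6 hc0
    have h8 : γ * (E.lpValue j lam - n * η +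
        ∑ i, lam i * solve j (lam + cubePoint η u) i ^ 1) ≤
        γ * (E.lpValue j (lam + cubePoint η u) +
        ∑ i, (lam + cubePoint η u) i * solve j (lam + cubePoint η u) i) :=
      mul_le_mul_of_nonneg_left (by linarith) hγ0
    linarith
  have hi1 : ∀ j, Integrable fun u => ∑ i, lam i * solve j (lam + cubePoint η u) i ^ 1 :=
    fun j => integrable_finsetSum _ fun i _ => (h.integrable_pow η 1 i lam j).const_mul _
  have hi2 : ∀ j, Integrable fun u => ∑ i, lam i ^ 2 * solve j (lam + cubePoint η u) i ^ 2 :=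
    fun j => integrable_finsetSum _ fun i _ => (h.integrable_pow η 2 i lam j).const_mul _
  have hint : ∀ j, γ * (E.lpValue j lam - n * η + ∑ i, lam i * avgUse solve η 1 i lam j) +
      c * ∑ i, lam i ^ 2 * avgUse solve η 2 i lam j ≤
      ∫ u, E.roundValue j (solve j (lam + cubePoint η u)) := by
    intro j
    have hi3 : Integrable fun u => γ * (E.lpValue j lam - n * η +
        ∑ i, lam i * solve j (lam + cubePoint η u) i ^ 1) :=
      ((integrable_const _).add (hi1 j)).const_mul γ
    have h9 := integral_mono (hi3.add ((hi2 j).const_mul c)) (h.integrable_roundValue η lam j)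
      fun u => hpoint j u
    refine le_trans (le_of_eq ?_) h9
    rw [integral_add' hi3 ((hi2 j).const_mul c), integral_const_mul, integral_const_mul,
      integral_add (integrable_const _) (hi1 j),
      integral_finsetSum _ fun i _ => (h.integrable_pow η 1 i lam j).const_mul _,
      integral_finsetSum _ fun i _ => (h.integrable_pow η 2 i lam j).const_mul _]
    simp only [integral_const_mul, integral_const, probReal_univ, one_smul]
    rfl
  refine le_trans (le_of_eq ?_) (Finset.sum_le_sum fun j _ =>
    mul_le_mul_of_nonneg_left (hint j) (hq.1 j))
  have e1 : ∑ i, lam i * meanUse solve η q 1 i lam =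
      ∑ j, q j * ∑ i, lam i * avgUse solve η 1 i lam j := by
    simp only [meanUse, Finset.mul_sum]
    rw [Finset.sum_comm]
    exact Finset.sum_congr rfl fun j _ => Finset.sum_congr rfl fun i _ => by ring
  have e2 : ∑ i, lam i ^ 2 * meanUse solve η q 2 i lam =
      ∑ j, q j * ∑ i, lam i ^ 2 * avgUse solve η 2 i lam j := by
    simp only [meanUse, Finset.mul_sum]
    rw [Finset.sum_comm]
    exact Finset.sum_congr rfl fun j _ => Finset.sum_congr rfl fun i _ => by ring
  have e3 : ∑ j, q j * (γ * (E.lpValue j lam - n * η + ∑ i, lam i * avgUse solve η 1 i lam j) +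
      c * ∑ i, lam i ^ 2 * avgUse solve η 2 i lam j) =
      γ * (∑ j, q j * E.lpValue j lam - (∑ j, q j) * (n * η) +
        ∑ j, q j * ∑ i, lam i * avgUse solve η 1 i lam j) +
      c * ∑ j, q j * ∑ i, lam i ^ 2 * avgUse solve η 2 i lam j := by
    rw [Finset.sum_mul, mul_add γ, mul_sub γ, Finset.mul_sum (a := γ), Finset.mul_sum (a := γ),
      Finset.mul_sum (a := γ), Finset.mul_sum (a := c), ← Finset.sum_sub_distrib,
      ← Finset.sum_add_distrib, ← Finset.sum_add_distrib]
    exact Finset.sum_congr rfl fun j _ => by ring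
  rw [e3, hq.2, ← e1, ← e2]
  unfold dualValue
  simp only [mul_sub, Finset.sum_sub_distrib]
  ring

end Exchange

namespace Exchange

variable {n M : ℕ} {ι : Type} {E : Exchange n M ι}

/-! ### Learning rules -/

/-- Prices so high that nobody is called out on a sample with perturbations `w`. -/
noncomputable def safePrice (E : Exchange n M ι) {t : ℕ} (w : Fin t → Fin n → ℝ) (i : Fin n) : ℝ :=
  E.maxBid + ∑ s, |w s i|

theorem measurable_safePrice (E : Exchange n M ι) (t : ℕ) :
    Measurable fun w : Fin t → Fin n → ℝ => E.safePrice w :=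
  measurable_pi_iff.2 fun i => (Finset.measurable_sum _ fun s _ =>
    (measurable_norm.comp ((measurable_pi_apply i).comp (measurable_pi_apply s)))).const_add _

/-- With all scaling factors zero the sampled dual is nonnegative, and it vanishes once every
perturbed price is at least L. -/
theorem isOptimalMultiplier_safePrice {t : ℕ} (σ : E.Sample t) :
    E.IsOptimalMultiplier σ (fun i => 0 * E.rate i) (E.safePrice fun s => (σ s).2) := by
  have hnn : ∀ i, 0 ≤ ∑ s, |(σ s).2 i| := fun i => Finset.sum_nonneg fun s _ => abs_nonneg _
  refine ⟨fun i => add_nonneg E.maxBid_nonneg (hnn i), fun lam' _ => ?_⟩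
  have h0 : E.sampleDual σ (fun i => 0 * E.rate i) (E.safePrice fun s => (σ s).2) = 0 := by
    unfold sampleDual
    have : ∀ s, E.lpValue (σ s).1 ((E.safePrice fun s => (σ s).2) + (σ s).2) = 0 := by
      intro s
      refine lpValue_eq_zero fun i => ?_
      have h1 : |(σ s).2 i| ≤ ∑ s, |(σ s).2 i| :=
        Finset.single_le_sum (f := fun s => |(σ s).2 i|) (fun _ _ => abs_nonneg _)
          (Finset.mem_univ s)
      have h2 := neg_abs_le ((σ s).2 i)
      simp only [safePrice, Pi.add_apply]
      linarith
    simp [this]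
  rw [h0]
  unfold sampleDual
  refine add_nonneg (Finset.sum_nonneg fun i _ => by simp)
    (div_nonneg (Finset.sum_nonneg fun s _ => lpValue_nonneg _ _) (Nat.cast_nonneg t))

theorem isLearner_safePrice (E : Exchange n M ι) (t : ℕ) :
    E.IsLearner t fun σ => E.safePrice fun s => (σ s).2 :=
  ⟨fun _ => E.measurable_safePrice t, fun _ _ => 0, fun σ =>
    ⟨fun _ => ⟨le_rfl, zero_le_one⟩, isOptimalMultiplier_safePrice σ⟩⟩

/-- The fraction of the sampled arrivals on which network `i` is called out at prices `lam`. -/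
noncomputable def sampledUse {t : ℕ} (solve : ι → (Fin n → ℝ) → Fin n → ℝ) (lam : Fin n → ℝ)
    (σ : E.Sample t) (i : Fin n) : ℝ := (∑ s, solve (σ s).1 (lam + (σ s).2) i) / t

/-- The learning rule that chooses the multipliers from the sampled impressions, and checks that
they respect the call-out rates on the sample. -/
noncomputable def checkedPrice {t : ℕ} (solve : ι → (Fin n → ℝ) → Fin n → ℝ)
    (price : (Fin t → ι) → Fin n → ℝ) (σ : E.Sample t) : Fin n → ℝ :=
  open scoped Classical in
  if ∀ i, sampledUse solve (price fun s => (σ s).1) σ i ≤ E.rate i then price fun s => (σ s).1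
  else E.safePrice fun s => (σ s).2

variable {solve : ι → (Fin n → ℝ) → Fin n → ℝ}

/-- The subgradient of the sampled dual at λ is the vector of bounds minus the sampled use; if the
bounds equal the use, it is zero. -/
theorem IsSolver.isOptimalMultiplier (h : E.IsSolver solve) {t : ℕ} (σ : E.Sample t)
    {lam : Fin n → ℝ} (hl : 0 ≤ lam) : E.IsOptimalMultiplier σ (sampledUse solve lam σ) lam := by
  refine ⟨hl, fun lam' _ => ?_⟩
  have h1 : ∀ s, E.lpValue (σ s).1 (lam + (σ s).2) ≤ E.lpValue (σ s).1 (lam' + (σ s).2) +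
      ∑ i, (lam' i - lam i) * solve (σ s).1 (lam + (σ s).2) i := by
    intro s
    have := ((h (σ s).1).2 (lam + (σ s).2)).lpValue_le_add ((h (σ s).1).2 (lam' + (σ s).2))
    simpa using this
  have h2 := Finset.sum_le_sum fun s (_ : s ∈ Finset.univ) => h1 s
  rw [Finset.sum_add_distrib, Finset.sum_comm] at h2
  have h3 := div_le_div_of_nonneg_right h2 (Nat.cast_nonneg t : (0 : ℝ) ≤ t)
  have h4 : (∑ i, ∑ s, (lam' i - lam i) * solve (σ s).1 (lam + (σ s).2) i) / t =
      ∑ i, lam' i * sampledUse solve lam σ i - ∑ i, lam i * sampledUse solve lam σ i := by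
    rw [← Finset.sum_sub_distrib, Finset.sum_div]
    refine Finset.sum_congr rfl fun i _ => ?_
    rw [← Finset.mul_sum, sampledUse]
    ring
  rw [add_div, h4] at h3
  unfold sampleDual
  linarith

theorem IsSolver.isLearner_checkedPrice (h : E.IsSolver solve) {t : ℕ}
    {price : (Fin t → ι) → Fin n → ℝ} (hprice : ∀ j, 0 ≤ price j) :
    E.IsLearner t (E.checkedPrice solve price) := by
  classical
  have hκ : ∀ σ : E.Sample t, ∃ κ : Fin n → ℝ, (∀ i, 0 ≤ κ i ∧ κ i ≤ 1) ∧
      E.IsOptimalMultiplier σ (fun i => κ i * E.rate i) (E.checkedPrice solve price σ) := by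
    intro σ
    unfold checkedPrice
    split_ifs with hc
    · have hnn : ∀ i, 0 ≤ sampledUse solve (price fun s => (σ s).1) σ i := fun i =>
        div_nonneg (Finset.sum_nonneg fun s _ => h.nonneg _ _ _) (Nat.cast_nonneg t)
      -- The scaling factor reduces the budget to the sampled use, and the check puts it into [0,
      -- 1]. If the rate is 0, the check forces zero use.
      refine ⟨fun i => sampledUse solve (price fun s => (σ s).1) σ i / E.rate i,
        fun i => ⟨div_nonneg (hnn i) (E.rate_nonneg i),
        div_le_one_of_le₀ (hc i) (E.rate_nonneg i)⟩, ?_⟩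
      convert h.isOptimalMultiplier σ (hprice _) using 2 with i
      by_cases h0 : E.rate i = 0
      · rw [h0, mul_zero]
        exact le_antisymm (hnn i) (h0 ▸ hc i)
      · exact div_mul_cancel₀ _ h0
    · exact ⟨fun _ => 0, fun _ => ⟨le_rfl, zero_le_one⟩, isOptimalMultiplier_safePrice σ⟩
  choose κ hκ using hκ
  refine ⟨fun j => ?_, κ, hκ⟩
  unfold checkedPrice
  refine Measurable.ite ?_ (measurable_const (a := price j)) (E.measurable_safePrice t)
  have : {w : Fin t → Fin n → ℝ | ∀ i, sampledUse (E := E) solve (price fun s => j s)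
      (fun s => (j s, w s)) i ≤ E.rate i} = ⋂ i, {w | sampledUse (E := E) solve (price fun s => j s)
      (fun s => (j s, w s)) i ≤ E.rate i} := by
    ext w; simp
  refine (congrArg MeasurableSet this).mpr ?_
  refine MeasurableSet.iInter fun i => measurableSet_le ?_ measurable_const
  unfold sampledUse
  refine (Finset.measurable_sum _ fun s _ => ?_).div_const _
  exact (h.measurable_apply (j s) i).comp ((measurable_pi_apply s).const_add _)

/-! ### The choice of the multipliers on a grid -/

/-- The grid point `y` in `[0, B]ⁿ`, where the coordinates of the networks in `A` are set to `B`. -/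
noncomputable def gridPrice (B : ℝ) (K : ℕ) (A : Fin n → Prop) (y : Fin n → ℕ) (i : Fin n) : ℝ :=
  open scoped Classical in if A i then B else B * y i / K

theorem gridPrice_mem {B : ℝ} (hB : 0 ≤ B) {K : ℕ} (A : Fin n → Prop)
    {y : Fin n → ℕ} {i : Fin n} (hy : y i ≤ K) :
    0 ≤ gridPrice B K A y i ∧ gridPrice B K A y i ≤ B := by
  unfold gridPrice
  split_ifs
  · exact ⟨hB, le_rfl⟩
  · refine ⟨by positivity, ?_⟩
    rw [mul_div_assoc]
    exact mul_le_of_le_one_right hB (div_le_one_of_le₀ (Nat.cast_le.2 hy) (Nat.cast_nonneg K))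

theorem abs_gridPrice_sub_le {B : ℝ} (hB : 0 ≤ B) {K : ℕ} (A : Fin n → Prop)
    {y r : Fin n → ℕ} {i : Fin n} (h : y i ≤ r i ∧ r i ≤ y i + 1) :
    |gridPrice B K A r i - gridPrice B K A y i| ≤ B / K := by
  unfold gridPrice
  split_ifs
  · rw [sub_self, abs_zero]; positivity
  · have e : B * r i / K - B * y i / K = (B / K) * ((r i : ℝ) - y i) := by ring
    rw [e, abs_mul, abs_of_nonneg (by positivity : 0 ≤ B / K)]
    refine mul_le_of_le_one_right (by positivity) ?_
    have h1 : (y i : ℝ) ≤ r i := Nat.cast_le.2 h.1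
    have h2 : (r i : ℝ) ≤ y i + 1 := by exact_mod_cast h.2
    rw [abs_le]
    constructor <;> linarith

/-- The average of the `p`-th powers of call-out probabilities over sampled impressions. -/
noncomputable def sampleMean {t : ℕ} (solve : ι → (Fin n → ℝ) → Fin n → ℝ) (η : ℝ)
    (j : Fin t → ι) (p : ℕ) (i : Fin n) (lam : Fin n → ℝ) : ℝ :=
  (∑ s, avgUse solve η p i lam (j s)) / t

section SampleMean

variable {t : ℕ} {η : ℝ} (j : Fin t → ι) (p : ℕ) (i : Fin n) (lam lam' : Fin n → ℝ)

theorem IsSolver.sampleMean_nonneg (h : E.IsSolver solve) : 0 ≤ sampleMean solve η j p i lam :=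
  div_nonneg (Finset.sum_nonneg fun _ _ => h.avgUse_nonneg _ _ _ _ _) (Nat.cast_nonneg t)

theorem IsSolver.sampleMean_le_one (h : E.IsSolver solve) : sampleMean solve η j p i lam ≤ 1 := by
  refine div_le_one_of_le₀ ?_ (Nat.cast_nonneg t)
  refine (Finset.sum_le_sum fun s _ => h.avgUse_le_one η p i lam (j s)).trans ?_
  simp

theorem IsSolver.abs_sampleMean_sub_le (h : E.IsSolver solve) (hη : 0 < η) {D : ℝ} (hD : 0 ≤ D)
    (hlam : ∑ k, |lam' k - lam k| ≤ D) :
    |sampleMean solve η j p i lam' - sampleMean solve η j p i lam| ≤ D / η := by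
  unfold sampleMean
  rw [← sub_div, ← Finset.sum_sub_distrib, abs_div, abs_of_nonneg (Nat.cast_nonneg t : (0 : ℝ) ≤ t)]
  refine div_le_of_le_mul₀ (Nat.cast_nonneg t) (by positivity) ?_
  have hs : ∀ s, |avgUse solve η p i lam' (j s) - avgUse solve η p i lam (j s)| ≤ D / η := by
    intro s
    refine (h.abs_avgUse_sub_le hη p i lam lam' (j s)).trans ?_
    rw [one_div_mul_eq_div]
    exact div_le_div_of_nonneg_right hlam hη.le
  refine (Finset.abs_sum_le_sum_abs _ _).trans ((Finset.sum_le_sum fun s _ => hs s).trans ?_)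
  simp [mul_comm]

end SampleMean

/-- The excess of the budget of network `i` over its use and a safety margin, in money. -/
noncomputable def excess {t : ℕ} (E : Exchange n M ι) (solve : ι → (Fin n → ℝ) → Fin n → ℝ)
    (η β : ℝ) (j : Fin t → ι) (lam : Fin n → ℝ) (i : Fin n) : ℝ :=
  lam i * (E.rate i - sampleMean solve η j 1 i lam) -
    1 / (144 * E.maxBid) * (lam i ^ 2 * sampleMean solve η j 2 i lam) - 11 * β

/-- Sampled uses are averages over cubes of side η, hence Lipschitz with constant 1/η; the price
factors are bounded by 2L. The bound on η lets the change of price be absorbed as well. -/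
theorem IsSolver.abs_excess_sub_le (h : E.IsSolver solve) (hL : 0 < E.maxBid) {η β : ℝ}
    (hη : 0 < η) {t : ℕ} (j : Fin t → ι) (i : Fin n) {lam lam' : Fin n → ℝ} {d : ℝ} (hd : 0 ≤ d)
    (h0 : 0 ≤ lam i) (h1 : lam i ≤ 2 * E.maxBid) (h0' : 0 ≤ lam' i) (h1' : lam' i ≤ 2 * E.maxBid)
    (hlam : ∀ k, |lam' k - lam k| ≤ d) (hηL : η ≤ n * (2 * E.maxBid)) :
    |E.excess solve η β j lam' i - E.excess solve η β j lam i| ≤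
      3 * (2 * E.maxBid) * (n * d / η) := by
  have hsum : ∑ k, |lam' k - lam k| ≤ n * d := by
    refine (Finset.sum_le_sum fun k _ => hlam k).trans ?_
    simp
  have hnd : 0 ≤ n * d := by positivity
  have hU := h.abs_sampleMean_sub_le j 1 i lam lam' hη hnd hsum
  have hQ := h.abs_sampleMean_sub_le j 2 i lam lam' hη hnd hsum
  have hU0 := h.sampleMean_nonneg (η := η) j 1 i lam'
  have hU1 := h.sampleMean_le_one (η := η) j 1 i lam'
  have hQ0 := h.sampleMean_nonneg (η := η) j 2 i lam'
  have hQ1 := h.sampleMean_le_one (η := η) j 2 i lam'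
  have hr0 := E.rate_nonneg i
  have hr1 := E.rate_le_one i
  unfold excess
  set L := E.maxBid
  set D := n * d / η with hD
  have hD0 : 0 ≤ D := by positivity
  have hdD : d ≤ 2 * L * D := by
    rw [hD, ← mul_div_assoc, le_div_iff₀ hη]
    nlinarith
  set U := sampleMean solve η j 1 i lam
  set U' := sampleMean solve η j 1 i lam'
  set Q := sampleMean solve η j 2 i lam
  set Q' := sampleMean solve η j 2 i lam'
  have hl := hlam i
  have a1 : |(lam' i - lam i) * (E.rate i - U')| ≤ d := by
    rw [abs_mul]
    calc _ ≤ d * 1 := mul_le_mul hl (abs_le.2 ⟨by linarith, by linarith⟩) (abs_nonneg _) hd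
      _ = d := mul_one d
  have a2 : |lam i * (U' - U)| ≤ 2 * L * D := by
    rw [abs_mul, abs_of_nonneg h0]
    exact mul_le_mul h1 hU (abs_nonneg _) (by positivity)
  have a3 : |(lam' i - lam i) * ((lam' i + lam i) * Q')| ≤ d * (4 * L) := by
    rw [abs_mul]
    refine mul_le_mul hl ?_ (abs_nonneg _) hd
    rw [abs_of_nonneg (by positivity)]
    calc _ ≤ (4 * L) * 1 := mul_le_mul (by linarith) hQ1 hQ0 (by positivity)
      _ = 4 * L := mul_one _
  have a4 : |lam i ^ 2 * (Q' - Q)| ≤ (2 * L) ^ 2 * D := by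
    rw [abs_mul, abs_of_nonneg (sq_nonneg _)]
    exact mul_le_mul (pow_le_pow_left₀ h0 h1 2) hQ (abs_nonneg _) (by positivity)
  have e : lam' i * (E.rate i - U') - 1 / (144 * L) * (lam' i ^ 2 * Q') - 11 * β -
      (lam i * (E.rate i - U) - 1 / (144 * L) * (lam i ^ 2 * Q) - 11 * β) =
      (lam' i - lam i) * (E.rate i - U') - lam i * (U' - U) -
      1 / (144 * L) * ((lam' i - lam i) * ((lam' i + lam i) * Q') + lam i ^ 2 * (Q' - Q)) := by
    ring
  rw [e]
  have a5 : |1 / (144 * L) * ((lam' i - lam i) * ((lam' i + lam i) * Q') + lam i ^ 2 * (Q' - Q))| ≤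
      1 / (144 * L) * (d * (4 * L) + (2 * L) ^ 2 * D) := by
    rw [abs_mul, abs_of_nonneg (by positivity : 0 ≤ 1 / (144 * L))]
    exact mul_le_mul_of_nonneg_left ((abs_add_le _ _).trans (add_le_add a3 a4)) (by positivity)
  have e2 : 1 / (144 * L) * (d * (4 * L) + (2 * L) ^ 2 * D) = d / 36 + L * D / 36 := by
    field_simp
    ring
  rw [e2] at a5
  refine (abs_sub _ _).trans ?_
  refine (add_le_add (abs_sub _ _) a5).trans ?_
  have hLD : 0 ≤ L * D := by positivity
  linarith

/-- Some grid point has a small excess in every coordinate that may vary. -/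
theorem IsSolver.exists_gridPrice (h : E.IsSolver solve) (hL : 0 < E.maxBid) {η β : ℝ}
    (hη : 0 < η) (hβ : 0 < β) (hηL : η ≤ n * (2 * E.maxBid)) {K : ℕ} (hK0 : 0 < K)
    (hK : 3 * n * (2 * E.maxBid) ^ 2 / (η * β) ≤ K) {t : ℕ} (j : Fin t → ι) :
    ∃ y : Fin n → ℕ, (∀ i, y i < K) ∧ ∀ i, 11 * β ≤ 2 * E.maxBid * E.rate i →
      |E.excess solve η β j (gridPrice (2 * E.maxBid) K
        (fun i => 2 * E.maxBid * E.rate i < 11 * β) y) i| ≤ β := by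
  set B := 2 * E.maxBid with hB
  have hB0 : 0 < B := by positivity
  set A : Fin n → Prop := fun i => B * E.rate i < 11 * β with hA
  have hK' : (0 : ℝ) < K := Nat.cast_pos.2 hK0
  -- The label says that the price of network i is high enough. For networks in A, whose price is
  -- fixed, it only separates the two faces.
  let l : Fin n → (Fin n → ℕ) → Prop := fun i y => y i ≠ 0 ∧
    (¬A i → y i ≤ K → 0 ≤ E.excess solve η β j (gridPrice B K A y) i)
  have hlK : ∀ i y, y i = K → l i y := by
    intro i y hyi
    refine ⟨by omega, fun hiA _ => ?_⟩
    -- On the far face the price 2L exceeds every bid, so network i is not used and its excess is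
    -- 2Lρ_i - 11β ≥ 0.
    have hz : gridPrice B K A y i = B := by
      simp only [gridPrice, hiA, if_false, hyi]
      field_simp
    have hzero : ∀ p, p ≠ 0 → sampleMean solve η j p i (gridPrice B K A y) = 0 := by
      intro p hp
      unfold sampleMean
      rw [Finset.sum_eq_zero, zero_div]
      intro s _
      exact h.avgUse_eq_zero hη hp (by rw [hz]; linarith) _
    unfold excess
    rw [hzero 1 one_ne_zero, hzero 2 two_ne_zero, hz]
    have := not_lt.1 hiA
    linarith
  obtain ⟨y, hyK, hy⟩ := exists_cube_of_labels l (K := K) (fun i y h0 hl => hl.1 h0) hlK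
  refine ⟨y, hyK, fun i hi => ?_⟩
  have hiA : ¬A i := not_lt.2 hi
  obtain ⟨r, s, hr, hs, hlr, hls⟩ := hy i
  have hdist : ∀ r : Fin n → ℕ, (∀ k, y k ≤ r k ∧ r k ≤ y k + 1) →
      |E.excess solve η β j (gridPrice B K A r) i - E.excess solve η β j (gridPrice B K A y) i|
        ≤ β := by
    intro r hr
    have hm := gridPrice_mem hB0.le A (hyK i).le
    have hm' := gridPrice_mem hB0.le A (show r i ≤ K by have := hr i; have := hyK i; omega)
    refine (h.abs_excess_sub_le hL (β := β) hη j i (d := B / K) (by positivity) hm.1 hm.2 hm'.1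
      hm'.2 (fun k => abs_gridPrice_sub_le hB0.le A (hr k)) hηL).trans ?_
    rw [← hB]
    -- The lower bound on K is chosen so that the excess varies by at most β within a grid cube.
    have e : 3 * B * (n * (B / K) / η) = 3 * n * B ^ 2 / (η * β) * (β / K) := by
      field_simp
    rw [e]
    calc _ ≤ (K : ℝ) * (β / K) := mul_le_mul_of_nonneg_right hK (by positivity)
      _ = β := by field_simp
  have h1 := hlr.2 hiA (by have := hr i; have := hyK i; omega)
  have h2 := abs_le.1 (hdist r hr)
  have h3 := abs_le.1 (hdist s hs)
  have h4 : E.excess solve η β j (gridPrice B K A s) i ≤ β +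
      E.excess solve η β j (gridPrice B K A y) i := by linarith
  rw [abs_le]
  refine ⟨by linarith, ?_⟩
  -- Either way the excess at s is negative, at price 0 being -11β, so the excess at y is at most β.
  by_cases hs0 : s i = 0
  · have hz : gridPrice B K A s i = 0 := by simp [gridPrice, hiA, hs0]
    have : E.excess solve η β j (gridPrice B K A s) i = -(11 * β) := by
      unfold excess; rw [hz]; ring
    linarith
  · have : ¬(0 ≤ E.excess solve η β j (gridPrice B K A s) i) := fun hn =>
      hls ⟨hs0, fun _ _ => hn⟩
    linarith

end Exchange

/-! ### Exponential moments -/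

theorem exp_le_one_add_add_sq {x : ℝ} (hx : |x| ≤ 1) : Real.exp x ≤ 1 + x + x ^ 2 := by
  have := Real.abs_exp_sub_one_sub_id_le hx
  linarith [(abs_le.1 this).2]

section ExpMoment

variable {S : Type*} [MeasurableSpace S] {μ : Measure S} [IsProbabilityMeasure μ] {Y : S → ℝ}

theorem integrable_exp_of_le {f : S → ℝ} (hf : Measurable f) {C : ℝ} (hC : ∀ s, f s ≤ C) :
    Integrable (fun s => Real.exp (f s)) μ :=
  Integrable.of_bound (Real.measurable_exp.comp hf).aestronglyMeasurable (Real.exp C)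
    (Filter.Eventually.of_forall fun s => by
      rw [Real.norm_eq_abs, Real.abs_exp]; exact Real.exp_le_exp.2 (hC s))

/-- A Bernstein-type bound from exp x ≤ 1 + x + x² for |x| ≤ 1. The compensation r²Q involves the
second moment, as needed for a margin proportional to Q. -/
theorem integral_exp_centered_le (hY : Measurable Y) (h0 : ∀ s, 0 ≤ Y s) (h1 : ∀ s, Y s ≤ 1)
    {Q r : ℝ} (hQ : ∫ s, Y s ^ 2 ∂μ ≤ Q) (hr : |r| ≤ 1) :
    ∫ s, Real.exp (r * (Y s - ∫ s, Y s ∂μ) - r ^ 2 * Q) ∂μ ≤ 1 := by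
  set U := ∫ s, Y s ∂μ with hU
  have hi : Integrable Y μ := integrable_of_mem_unit hY h0 h1
  have hi2 : Integrable (fun s => Y s ^ 2) μ := integrable_of_mem_unit (hY.pow_const 2)
    (fun s => sq_nonneg _) fun s => pow_le_one₀ (h0 s) (h1 s)
  have hle : ∀ s, Real.exp (r * Y s) ≤ 1 + r * Y s + r ^ 2 * Y s ^ 2 := by
    intro s
    have := exp_le_one_add_add_sq (x := r * Y s) (by
      rw [abs_mul, abs_of_nonneg (h0 s)]
      exact mul_le_one₀ hr (h0 s) (h1 s))
    rwa [mul_pow] at this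
  have hexp : Integrable (fun s => Real.exp (r * Y s)) μ :=
    integrable_exp_of_le (hY.const_mul r) (C := 1) fun s => by
      calc r * Y s ≤ |r * Y s| := le_abs_self _
        _ ≤ 1 := by
          rw [abs_mul, abs_of_nonneg (h0 s)]
          exact mul_le_one₀ hr (h0 s) (h1 s)
  have hi3 : Integrable (fun s => 1 + r * Y s) μ := (integrable_const _).add (hi.const_mul r)
  have h2 : ∫ s, Real.exp (r * Y s) ∂μ ≤ 1 + r * U + r ^ 2 * Q := by
    refine (integral_mono hexp (hi3.add (hi2.const_mul _)) hle).trans ?_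
    rw [integral_add' hi3 (hi2.const_mul _), integral_add (integrable_const _) (hi.const_mul r),
      integral_const_mul, integral_const_mul]
    simp only [integral_const, probReal_univ, one_smul]
    have := mul_le_mul_of_nonneg_left hQ (sq_nonneg r)
    linarith
  have e : ∀ s, Real.exp (r * (Y s - U) - r ^ 2 * Q) =
      Real.exp (-(r * U + r ^ 2 * Q)) * Real.exp (r * Y s) := by
    intro s; rw [← Real.exp_add]; congr 1; ring
  simp only [e]
  rw [integral_const_mul, Real.exp_neg, inv_mul_le_iff₀ (Real.exp_pos _), mul_one]
  refine h2.trans ?_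
  have := Real.add_one_le_exp (r * U + r ^ 2 * Q)
  linarith

/-- A multiplicative Chernoff bound: by exp(-Y) ≤ 1 - Y/2 on [0, 1], the sample average is unlikely
to fall far below half the mean. -/
theorem integral_exp_half_sub_le (hY : Measurable Y) (h0 : ∀ s, 0 ≤ Y s) (h1 : ∀ s, Y s ≤ 1) :
    ∫ s, Real.exp ((∫ s, Y s ∂μ) / 2 - Y s) ∂μ ≤ 1 := by
  set Q := ∫ s, Y s ∂μ with hQ
  have hi : Integrable Y μ := integrable_of_mem_unit hY h0 h1
  have hle : ∀ s, Real.exp (-Y s) ≤ 1 - 1 / 2 * Y s := by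
    intro s
    rw [Real.exp_neg, inv_le_iff_one_le_mul₀ (Real.exp_pos _)]
    have := Real.add_one_le_exp (Y s)
    nlinarith [h0 s, h1 s]
  have hexp : Integrable (fun s => Real.exp (-Y s)) μ :=
    integrable_exp_of_le hY.neg (C := 0) fun s => neg_nonpos.2 (h0 s)
  have h2 : ∫ s, Real.exp (-Y s) ∂μ ≤ 1 - 1 / 2 * Q := by
    refine (integral_mono hexp ((integrable_const _).sub (hi.const_mul _)) hle).trans ?_
    rw [integral_sub' (integrable_const _) (hi.const_mul _), integral_const_mul]
    simp [hQ]
  have e : ∀ s, Real.exp (Q / 2 - Y s) = Real.exp (Q / 2) * Real.exp (-Y s) := by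
    intro s; rw [← Real.exp_add]; congr 1
  simp only [e]
  rw [integral_const_mul, ← Real.exp_zero, ← sub_self (Q / 2), sub_eq_add_neg, Real.exp_add]
  refine mul_le_mul_of_nonneg_left (h2.trans ?_) (Real.exp_pos _).le
  have := Real.add_one_le_exp (-(Q / 2))
  linarith

/-- The opposite multiplicative bound, from exp Y ≤ 1 + 2Y on [0, 1]. Together they let the margin
be computed from the sampled second moment. -/
theorem integral_exp_sub_two_mul_le (hY : Measurable Y) (h0 : ∀ s, 0 ≤ Y s) (h1 : ∀ s, Y s ≤ 1) :
    ∫ s, Real.exp (Y s - 2 * ∫ s, Y s ∂μ) ∂μ ≤ 1 := by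
  set Q := ∫ s, Y s ∂μ with hQ
  have hi : Integrable Y μ := integrable_of_mem_unit hY h0 h1
  have hle : ∀ s, Real.exp (Y s) ≤ 1 + 2 * Y s := by
    intro s
    have := exp_le_one_add_add_sq (x := Y s) (by rw [abs_of_nonneg (h0 s)]; exact h1 s)
    nlinarith [h0 s, h1 s]
  have hexp : Integrable (fun s => Real.exp (Y s)) μ := integrable_exp_of_le hY h1
  have h2 : ∫ s, Real.exp (Y s) ∂μ ≤ 1 + 2 * Q := by
    refine (integral_mono hexp ((integrable_const _).add (hi.const_mul _)) hle).trans ?_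
    rw [integral_add' (integrable_const _) (hi.const_mul _), integral_const_mul]
    simp [hQ]
  have e : ∀ s, Real.exp (Y s - 2 * Q) = Real.exp (-(2 * Q)) * Real.exp (Y s) := by
    intro s; rw [← Real.exp_add]; congr 1; ring
  simp only [e]
  rw [integral_const_mul, Real.exp_neg, inv_mul_le_iff₀ (Real.exp_pos _), mul_one]
  refine h2.trans ?_
  have := Real.add_one_le_exp (2 * Q)
  linarith

/-- The exponential weight of the event that the sum of `f` over a list exceeds `τ`. -/
noncomputable def expWeight (f : S → ℝ) (τ : ℝ) (e : List S) : ℝ :=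
  Real.exp (-τ) * (e.map fun s => Real.exp (f s)).prod

theorem prod_map_exp (f : S → ℝ) (e : List S) :
    (e.map fun s => Real.exp (f s)).prod = Real.exp (e.map f).sum := by
  induction e with
  | nil => simp
  | cons s e ih => simp [ih, Real.exp_add]

theorem expWeight_nonneg (f : S → ℝ) (τ : ℝ) (e : List S) : 0 ≤ expWeight f τ e := by
  rw [expWeight, prod_map_exp]; positivity

theorem sum_lt_of_expWeight_lt_one {f : S → ℝ} {τ : ℝ} {e : List S} (h : expWeight f τ e < 1) :
    (e.map f).sum < τ := by
  rw [expWeight, prod_map_exp, ← Real.exp_add, Real.exp_lt_one_iff] at h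
  linarith

theorem tame_expWeight {f : S → ℝ} (hf : Measurable f) {C : ℝ} (hC : ∀ s, f s ≤ C) (τ : ℝ) :
    Tame (expWeight f τ) :=
  (Tame.prod_map (Real.measurable_exp.comp hf) (C := Real.exp C) fun s => by
    rw [Function.comp_apply, Real.abs_exp]; exact Real.exp_le_exp.2 (hC s)).const_mul _

/-- Markov's inequality in a form suited to union bounds: independence turns the expectation into a
power of a number at most 1. -/
theorem listExp_expWeight_le {f : S → ℝ} (hf : ∫ s, Real.exp (f s) ∂μ ≤ 1) (τ : ℝ) (k : ℕ) :
    listExp μ k (expWeight f τ) ≤ Real.exp (-τ) := by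
  unfold expWeight
  rw [listExp_const_mul, listExp_prod_map]
  exact mul_le_of_le_one_right (Real.exp_pos _).le
    (pow_le_one₀ (integral_nonneg fun s => (Real.exp_pos _).le) hf)

end ExpMoment

namespace Exchange

variable {n M : ℕ} {ι : Type} {E : Exchange n M ι} [Fintype ι] [MeasurableSpace ι]
  [MeasurableSingletonClass ι] {solve solve' : ι → (Fin n → ℝ) → Fin n → ℝ} {q : ι → ℝ} {η : ℝ}

/-! ### Deviations of sample averages -/

theorem integral_perturb {G : (Fin n → unitInterval) → ℝ} (hG : Measurable G) :
    ∫ z : Fin n → unitInterval × unitInterval, G (fun i => (z i).1) = ∫ u, G u := by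
  have hp : MeasurePreserving (fun (z : Fin n → unitInterval × unitInterval) i => (z i).1)
      (Measure.pi fun _ => (volume : Measure unitInterval).prod volume) (Measure.pi fun _ => volume) :=
    measurePreserving_pi _ _ fun _ => measurePreserving_fst
  change _ = ∫ u, G u ∂(Measure.pi fun _ => volume)
  rw [← hp.map_eq, integral_map hp.measurable.aemeasurable hG.aestronglyMeasurable]
  rfl

theorem integral_stepLaw_impression (hq : q ∈ stdSimplex ℝ ι) (g : ι → ℝ) :
    ∫ s, g s.2.1 ∂(E.stepLaw q) = ∑ j, q j * g j := by
  have := E.isProbabilityMeasure_stepLaw hq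
  have hm : Measurable fun s : E.Step => g s.2.1 :=
    (measurable_of_countable g).comp (measurable_fst.comp measurable_snd)
  have hi : Integrable (fun s : E.Step => g s.2.1) (E.stepLaw q) :=
    Integrable.of_bound hm.aestronglyMeasurable (∑ j, |g j|) (Filter.Eventually.of_forall fun s =>
      Finset.single_le_sum (f := fun j => |g j|) (fun _ _ => abs_nonneg _) (Finset.mem_univ _))
  rw [E.integral_stepLaw hq hi, ← E.sum_arrivalProb_mul]
  simp

/-- The probability with which network `i` is called out in a step at prices `lam`. -/
def stepUse (solve : ι → (Fin n → ℝ) → Fin n → ℝ) (η : ℝ) (i : Fin n) (lam : Fin n → ℝ)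
    (s : E.Step) : ℝ := solve s.2.1 (lam + Step.shift η s) i

theorem IsSolver.measurable_stepUse (h : E.IsSolver solve) (η : ℝ) (i : Fin n) (lam : Fin n → ℝ) :
    Measurable (stepUse (E := E) solve η i lam) :=
  (measurable_pi_apply i).comp ((h.measurable_price η).comp (measurable_const.prodMk measurable_id))

theorem IsSolver.integral_stepUse_pow (h : E.IsSolver solve) (hq : q ∈ stdSimplex ℝ ι) (p : ℕ)
    (i : Fin n) (lam : Fin n → ℝ) :
    ∫ s, stepUse (E := E) solve η i lam s ^ p ∂(E.stepLaw q) = meanUse solve η q p i lam := by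
  have := E.isProbabilityMeasure_stepLaw hq
  rw [E.integral_stepLaw hq (integrable_of_mem_unit ((h.measurable_stepUse η i lam).pow_const p)
    (fun s => pow_nonneg (h.nonneg _ _ _) _)
    fun s => pow_le_one₀ (h.nonneg _ _ _) (h.le_one _ _ _)), meanUse, ← E.sum_arrivalProb_mul]
  refine Finset.sum_congr rfl fun a _ => ?_
  congr 1
  exact integral_perturb (G := fun u => solve a.1 (lam + cubePoint η u) i ^ p)
    (((h.measurable_apply a.1 i).comp ((measurable_cubePoint η).const_add lam)).pow_const p)

theorem IsSolver.integral_avgUse (hq : q ∈ stdSimplex ℝ ι) (p : ℕ) (i : Fin n)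
    (lam : Fin n → ℝ) :
    ∫ s, avgUse solve η p i lam s.2.1 ∂(E.stepLaw q) = meanUse solve η q p i lam :=
  integral_stepLaw_impression hq _

theorem IsSolver.meanUse_nonneg (h : E.IsSolver solve) (hq : q ∈ stdSimplex ℝ ι) (p : ℕ)
    (i : Fin n) (lam : Fin n → ℝ) : 0 ≤ meanUse solve η q p i lam :=
  Finset.sum_nonneg fun j _ => mul_nonneg (hq.1 j) (h.avgUse_nonneg _ _ _ _ _)

theorem IsSolver.meanUse_le_one (h : E.IsSolver solve) (hq : q ∈ stdSimplex ℝ ι) (p : ℕ)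
    (i : Fin n) (lam : Fin n → ℝ) : meanUse solve η q p i lam ≤ 1 := by
  rw [← hq.2]
  exact Finset.sum_le_sum fun j _ => mul_le_of_le_one_right (hq.1 j) (h.avgUse_le_one _ _ _ _ _)

theorem IsSolver.meanUse_eq (h : E.IsSolver solve) (h' : E.IsSolver solve') (hη : 0 < η) (p : ℕ)
    (i : Fin n) (lam : Fin n → ℝ) : meanUse solve η q p i lam = meanUse solve' η q p i lam :=
  Finset.sum_congr rfl fun j _ => by rw [h.avgUse_eq h' hη]

/-- The deviations of sample averages from their expectations that must be controlled for network
`i` at prices `lam`, with rate `r` of the exponential moments. -/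
noncomputable def deviation (solve : ι → (Fin n → ℝ) → Fin n → ℝ) (η : ℝ) (q : ι → ℝ) (r : ℝ)
    (i : Fin n) (lam : Fin n → ℝ) (s : E.Step) : Fin 5 → ℝ
  | 0 => r * (avgUse solve η 1 i lam s.2.1 - meanUse solve η q 1 i lam) -
      r ^ 2 * meanUse solve η q 2 i lam
  | 1 => -r * (avgUse solve η 1 i lam s.2.1 - meanUse solve η q 1 i lam) -
      (-r) ^ 2 * meanUse solve η q 2 i lam
  | 2 => r * (stepUse solve η i lam s - meanUse solve η q 1 i lam) -
      r ^ 2 * meanUse solve η q 2 i lam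
  | 3 => meanUse solve η q 2 i lam / 2 - avgUse solve η 2 i lam s.2.1
  | 4 => avgUse solve η 2 i lam s.2.1 - 2 * meanUse solve η q 2 i lam

section Deviation

variable {r : ℝ} (i : Fin n) (lam : Fin n → ℝ)

theorem measurable_avgUse_impression (p : ℕ) :
    Measurable fun s : E.Step => avgUse solve η p i lam s.2.1 :=
  (measurable_of_countable fun j => avgUse solve η p i lam j).comp
    (measurable_fst.comp measurable_snd)

theorem IsSolver.measurable_deviation (h : E.IsSolver solve) (k : Fin 5) :
    Measurable fun s : E.Step => deviation solve η q r i lam s k := by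
  have h1 := measurable_avgUse_impression (E := E) (solve := solve) (η := η) i lam 1
  have h2 := measurable_avgUse_impression (E := E) (solve := solve) (η := η) i lam 2
  have h3 := h.measurable_stepUse η i lam
  fin_cases k
  · exact ((h1.sub_const _).const_mul _).sub_const _
  · exact ((h1.sub_const _).const_mul _).sub_const _
  · exact ((h3.sub_const _).const_mul _).sub_const _
  · exact h2.const_sub _
  · exact h2.sub_const _

theorem mul_sub_le_one {r a b : ℝ} (hr : |r| ≤ 1) (ha0 : 0 ≤ a) (ha1 : a ≤ 1) (hb0 : 0 ≤ b)
    (hb1 : b ≤ 1) : r * (a - b) ≤ 1 := by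
  calc r * (a - b) ≤ |r * (a - b)| := le_abs_self _
    _ ≤ 1 := by
      rw [abs_mul]
      exact mul_le_one₀ hr (abs_nonneg _) (abs_le.2 ⟨by linarith, by linarith⟩)

theorem IsSolver.deviation_le (h : E.IsSolver solve) (hq : q ∈ stdSimplex ℝ ι) (hr : |r| ≤ 1) (k : Fin 5) (s : E.Step) :
    deviation solve η q r i lam s k ≤ 1 := by
  have a0 := h.avgUse_nonneg η 1 i lam s.2.1
  have a1 := h.avgUse_le_one η 1 i lam s.2.1
  have b0 := h.avgUse_nonneg η 2 i lam s.2.1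
  have b1 := h.avgUse_le_one η 2 i lam s.2.1
  have c0 := h.meanUse_nonneg (η := η) hq 1 i lam
  have c1 := h.meanUse_le_one (η := η) hq 1 i lam
  have d0 := h.meanUse_nonneg (η := η) hq 2 i lam
  have d1 := h.meanUse_le_one (η := η) hq 2 i lam
  have e0 : 0 ≤ stepUse solve η i lam s := h.nonneg _ _ _
  have e1 : stepUse solve η i lam s ≤ 1 := h.le_one _ _ _
  have hsq := mul_nonneg (sq_nonneg r) d0
  have hsq' := mul_nonneg (sq_nonneg (-r)) d0
  fin_cases k
  · have := mul_sub_le_one hr a0 a1 c0 c1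
    change _ - _ ≤ _; linarith
  · have := mul_sub_le_one (r := -r) (by rwa [abs_neg]) a0 a1 c0 c1
    change _ - _ ≤ _; linarith
  · have := mul_sub_le_one hr e0 e1 c0 c1
    change _ - _ ≤ _; linarith
  · change _ / 2 - _ ≤ _; linarith
  · change _ - 2 * _ ≤ _; linarith

theorem IsSolver.integral_exp_deviation_le (h : E.IsSolver solve) (hq : q ∈ stdSimplex ℝ ι)
    (hr : |r| ≤ 1) (k : Fin 5) :
    ∫ s : E.Step, Real.exp (deviation solve η q r i lam s k) ∂(E.stepLaw q) ≤ 1 := by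
  have := E.isProbabilityMeasure_stepLaw hq
  have m1 := measurable_avgUse_impression (E := E) (solve := solve) (η := η) i lam 1
  have m2 := measurable_avgUse_impression (E := E) (solve := solve) (η := η) i lam 2
  have i1 := IsSolver.integral_avgUse (E := E) (solve := solve) (η := η) hq 1 i lam
  have i2 := IsSolver.integral_avgUse (E := E) (solve := solve) (η := η) hq 2 i lam
  have i3 := h.integral_stepUse_pow (η := η) hq 1 i lam
  have i4 := h.integral_stepUse_pow (η := η) hq 2 i lam
  simp only [pow_one] at i3
  -- Averaging over the perturbation lowers second moments, so Q also serves as variance bound for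
  -- the averaged use.
  have hsq : ∫ s : E.Step, avgUse solve η 1 i lam s.2.1 ^ 2 ∂(E.stepLaw q) ≤
      meanUse solve η q 2 i lam := by
    rw [integral_stepLaw_impression hq fun j => avgUse solve η 1 i lam j ^ 2]
    exact Finset.sum_le_sum fun j _ => mul_le_mul_of_nonneg_left
      (h.avgUse_one_sq_le η i lam j) (hq.1 j)
  fin_cases k
  · have := integral_exp_centered_le m1 (fun s => h.avgUse_nonneg _ _ _ _ _)
      (fun s => h.avgUse_le_one _ _ _ _ _) hsq hr
    rwa [i1] at this
  · have := integral_exp_centered_le m1 (fun s => h.avgUse_nonneg _ _ _ _ _)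
      (fun s => h.avgUse_le_one _ _ _ _ _) hsq (r := -r) (by rwa [abs_neg])
    rwa [i1] at this
  · have := integral_exp_centered_le (h.measurable_stepUse η i lam) (fun s => h.nonneg _ _ _)
      (fun s => h.le_one _ _ _) i4.le hr
    rwa [i3] at this
  · have := integral_exp_half_sub_le (μ := E.stepLaw q) m2 (fun s => h.avgUse_nonneg _ _ _ _ _)
      (fun s => h.avgUse_le_one _ _ _ _ _)
    rwa [i2] at this
  · have := integral_exp_sub_two_mul_le (μ := E.stepLaw q) m2 (fun s => h.avgUse_nonneg _ _ _ _ _)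
      (fun s => h.avgUse_le_one _ _ _ _ _)
    rwa [i2] at this

end Deviation

end Exchange

namespace Exchange

variable {n M : ℕ} {ι : Type} {E : Exchange n M ι}

/-! ### Learned multipliers respect the budgets -/

/-- In units A = λ²Q/(576L), and A' for the sampled Q', deviations of use cost at most A + β, while
the margin is 4A' + 11β up to β and A' lies between A/2 and 2A up to β/2. The lower side leaves λ(ρ
- U) ≥ A + 7β, enough also for the use R with the actual perturbations; the upper side gives at most
9A + 15β, and 9A = λ²Q/(64L). -/
theorem budget_of_small_deviations {lam L β τ T r U Q U' Q' R ρ : ℝ} (hL : 0 < L) (hβ : 0 < β)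
    (hT : 0 < T) (hτ : 576 * L * τ ≤ β * T) (h0 : 0 ≤ lam) (h1 : lam ≤ 2 * L)
    (hr : r = lam / (576 * L)) (hQ : 0 ≤ Q)
    (e0 : T * (r * (U' - U) - r ^ 2 * Q) ≤ τ) (e1 : T * (-r * (U' - U) - (-r) ^ 2 * Q) ≤ τ)
    (e2 : T * (r * (R - U) - r ^ 2 * Q) ≤ τ) (e3 : T * (Q / 2 - Q') ≤ τ)
    (e4 : T * (Q' - 2 * Q) ≤ τ)
    (hχ : |lam * (ρ - U') - 1 / (144 * L) * (lam ^ 2 * Q') - 11 * β| ≤ β) :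
    U ≤ ρ ∧ R ≤ ρ ∧ lam * (ρ - U) ≤ 1 / (64 * L) * (lam ^ 2 * Q) + 17 * β := by
  set A := lam ^ 2 * Q / (576 * L) with hA
  set A' := lam ^ 2 * Q' / (576 * L) with hA'
  have hκ : ∀ {x : ℝ}, T * x ≤ τ → 576 * L * x ≤ β := by
    intro x hx
    have : T * (576 * L * x) ≤ T * β := by nlinarith
    exact le_of_mul_le_mul_left this hT
  have hA0 : 0 ≤ A := by positivity
  have f0 : lam * (U' - U) - A ≤ β := by
    refine le_trans (le_of_eq ?_) (hκ e0)
    rw [hr, hA]; field_simp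
  have f1 : -(lam * (U' - U)) - A ≤ β := by
    refine le_trans (le_of_eq ?_) (hκ e1)
    rw [hr, hA]; field_simp
  have f2 : lam * (R - U) - A ≤ β := by
    refine le_trans (le_of_eq ?_) (hκ e2)
    rw [hr, hA]; field_simp
  have hsmall : ∀ {x : ℝ}, T * x ≤ τ → lam ^ 2 * x / (576 * L) ≤ β / 2 := by
    intro x hx
    have h2 := hκ hx
    rcases le_or_gt x 0 with hx0 | hx0
    · have : lam ^ 2 * x / (576 * L) ≤ 0 :=
        div_nonpos_of_nonpos_of_nonneg (mul_nonpos_of_nonneg_of_nonpos (sq_nonneg _) hx0)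
          (by positivity)
      linarith
    · rw [div_le_iff₀ (by positivity)]
      have h3 : lam ^ 2 ≤ (2 * L) ^ 2 := pow_le_pow_left₀ h0 h1 2
      have h4 : lam ^ 2 * x ≤ (2 * L) ^ 2 * x := mul_le_mul_of_nonneg_right h3 hx0.le
      have h5 : L * (576 * L * x) ≤ L * β := mul_le_mul_of_nonneg_left h2 hL.le
      nlinarith [mul_pos hL hβ]
  have f3 : A / 2 - A' ≤ β / 2 := by
    refine le_trans (le_of_eq ?_) (hsmall e3)
    rw [hA, hA']; ring
  have f4 : A' - 2 * A ≤ β / 2 := by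
    refine le_trans (le_of_eq ?_) (hsmall e4)
    rw [hA, hA']; ring
  have g1 : 1 / (144 * L) * (lam ^ 2 * Q') = 4 * A' := by rw [hA']; field_simp; ring
  have g2 : 1 / (64 * L) * (lam ^ 2 * Q) = 9 * A := by rw [hA]; field_simp; ring
  rw [g1] at hχ
  rw [g2]
  obtain ⟨c1, c2⟩ := abs_le.1 hχ
  -- At price 0 the excess would be -11β, which is not within β of zero.
  have hlam : 0 < lam := by
    rcases h0.eq_or_lt with hz | hz
    · have : A' = 0 := by rw [hA', ← hz]; simp
      rw [← hz, this] at c1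
      linarith
    · exact hz
  refine ⟨?_, ?_, ?_⟩
  · have : lam * U ≤ lam * ρ := by nlinarith
    exact le_of_mul_le_mul_left this hlam
  · have : lam * R ≤ lam * ρ := by nlinarith
    exact le_of_mul_le_mul_left this hlam
  · nlinarith

variable {solve solve' : ι → (Fin n → ℝ) → Fin n → ℝ} {η : ℝ} {t : ℕ}

theorem learned_reverse_ofFn {learn : E.Sample t → Fin n → ℝ} (ω : Fin t → E.Step) :
    E.learned t η learn (List.ofFn ω).reverse =
      learn fun s => ((ω s).2.1, Step.shift η (ω s)) := by
  unfold learned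
  rw [dif_pos (by simp)]
  congr 1
  ext1 s
  have : (List.ofFn ω).reverse.reverse[(s : ℕ)]'(by simp) = ω s := by
    simp only [List.reverse_reverse, List.getElem_ofFn]
  simp only [this]

theorem exists_reverse_ofFn {S : Type*} {e : List S} (he : e.length = t) :
    ∃ ω : Fin t → S, e = (List.ofFn ω).reverse := by
  subst he
  refine ⟨fun s => e.reverse.get (Fin.cast (by simp) s), ?_⟩
  rw [← List.reverse_inj, List.reverse_reverse]
  exact List.ext_getElem (by simp) fun k h1 h2 => by simp

theorem sum_map_reverse_ofFn {S : Type*} (f : S → ℝ) (ω : Fin t → S) :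
    ((List.ofFn ω).reverse.map f).sum = ∑ s, f (ω s) := by
  rw [List.map_reverse, List.sum_reverse, List.map_ofFn, List.sum_ofFn]
  rfl

theorem sum_sub_div_eq {t : ℕ} (ht : 0 < t) (a : Fin t → ℝ) (r U c : ℝ) :
    ∑ s, (r * (a s - U) - c) = t * (r * ((∑ s, a s) / t - U) - c) := by
  have : (t : ℝ) ≠ 0 := Nat.cast_ne_zero.2 ht.ne'
  rw [Finset.sum_sub_distrib, ← Finset.mul_sum, Finset.sum_sub_distrib]
  simp
  field_simp

theorem checkedPrice_nonneg {price : (Fin t → ι) → Fin n → ℝ} (hprice : ∀ j, 0 ≤ price j)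
    (σ : E.Sample t) : 0 ≤ E.checkedPrice solve price σ := by
  unfold checkedPrice
  split_ifs
  · exact hprice _
  · exact (isOptimalMultiplier_safePrice σ).1

theorem learned_nonneg {learn : E.Sample t → Fin n → ℝ} (hl : ∀ σ, 0 ≤ learn σ)
    (e : List E.Step) : 0 ≤ E.learned t η learn e := by
  unfold learned
  split_ifs
  · exact hl _
  · exact le_rfl

/-- The networks whose budget is too small to be worth a price below the maximum. -/
def smallBudget (E : Exchange n M ι) (β : ℝ) (i : Fin n) : Prop := 2 * E.maxBid * E.rate i < 11 * β

theorem abs_rate_le_one (hL : 0 < E.maxBid) {β : ℝ} {K : ℕ} {y : Fin n → ℕ}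
    (hy : ∀ i, y i < K) (i : Fin n) :
    |gridPrice (2 * E.maxBid) K (E.smallBudget β) y i / (576 * E.maxBid)| ≤ 1 := by
  have hm := gridPrice_mem (B := 2 * E.maxBid) (by positivity) (E.smallBudget β) (hy i).le
  rw [abs_of_nonneg (div_nonneg hm.1 (by positivity)), div_le_one (by positivity)]
  linarith [hm.2]

variable [Fintype ι] [MeasurableSpace ι] [MeasurableSingletonClass ι] {q : ι → ℝ}

/-- The total exponential weight of the deviations at all grid prices. -/
noncomputable def gridWeight (E : Exchange n M ι) (solve : ι → (Fin n → ℝ) → Fin n → ℝ) (η β : ℝ)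
    (K : ℕ) (q : ι → ℝ) (τ : ℝ) (e : List E.Step) : ℝ :=
  ∑ y ∈ Fintype.piFinset fun _ : Fin n => Finset.range K, ∑ i, ∑ k : Fin 5,
    expWeight (fun s => deviation solve η q
      (gridPrice (2 * E.maxBid) K (E.smallBudget β) y i / (576 * E.maxBid)) i
      (gridPrice (2 * E.maxBid) K (E.smallBudget β) y) s k) τ e

theorem IsSolver.tame_gridWeight (h : E.IsSolver solve) (hL : 0 < E.maxBid)
    (hq : q ∈ stdSimplex ℝ ι) (β : ℝ) (K : ℕ) (τ : ℝ) :
    Tame (E.gridWeight solve η β K q τ) :=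
  Tame.sum _ fun _ hy => Tame.sum _ fun i _ => Tame.sum _ fun k _ =>
    tame_expWeight (h.measurable_deviation i _ k) (C := 1) (fun s => h.deviation_le i _ hq
      (abs_rate_le_one hL (fun i => Finset.mem_range.1 (Fintype.mem_piFinset.1 hy i)) i) k s) τ

theorem IsSolver.listExp_gridWeight_le (h : E.IsSolver solve) (hL : 0 < E.maxBid)
    (hq : q ∈ stdSimplex ℝ ι) (β : ℝ) (K : ℕ) (τ : ℝ) (k : ℕ) :
    listExp (E.stepLaw q) k (E.gridWeight solve η β K q τ) ≤
      (K : ℝ) ^ n * (n * (5 * Real.exp (-τ))) := by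
  have := E.isProbabilityMeasure_stepLaw hq
  have hr : ∀ y ∈ Fintype.piFinset fun _ : Fin n => Finset.range K, ∀ i,
      |gridPrice (2 * E.maxBid) K (E.smallBudget β) y i / (576 * E.maxBid)| ≤ 1 := fun _ hy i =>
    abs_rate_le_one hL (fun i => Finset.mem_range.1 (Fintype.mem_piFinset.1 hy i)) i
  have ht : ∀ y ∈ Fintype.piFinset fun _ : Fin n => Finset.range K, ∀ (i : Fin n) (l : Fin 5),
      Tame (expWeight (fun s : E.Step => deviation solve η q
      (gridPrice (2 * E.maxBid) K (E.smallBudget β) y i / (576 * E.maxBid)) i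
      (gridPrice (2 * E.maxBid) K (E.smallBudget β) y) s l) τ) := fun y hy i l =>
    tame_expWeight (h.measurable_deviation i _ l) (C := 1)
      (fun s => h.deviation_le i _ hq (hr y hy i) l s) τ
  unfold gridWeight
  rw [listExp_sum _ fun y hy => Tame.sum _ fun i _ => Tame.sum _ fun l _ => ht y hy i l]
  have hy : ∀ y ∈ Fintype.piFinset fun _ : Fin n => Finset.range K,
      listExp (E.stepLaw q) k (fun e => ∑ i, ∑ l : Fin 5, expWeight (fun s => deviation solve η q
      (gridPrice (2 * E.maxBid) K (E.smallBudget β) y i / (576 * E.maxBid)) i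
      (gridPrice (2 * E.maxBid) K (E.smallBudget β) y) s l) τ e) ≤ n * (5 * Real.exp (-τ)) := by
    intro y hy
    rw [listExp_sum _ fun i _ => Tame.sum _ fun l _ => ht y hy i l]
    have : ∀ i ∈ Finset.univ, listExp (E.stepLaw q) k (fun e => ∑ l : Fin 5,
        expWeight (fun s => deviation solve η q
        (gridPrice (2 * E.maxBid) K (E.smallBudget β) y i / (576 * E.maxBid)) i
        (gridPrice (2 * E.maxBid) K (E.smallBudget β) y) s l) τ e) ≤ 5 * Real.exp (-τ) := by
      intro i _
      rw [listExp_sum _ fun l _ => ht y hy i l]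
      refine (Finset.sum_le_card_nsmul _ _ (Real.exp (-τ)) fun l _ =>
        listExp_expWeight_le (h.integral_exp_deviation_le i _ hq (hr y hy i) l) τ k).trans ?_
      simp
    refine (Finset.sum_le_card_nsmul _ _ _ this).trans ?_
    simp
  refine (Finset.sum_le_card_nsmul _ _ _ hy).trans ?_
  simp

/-- If the weight of the deviations is small then the learned multipliers respect all budgets,
and leave a part of each budget unused that costs little. -/
theorem IsSolver.learned_budget (h : E.IsSolver solve) (hL : 0 < E.maxBid) (hη : 0 < η) {β : ℝ}
    (hβ : 0 < β) (hq : q ∈ stdSimplex ℝ ι) (ht : 0 < t) {τ : ℝ}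
    (hτ : 576 * E.maxBid * τ ≤ β * t) {K : ℕ} {pick : (Fin t → ι) → Fin n → ℕ}
    (hpick : ∀ j, (∀ i, pick j i < K) ∧ ∀ i, 11 * β ≤ 2 * E.maxBid * E.rate i →
      |E.excess solve η β j (gridPrice (2 * E.maxBid) K (E.smallBudget β) (pick j)) i| ≤ β)
    {e : List E.Step} (he : e.length = t) (hw : E.gridWeight solve η β K q τ e < 1)
    {lam : Fin n → ℝ}
    (hlam : lam = E.learned t η (E.checkedPrice solve
      fun j => gridPrice (2 * E.maxBid) K (E.smallBudget β) (pick j)) e) (i : Fin n) :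
    meanUse solve η q 1 i lam ≤ E.rate i ∧
      lam i * (E.rate i - meanUse solve η q 1 i lam) ≤
        1 / (64 * E.maxBid) * (lam i ^ 2 * meanUse solve η q 2 i lam) + 17 * β := by
  have hT : (0 : ℝ) < t := Nat.cast_pos.2 ht
  obtain ⟨ω, rfl⟩ := exists_reverse_ofFn he
  set j : Fin t → ι := fun s => (ω s).2.1 with hj
  set p : Fin n → ℝ := gridPrice (2 * E.maxBid) K (E.smallBudget β) (pick j) with hp
  obtain ⟨hyK, hex⟩ := hpick j
  have hmem : ∀ i, 0 ≤ p i ∧ p i ≤ 2 * E.maxBid := fun i =>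
    gridPrice_mem (by positivity) _ (hyK i).le
  have hdev : ∀ i (k : Fin 5), ∑ s, deviation solve η q (p i / (576 * E.maxBid)) i p (ω s) k ≤
      τ := by
    intro i k
    rw [← sum_map_reverse_ofFn (fun s : E.Step =>
      deviation solve η q (p i / (576 * E.maxBid)) i p s k)]
    -- The weight of this deviation at this grid price is one summand of a total below 1. Since all
    -- grid prices are included, the dependence of the chosen price on the sample is harmless.
    refine (sum_lt_of_expWeight_lt_one (lt_of_le_of_lt ?_ hw)).le
    have hnn : ∀ y (i : Fin n) (k : Fin 5), 0 ≤ expWeight (fun s => deviation solve η q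
      (gridPrice (2 * E.maxBid) K (E.smallBudget β) y i / (576 * E.maxBid)) i
      (gridPrice (2 * E.maxBid) K (E.smallBudget β) y) s k) τ (List.ofFn ω).reverse :=
      fun y i k => expWeight_nonneg _ _ _
    unfold gridWeight
    refine le_trans ?_ (Finset.single_le_sum (fun y _ => Finset.sum_nonneg fun i _ =>
      Finset.sum_nonneg fun k _ => hnn y i k) (a := pick j) (Fintype.mem_piFinset.2 fun i =>
        Finset.mem_range.2 (hyK i)))
    refine le_trans ?_ (Finset.single_le_sum (fun i _ => Finset.sum_nonneg fun k _ =>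
      hnn (pick j) i k) (Finset.mem_univ i))
    exact Finset.single_le_sum (fun k _ => hnn (pick j) i k) (Finset.mem_univ k)
  have key : ∀ i, meanUse solve η q 1 i p ≤ E.rate i ∧
      sampledUse (E := E) solve p (fun s => (j s, Step.shift η (ω s))) i ≤ E.rate i ∧
      p i * (E.rate i - meanUse solve η q 1 i p) ≤
        1 / (64 * E.maxBid) * (p i ^ 2 * meanUse solve η q 2 i p) + 17 * β := by
    intro i
    -- A network with tiny budget is priced at 2L and never called out; its whole budget is wasted,
    -- but is worth less than 11β.
    by_cases hsmall : E.smallBudget β i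
    · have hpi : p i = 2 * E.maxBid := by simp [hp, gridPrice, hsmall]
      have hlt : E.maxBid < p i := by rw [hpi]; linarith
      have hz : ∀ k, k ≠ 0 → meanUse solve η q k i p = 0 := fun k hk =>
        Finset.sum_eq_zero fun j _ => by rw [h.avgUse_eq_zero hη hk hlt, mul_zero]
      have hR : sampledUse (E := E) solve p (fun s => (j s, Step.shift η (ω s))) i = 0 := by
        unfold sampledUse
        rw [Finset.sum_eq_zero, zero_div]
        intro s _
        refine ((h _).2 _).eq_zero (lt_of_lt_of_le hlt ?_)
        exact le_add_of_nonneg_right (mul_nonneg hη.le ((ω s).1 i).1.2.1)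
      rw [hz 1 one_ne_zero, hz 2 two_ne_zero, hR, hpi]
      have : 2 * E.maxBid * E.rate i < 11 * β := hsmall
      refine ⟨E.rate_nonneg i, E.rate_nonneg i, ?_⟩
      simp only [sub_zero, mul_zero, zero_add]
      linarith
    · have d0 := hdev i 0
      have d1 := hdev i 1
      have d2 := hdev i 2
      have d3 := hdev i 3
      have d4 := hdev i 4
      simp only [deviation] at d0 d1 d2 d3 d4
      rw [sum_sub_div_eq ht] at d0 d1 d2
      have s3 := sum_sub_div_eq ht (fun s => avgUse solve η 2 i p (ω s).2.1) (-1) 0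
        (-(meanUse solve η q 2 i p / 2))
      have s4 := sum_sub_div_eq ht (fun s => avgUse solve η 2 i p (ω s).2.1) 1 0
        (2 * meanUse solve η q 2 i p)
      refine budget_of_small_deviations hL hβ hT hτ (hmem i).1 (hmem i).2 rfl
        (h.meanUse_nonneg hq 2 i p) d0 d1 d2 ?_ ?_ (hex i (not_lt.1 hsmall))
      · refine le_trans (le_of_eq ?_) d3
        rw [Finset.sum_congr rfl fun s _ => show meanUse solve η q 2 i p / 2 -
          avgUse solve η 2 i p (ω s).2.1 = -1 * (avgUse solve η 2 i p (ω s).2.1 - 0) -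
          -(meanUse solve η q 2 i p / 2) by ring, s3]
        unfold sampleMean
        ring
      · refine le_trans (le_of_eq ?_) d4
        rw [Finset.sum_congr rfl fun s _ => show avgUse solve η 2 i p (ω s).2.1 -
          2 * meanUse solve η q 2 i p = 1 * (avgUse solve η 2 i p (ω s).2.1 - 0) -
          2 * meanUse solve η q 2 i p by ring, s4]
        unfold sampleMean
        ring
  -- The sampled use is within the rates, so the check succeeds and the safe prices are not used.
  have hlp : lam = p := by
    rw [hlam, learned_reverse_ofFn, checkedPrice, if_pos]
    exact fun i => (key i).2.1
  rw [hlp]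
  exact ⟨(key i).1, (key i).2.2⟩

end Exchange

namespace Exchange

variable {n M : ℕ} {ι : Type} {E : Exchange n M ι}

/-! ### The performance of LP-Val -/

theorem totalValue_nonneg (E : Exchange n M ι) (R : E.Rule) (as : List E.Arrival) :
    0 ≤ E.totalValue R as := by
  induction as with
  | nil => exact le_rfl
  | cons a as ih => exact add_nonneg (E.slotValue_nonneg _ _) ih

theorem value_nonneg [Fintype ι] {q : ι → ℝ} (hq : q ∈ stdSimplex ℝ ι) (m : ℕ) (P : E.Policy) :
    0 ≤ P.value q m :=
  integral_nonneg fun _ => div_nonneg (Finset.sum_nonneg fun _ _ => mul_nonneg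
    (Finset.prod_nonneg fun _ _ => mul_nonneg (hq.1 _)
      (Finset.prod_nonneg fun i _ => (E.prob_mem i _).1 _))
    (E.totalValue_nonneg _ _)) (Nat.cast_nonneg m)

theorem dualValue_maxBid_le [Fintype ι] (q : ι → ℝ) :
    E.dualValue q (fun _ => E.maxBid) ≤ n * E.maxBid := by
  unfold dualValue
  rw [Finset.sum_eq_zero fun j _ => by rw [lpValue_eq_zero fun _ => le_rfl, mul_zero], zero_add]
  refine (Finset.sum_le_card_nsmul _ _ E.maxBid fun i _ =>
    mul_le_of_le_one_right E.maxBid_nonneg (E.rate_le_one i)).trans ?_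
  simp

theorem value_zero [Fintype ι] (q : ι → ℝ) (P : E.Policy) : P.value q 0 = 0 := by
  simp [Policy.value, ruleValue]

variable {solve : ι → (Fin n → ℝ) → Fin n → ℝ} {η δ ε : ℝ} {t m : ℕ}

theorem three_fifths_le : (3 : ℝ) / 5 ≤ 1 - 1 / Real.exp 1 := by
  have h := Real.exp_one_gt_d9
  have : 1 / Real.exp 1 ≤ 2 / 5 := by
    rw [div_le_div_iff₀ (Real.exp_pos 1) (by norm_num)]
    linarith
  linarith

section

variable [Fintype ι] [MeasurableSpace ι] [MeasurableSingletonClass ι] {q : ι → ℝ}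

/-- Exploiting multipliers that respect all budgets and waste little of them. -/
theorem IsSolver.le_listExp_of_budget (h : E.IsSolver solve) (hL : 0 < E.maxBid) (hη : 0 < η)
    (hq : q ∈ stdSimplex ℝ ι) (hδ : 0 < δ) (hε : 0 < ε) (hε1 : ε < 1) {β : ℝ} {lam : Fin n → ℝ}
    (hl : 0 ≤ lam) (hb : ∀ i, meanUse solve η q 1 i lam ≤ E.rate i ∧
      lam i * (E.rate i - meanUse solve η q 1 i lam) ≤
        1 / (64 * E.maxBid) * (lam i ^ 2 * meanUse solve η q 2 i lam) + 17 * β)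
    (hηδ : n * η ≤ ε * δ / 20) (hβδ : n * β ≤ ε * δ / 200) {v : ℝ} (hv : δ ≤ v)
    (hvD : v ≤ E.dualValue q lam) (hm : 0 < m) (ht : (t : ℝ) ≤ ε / 100 * m)
    (hmL : 600 * (n * E.maxBid) ≤ ε ^ 2 * δ * m) :
    m * ((1 - 3 / 50 * ε) * ((1 - 1 / Real.exp 1) * v - 27 / 200 * (ε * δ)) - ε * δ / 100) ≤
      listExp (E.stepLaw q) (m - t)
        (E.exploitValue (E.lpWant solve η lam) (fun s => s.2.2) fun i => E.rate i * m) := by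
  have := E.isProbabilityMeasure_stepLaw hq
  have hm' : (0 : ℝ) < m := Nat.cast_pos.2 hm
  have htm : t ≤ m := by
    have : (t : ℝ) ≤ m := by nlinarith
    exact_mod_cast this
  have h1 := h.le_sum_expContribution hL hη hl hq
  have h2 : ∑ i, lam i * (E.rate i - meanUse solve η q 1 i lam) ≤
      1 / (64 * E.maxBid) * ∑ i, lam i ^ 2 * meanUse solve η q 2 i lam + 17 * (n * β) := by
    refine (Finset.sum_le_sum fun i _ => (hb i).2).trans (le_of_eq ?_)
    rw [Finset.sum_add_distrib, ← Finset.mul_sum]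
    simp
    ring
  have hS : 0 ≤ ∑ i, lam i ^ 2 * meanUse solve η q 2 i lam :=
    Finset.sum_nonneg fun i _ => mul_nonneg (sq_nonneg _) (h.meanUse_nonneg hq 2 i lam)
  set G := ∑ i, E.expContribution (E.lpWant solve η lam) (fun s => s.2.2) (E.stepLaw q) i
  set W := ∑ i, lam i * (E.rate i - meanUse solve η q 1 i lam)
  have hW : 0 ≤ W := Finset.sum_nonneg fun i _ => mul_nonneg (hl i) (sub_nonneg.2 (hb i).1)
  have hc := three_fifths_le
  have hc1 : 1 - 1 / Real.exp 1 ≤ 1 := by linarith [one_div_pos.2 (Real.exp_pos 1)]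
  set c := 1 - 1 / Real.exp 1
  have e1 : 1 / (32 * E.maxBid) * ∑ i, lam i ^ 2 * meanUse solve η q 2 i lam =
      2 * (1 / (64 * E.maxBid) * ∑ i, lam i ^ 2 * meanUse solve η q 2 i lam) := by
    field_simp; ring
  rw [e1] at h1
  have hS' : 0 ≤ 1 / (64 * E.maxBid) * ∑ i, lam i ^ 2 * meanUse solve η q 2 i lam := by positivity
  -- The part of the waste proportional to Q is covered by the surplus. The remainder is nη + 17nβ ≤
  -- (1/20 + 17/200) εδ = (27/200) εδ.
  have hG : c * v - 27 / 200 * (ε * δ) ≤ G := by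
    have a1 : c * W ≤ W := mul_le_of_le_one_left hW hc1
    have a2 : c * (n * η) ≤ n * η := mul_le_of_le_one_left (by positivity) hc1
    have a3 : c * v ≤ c * E.dualValue q lam := mul_le_mul_of_nonneg_left hvD (by linarith)
    nlinarith
  have hg0 : 0 ≤ c * v - 27 / 200 * (ε * δ) := by nlinarith [mul_pos hε hδ]
  -- With a = ε/10, truncation loses a fraction ε/20 of the arrivals; exploration loses another
  -- ε/100, in total 3ε/50.
  have h3 := E.le_listExp_exploitValue (μ := E.stepLaw q) (K := fun i => E.rate i * m)
    (want := E.lpWant solve η lam)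
    ((h.measurable_lpWant η).comp (measurable_const.prodMk measurable_id))
    measurable_bid (Nat.sub_le m t) hm (fun i => by
      rw [h.wantProb_lpWant η lam hq, mul_comm]
      exact mul_le_mul_of_nonneg_right (hb i).1 hm'.le) (show 0 < ε / 10 by positivity)
  refine le_trans ?_ h3
  rw [Nat.cast_sub htm]
  have h4 : n * E.maxBid * (1 + 1 / (2 * (ε / 10))) ≤ m * (ε * δ / 100) := by
    have : 1 + 1 / (2 * (ε / 10)) ≤ 6 / ε := by
      rw [show 1 / (2 * (ε / 10)) = 5 / ε by field_simp; norm_num, ← sub_nonneg]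
      have : 6 / ε - (1 + 5 / ε) = (1 - ε) / ε := by field_simp; ring
      rw [this]
      exact div_nonneg (by linarith) hε.le
    refine (mul_le_mul_of_nonneg_left this (by positivity)).trans ?_
    rw [mul_div_assoc', div_le_iff₀ hε]
    nlinarith
  have h5 : m * (1 - 3 / 50 * ε) * (c * v - 27 / 200 * (ε * δ)) ≤ (m - t - ε / 10 * m / 2) * G := by
    refine mul_le_mul (by nlinarith) hG hg0 ?_
    nlinarith
  change _ ≤ (m - t - ε / 10 * m / 2) * G - _
  nlinarith

end

/-- The number of grid prices per network. -/
noncomputable def gridSize (x : ℝ) : ℕ := ⌈x⌉₊ + 1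

/-- Both factors are polynomial in X: the grid size by definition, and n/ε because δ ≤ nL gives n/ε
≤ X. The exponent 26 comes from a cubic polynomial whose coefficients are absorbed by 2²³. -/
theorem log_gridSize_le {n L X : ℝ} (hn : 1 ≤ n) (hδ : 0 < δ) (hε : 0 < ε)
    (hδL : δ ≤ n * L) (hX : X = n ^ 2 * L / (δ * ε)) :
    Real.log (gridSize (48000 * X ^ 2 / n) * (100 * n / ε)) ≤ 26 * Real.log (2 + X) := by
  have hX0 : n / ε ≤ X := by
    rw [hX, div_le_div_iff₀ hε (by positivity)]
    have : n * ε * δ ≤ n * ε * (n * L) := mul_le_mul_of_nonneg_left hδL (by positivity)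
    linarith
  have hnε : 0 < n / ε := by positivity
  have hX1 : 0 < X := hnε.trans_le hX0
  rw [show (26 : ℝ) * Real.log (2 + X) = Real.log ((2 + X) ^ 26) by rw [Real.log_pow]; norm_num]
  have hK0 : (0 : ℝ) < gridSize (48000 * X ^ 2 / n) := by unfold gridSize; positivity
  refine Real.log_le_log (by positivity) ?_
  have hK : (gridSize (48000 * X ^ 2 / n) : ℝ) ≤ 48000 * X ^ 2 + 2 := by
    have h1 := (Nat.ceil_lt_add_one (show 0 ≤ 48000 * X ^ 2 / n by positivity)).le
    have h2 : 48000 * X ^ 2 / n ≤ 48000 * X ^ 2 := div_le_self (by positivity) hn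
    unfold gridSize
    push_cast
    linarith
  have h2 : (gridSize (48000 * X ^ 2 / n) : ℝ) * (100 * n / ε) ≤
      (48000 * X ^ 2 + 2) * (100 * X) := by
    refine mul_le_mul hK ?_ (by positivity) (by positivity)
    rw [mul_div_assoc]
    linarith
  refine h2.trans ?_
  have h3 : (48000 * X ^ 2 + 2) * (100 * X) ≤ 8388608 * (2 + X) ^ 3 := by
    nlinarith [pow_pos hX1 3, pow_pos hX1 2]
  have h4 : (8388608 : ℝ) ≤ (2 + X) ^ 23 :=
    le_trans (by norm_num) (pow_le_pow_left₀ (by norm_num : (0 : ℝ) ≤ 2) (by linarith) 23)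
  calc _ ≤ 8388608 * (2 + X) ^ 3 := h3
    _ ≤ (2 + X) ^ 23 * (2 + X) ^ 3 := mul_le_mul_of_nonneg_right h4 (by positivity)
    _ = (2 + X) ^ 26 := by ring

/-- Assembles learning and exploitation: outside an event of weight at most ε/20 the learned
multipliers satisfy `IsSolver.learned_budget`, and on that event the value is only bounded below by
0. -/
theorem IsSolver.le_lpVal_value [Fintype ι] {sol : ι → (Fin n → ℝ) → Fin n → ℝ}
    (hsol : E.IsSolver sol) (hsolve : E.IsSolver solve) (hL : 0 < E.maxBid) (hη : 0 < η) {β : ℝ}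
    (hβ : 0 < β) {q : ι → ℝ} (hq : q ∈ stdSimplex ℝ ι) (hδ : 0 < δ) (hε : 0 < ε) (hε1 : ε < 1)
    {τ : ℝ} (hτt : 576 * E.maxBid * τ ≤ β * t) {K : ℕ}
    {pick : (Fin t → ι) → Fin n → ℕ}
    (hpick : ∀ j, (∀ i, pick j i < K) ∧ ∀ i, 11 * β ≤ 2 * E.maxBid * E.rate i →
      |E.excess sol η β j (gridPrice (2 * E.maxBid) K (E.smallBudget β) (pick j)) i| ≤ β)
    (hw : (K : ℝ) ^ n * (n * (5 * Real.exp (-τ))) ≤ ε / 20)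
    (hnη : n * η ≤ ε * δ / 20) (hnβ : n * β ≤ ε * δ / 200) (ht0 : 0 < t)
    (htm : (t : ℝ) ≤ ε / 100 * m) (hmL : 600 * (n * E.maxBid) ≤ ε ^ 2 * δ * m) {v : ℝ}
    (hv : δ ≤ v) (hvD : ∀ lam, 0 ≤ lam → v ≤ E.dualValue q lam) :
    (1 - 1 / Real.exp 1 - ε) * v ≤ (E.lpVal m t η (E.checkedPrice sol
      fun j => gridPrice (2 * E.maxBid) K (E.smallBudget β) (pick j)) solve).value q m := by
  let _ : MeasurableSpace ι := ⊤
  have hprob := E.isProbabilityMeasure_stepLaw hq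
  have hprice : ∀ j, 0 ≤ gridPrice (2 * E.maxBid) K (E.smallBudget β) (pick j) := fun j i =>
    (gridPrice_mem (by positivity) _ ((hpick j).1 i).le).1
  have hlearn := hsol.isLearner_checkedPrice hprice
  have ht0' : (0 : ℝ) < t := Nat.cast_pos.2 ht0
  have hm0 : (0 : ℝ) < m := by
    by_contra hneg
    nlinarith
  have htm' : t ≤ m := by
    have : (t : ℝ) ≤ m := by nlinarith
    exact_mod_cast this
  set c := 1 - 1 / Real.exp 1 with hc
  have hc35 : 3 / 5 ≤ c := three_fifths_le
  have hc1 : c ≤ 1 := by rw [hc]; linarith [one_div_pos.2 (Real.exp_pos 1)]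
  set g := (1 - 3 / 50 * ε) * (c * v - 27 / 200 * (ε * δ)) - ε * δ / 100 with hg
  have hεδ : ε * δ ≤ ε * v := mul_le_mul_of_nonneg_left hv hε.le
  have hv0 : 0 < v := hδ.trans_le hv
  have hεv : ε * v ≤ v := mul_le_of_le_one_left hv0.le hε1.le
  have hcv : 3 / 5 * v ≤ c * v := mul_le_mul_of_nonneg_right hc35 hv0.le
  have hcv1 : c * v ≤ v := mul_le_of_le_one_left hv0.le hc1
  -- The losses add up to 27/200 + 3/50 + 1/100 = 41/200, using δ ≤ v.
  have hgc : (c - 41 / 200 * ε) * v ≤ g := by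
    have h1 : ε * (c * v - 27 / 200 * (ε * δ)) ≤ ε * v :=
      mul_le_mul_of_nonneg_left (by nlinarith [mul_pos hε hδ]) hε.le
    rw [hg]
    nlinarith
  have hg0 : 0 ≤ g := le_trans (mul_nonneg (by linarith) hv0.le) hgc
  set w := E.gridWeight sol η β K q τ
  have htame : Tame w := hsol.tame_gridWeight hL hq β K τ
  have hwexp : listExp (E.stepLaw q) t w ≤ ε / 20 :=
    (hsol.listExp_gridWeight_le hL hq β K τ t).trans hw
  -- A lower bound in both cases: it is at most m g where the weight is below 1, and nonpositive
  -- elsewhere.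
  have hH : Tame fun e => m * g * (1 - w e) := ((Tame.const 1).sub htame).const_mul _
  have hmain := le_listExp_lpGain (η := η) hlearn hsolve hq htm' hH fun e he => by
    rcases lt_or_ge (w e) 1 with hlt | hge
    · have hb := fun i => hsol.learned_budget hL hη hβ hq ht0 hτt hpick he hlt rfl i
      have hl := learned_nonneg (t := t) (η := η) (checkedPrice_nonneg (solve := sol) hprice) e
      have h1 := hsolve.le_listExp_of_budget (t := t) hL hη hq hδ hε hε1 hl
        (fun i => by
          -- The budgets were established for the solver used in learning; mean uses do not depend
          -- on the solver.
          rw [hsolve.meanUse_eq hsol hη, hsolve.meanUse_eq hsol hη]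
          exact hb i) hnη hnβ hv (hvD _ hl) (Nat.cast_pos.1 hm0) htm hmL
      refine le_trans ?_ h1
      have hw0 : 0 ≤ w e := Finset.sum_nonneg fun y _ => Finset.sum_nonneg fun i _ =>
        Finset.sum_nonneg fun k _ => expWeight_nonneg _ _ _
      exact mul_le_of_le_one_right (mul_nonneg hm0.le hg0) (by linarith)
    · refine le_trans ?_ (integral_nonneg fun ω => E.exploitValue_nonneg _ _ _ _)
      exact mul_nonpos_of_nonneg_of_nonpos (mul_nonneg hm0.le hg0) (by linarith)
  rw [lpVal_value_eq hlearn hsolve hq htm', le_div_iff₀ hm0]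
  refine le_trans ?_ hmain
  rw [listExp_const_mul, listExp_sub (Tame.const 1) htame, listExp_const]
  have h1 : m * g * (1 - ε / 20) ≤ m * g * (1 - listExp (E.stepLaw q) t w) :=
    mul_le_mul_of_nonneg_left (by linarith) (mul_nonneg hm0.le hg0)
  refine le_trans ?_ h1
  have h2 : (c - ε) * v ≤ g * (1 - ε / 20) := by
    have h3 : (c - 41 / 200 * ε) * v * (1 - ε / 20) ≤ g * (1 - ε / 20) :=
      mul_le_mul_of_nonneg_right hgc (by linarith)
    nlinarith
  nlinarith

/-- Fixes the parameters: the perturbation costs εδ/20 in total, the additive errors β are 1/200 of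
εδ in total, the grid is as fine as the Lipschitz constant requires, and τ makes the union bound
equal to ε/20. -/
theorem IsSolver.exists_learner [Fintype ι] {sol : ι → (Fin n → ℝ) → Fin n → ℝ}
    (hsol : E.IsSolver sol) (hδ : 0 < δ) (hε : 0 < ε) (hε1 : ε < 1) (hδL : δ ≤ n * E.maxBid)
    (ht : 3000000 * E.sampleScale δ ε * Real.log (2 + E.sampleScale δ ε) ≤ t) :
    ∃ (η : ℝ) (learn : E.Sample t → Fin n → ℝ), 0 < η ∧ n * η ≤ ε * δ ∧ E.IsLearner t learn ∧
      ∀ solve, E.IsSolver solve → ∀ q ∈ stdSimplex ℝ ι, ∀ m : ℕ, 3000000 * t / ε ≤ m →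
      ∀ v, δ ≤ v → (∀ lam, 0 ≤ lam → v ≤ E.dualValue q lam) →
        (1 - 1 / Real.exp 1 - ε) * v ≤ (E.lpVal m t η learn solve).value q m := by
  have hnL : 0 < n * E.maxBid := hδ.trans_le hδL
  have hL : 0 < E.maxBid := E.maxBid_nonneg.lt_of_ne fun h => by simp [← h] at hnL
  have hn0 : (0 : ℝ) < n := by
    by_contra hneg
    rw [le_antisymm (not_lt.1 hneg) (Nat.cast_nonneg n), zero_mul] at hnL
    exact lt_irrefl _ hnL
  have hn : (1 : ℝ) ≤ n := by exact_mod_cast Nat.cast_pos.1 hn0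
  set L := E.maxBid with hLdef
  set X := E.sampleScale δ ε with hX
  have hXdef : X = (n : ℝ) ^ 2 * L / (δ * ε) := rfl
  have hXpos : 0 < X := by rw [hXdef]; positivity
  set η := ε * δ / (20 * n) with hη
  set β := ε * δ / (200 * n) with hβ
  set K := gridSize (48000 * X ^ 2 / n) with hK
  set τ := n * Real.log K + Real.log (100 * n / ε) with hτ
  have hη0 : 0 < η := by positivity
  have hβ0 : 0 < β := by positivity
  have hnη : n * η = ε * δ / 20 := by rw [hη]; field_simp
  have hnβ : n * β = ε * δ / 200 := by rw [hβ]; field_simp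
  have hK0 : 0 < K := Nat.succ_pos _
  have hK1 : (1 : ℝ) ≤ K := by exact_mod_cast hK0
  have hlogK : 0 ≤ Real.log K := Real.log_nonneg hK1
  have hε100 : 1 ≤ 100 * n / ε := by rw [le_div_iff₀ hε]; linarith
  have hlogε : 0 ≤ Real.log (100 * n / ε) := Real.log_nonneg hε100
  have hKle : 3 * n * (2 * L) ^ 2 / (η * β) ≤ K := by
    have : 3 * n * (2 * L) ^ 2 / (η * β) = 48000 * X ^ 2 / n := by
      rw [hη, hβ, hXdef]; field_simp; ring
    rw [this, hK, gridSize]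
    push_cast
    linarith [Nat.le_ceil (48000 * X ^ 2 / n)]
  have hηL : η ≤ n * (2 * L) := by
    have : n * η ≤ n * (n * (2 * L)) := by
      rw [hnη]
      nlinarith
    exact le_of_mul_le_mul_left this hn0
  have hτX : τ ≤ n * (26 * Real.log (2 + X)) := by
    have h1 := log_gridSize_le hn hδ hε hδL hXdef
    rw [Real.log_mul (by positivity) (by positivity)] at h1
    have h2 : Real.log (100 * n / ε) ≤ n * Real.log (100 * n / ε) := le_mul_of_one_le_left hlogε hn
    calc τ ≤ n * (Real.log K + Real.log (100 * n / ε)) := by rw [hτ, mul_add]; linarith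
      _ ≤ _ := mul_le_mul_of_nonneg_left h1 hn0.le
  have hlog2 : 69 / 100 ≤ Real.log (2 + X) :=
    le_trans (by linarith [Real.log_two_gt_d9]) (Real.log_le_log two_pos (by linarith))
  -- This inequality dictates the sample size: 576 · 200 · 26 ≤ 3000000.
  have hτt : 576 * L * τ ≤ β * t := by
    have h1 : 576 * L * τ ≤ β * (115200 * X * (26 * Real.log (2 + X))) := by
      refine (mul_le_mul_of_nonneg_left hτX (by positivity)).trans (le_of_eq ?_)
      rw [hβ, hXdef]; field_simp; ring
    refine h1.trans (mul_le_mul_of_nonneg_left (le_trans ?_ ht) hβ0.le)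
    nlinarith [mul_pos hXpos (show 0 < Real.log (2 + X) by linarith)]
  have htX : 2000000 * X ≤ t := le_trans (by nlinarith) ht
  have ht0 : 0 < t := Nat.cast_pos.1 (lt_of_lt_of_le (by positivity : 0 < 2000000 * X) htX)
  have hw : (K : ℝ) ^ n * (n * (5 * Real.exp (-τ))) ≤ ε / 20 := by
    refine le_of_eq ?_
    rw [hτ, Real.exp_neg, Real.exp_add, ← Real.log_pow, Real.exp_log (by positivity),
      Real.exp_log (by positivity)]
    field_simp
    norm_num
  clear_value τ K η β
  choose pick hpick using fun j : Fin t → ι =>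
    hsol.exists_gridPrice hL hη0 hβ0 hηL hK0 hKle j
  have hprice : ∀ j, 0 ≤ gridPrice (2 * L) K (E.smallBudget β) (pick j) := fun j i =>
    (gridPrice_mem (by positivity) _ ((hpick j).1 i).le).1
  refine ⟨η, E.checkedPrice sol fun j => gridPrice (2 * L) K (E.smallBudget β) (pick j), hη0,
    by rw [hnη]; nlinarith [mul_pos hε hδ], hsol.isLearner_checkedPrice hprice, ?_⟩
  intro solve hsolve q hq m hm v hv hvD
  have htm : (t : ℝ) ≤ ε / 100 * m := by
    rw [div_le_iff₀ hε] at hm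
    have : (0 : ℝ) ≤ t := Nat.cast_nonneg t
    linarith
  have hmL : 600 * (n * L) ≤ ε ^ 2 * δ * m := by
    have h1 : n * L ≤ ε * δ * X := by
      rw [hXdef, show ε * δ * ((n : ℝ) ^ 2 * L / (δ * ε)) = n * (n * L) by field_simp]
      exact le_mul_of_one_le_left hnL.le hn
    have h3 : 600 * X ≤ ε * m := by
      rw [div_le_iff₀ hε] at hm
      linarith
    have h4 : ε * δ * (600 * X) ≤ ε * δ * (ε * m) := mul_le_mul_of_nonneg_left h3 (by positivity)
    calc 600 * (n * L) ≤ 600 * (ε * δ * X) := mul_le_mul_of_nonneg_left h1 (by norm_num)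
      _ = ε * δ * (600 * X) := by ring
      _ ≤ ε * δ * (ε * m) := h4
      _ = ε ^ 2 * δ * m := by ring
  exact hsol.le_lpVal_value hsolve hL hη0 hβ0 hq hδ hε hε1 hτt hpick hw hnη.le hnβ.le ht0
    htm hmL hv hvD

end Exchange

/-! ### The theorem -/

theorem theorem1 :
    ∃ (C : ℝ) (k : ℕ), 0 < C ∧
      ∀ (n M : ℕ) (ι : Type) [Fintype ι] (E : Exchange n M ι) (δ ε : ℝ), 0 < δ → 0 < ε →
      ∀ t : ℕ, C * E.sampleScale δ ε * Real.log (2 + E.sampleScale δ ε) ^ k ≤ t →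
      ∃ (η : ℝ) (learn : E.Sample t → Fin n → ℝ), 0 < η ∧ n * η ≤ ε * δ ∧ E.IsLearner t learn ∧
      ∀ solve : ι → (Fin n → ℝ) → Fin n → ℝ, E.IsSolver solve →
      ∀ q ∈ stdSimplex ℝ ι, ∀ m : ℕ, C * t / ε ≤ m →
        (∃ P : E.Policy, P.Admissible m ∧ δ ≤ P.value q m) →
        (E.lpVal m t η learn solve).Admissible m ∧
        ∀ P : E.Policy, P.Admissible m →
          (1 - 1 / Real.exp 1 - ε) * P.value q m ≤ (E.lpVal m t η learn solve).value q m := by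
  refine ⟨3000000, 1, by norm_num, ?_⟩
  intro n M ι _ E δ ε hδ hε t ht
  rw [pow_one] at ht
  let _ : MeasurableSpace ι := ⊤
  -- Outside this case any learning rule does: the claim is vacuous or, for ε ≥ 1, its lower bound
  -- is nonpositive.
  by_cases hmain : (∃ sol, E.IsSolver sol) ∧ ε < 1 ∧ δ ≤ n * E.maxBid
  · obtain ⟨⟨sol, hsol⟩, hε1, hδL⟩ := hmain
    obtain ⟨η, learn, hη, hηδ, hlearn, hval⟩ := hsol.exists_learner hδ hε hε1 hδL ht
    refine ⟨η, learn, hη, hηδ, hlearn, fun solve hsolve q hq m hm ⟨P₀, hP₀, hδP⟩ =>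
      ⟨Exchange.lpVal_admissible hlearn hsolve, fun P hP => ?_⟩⟩
    have hm0 : 0 < m := by
      rcases Nat.eq_zero_or_pos m with rfl | h
      · rw [Exchange.value_zero] at hδP; linarith
      · exact h
    have h0 := hval solve hsolve q hq m hm _ hδP fun lam hl => hsolve.value_le hq hl hm0 hP₀
    -- A policy worth less than δ is dominated by the given one worth at least δ, if the factor is
    -- nonnegative.
    rcases le_or_gt δ (P.value q m) with hPδ | hPδ
    · exact hval solve hsolve q hq m hm _ hPδ fun lam hl => hsolve.value_le hq hl hm0 hP
    · rcases le_or_gt 0 (1 - 1 / Real.exp 1 - ε) with hc | hc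
      · exact (mul_le_mul_of_nonneg_left (hPδ.le.trans hδP) hc).trans h0
      · exact (mul_nonpos_of_nonpos_of_nonneg hc.le (Exchange.value_nonneg hq m P)).trans
          (Exchange.value_nonneg hq m _)
  · refine ⟨ε * δ / (n + 1), fun σ => E.safePrice fun s => (σ s).2, by positivity, ?_,
      E.isLearner_safePrice t, fun solve hsolve q hq m hm ⟨P₀, hP₀, hδP⟩ =>
      ⟨Exchange.lpVal_admissible (E.isLearner_safePrice t) hsolve, fun P hP => ?_⟩⟩
    · rw [mul_div_assoc', div_le_iff₀ (by positivity)]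
      nlinarith [mul_pos hε hδ]
    · have hm0 : 0 < m := by
        rcases Nat.eq_zero_or_pos m with rfl | h
        · rw [Exchange.value_zero] at hδP; linarith
        · exact h
      -- The dual at prices L is at most nL, so a policy of performance δ forces δ ≤ nL. As a solver
      -- is given too, only ε ≥ 1 remains.
      have hδL : δ ≤ n * E.maxBid := hδP.trans ((hsolve.value_le hq
        (fun _ => E.maxBid_nonneg) hm0 hP₀).trans (Exchange.dualValue_maxBid_le q))
      have hε1 : 1 ≤ ε := le_of_not_gt fun h => hmain ⟨⟨solve, hsolve⟩, h, hδL⟩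
      have hc : 1 - 1 / Real.exp 1 - ε ≤ 0 := by linarith [one_div_pos.2 (Real.exp_pos 1)]
      exact (mul_nonpos_of_nonpos_of_nonneg hc (Exchange.value_nonneg hq m P)).trans
        (Exchange.value_nonneg hq m _)
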